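/- Let $(E,d)$ be a metric space with a doubling Borel measure $\mu$ (balls have positive finite measure and $\mu(B(u,2t))\le c\,\mu(B(u,t))$), and let $\mathscr D=\bigcup_{k\in\mathbb Z}\mathscr D_k$ be a system of dyadic cubes: for some $\delta\in(0,1)$ and $r_0,r_1>0$, each $\mathscr D_k$ is a countable partition of $E$, up to $\mu$-null sets, into measurable sets $Q$ with $B(z_Q,r_0\delta^k)\subseteq Q\subseteq B(z_Q,r_1\delta^k)$ for some $z_Q\in E$, and every $P\in\mathscr D_{k+1}$ is contained in some $Q\in\mathscr D_k$. Put $\langle f\rangle_Q=\mu(Q)^{-1}\int_Q f\,d\mu$, $\mathbb E_i f=\sum_{Q\in\mathscr D_i}1_Q\langle f\rangle_Q$, $\mathbb D_i f=\mathbb E_{i+1}f-\mathbb E_i f$. A scalar function $b$, integrable on each cube, belongs to $\mathrm{BMO}^2(\mathscr D)$ if $$\|b\|_{\mathrm{BMO}^2(\mathscr D)}:=\sup_{Q\in\mathscr D}\Big(\frac1{\mu(Q)}\int_Q|b-\langle b\rangle_Q|^2d\mu\Big)^{1/2}<\infty.$$ For integers $\sigma\le\tau$ let $n=\tau-\sigma+1$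 and define $$\Pi_b^{\sigma,\tau}f=\sum_{i=\sigma}^{\tau}\mathbb D_i b\;\mathbb E_i f,\qquad (\Pi_b^{\sigma,\tau})^*f=\sum_{i=\sigma}^{\tau}\mathbb E_i(\mathbb D_i b\, f).$$ A Banach space $X$ has martingale type $p$ if, for some $r\in(1,\infty)$, there is a constant $C$ such that every finite martingale $(f_k)_{k=0}^N$ in $L_r$ of any probability space with values in $X$ satisfies $\|f_N\|_{L_r(X)}\le C\|(\|f_0\|^p+\sum_{k=1}^N\|f_k-f_{k-1}\|^p)^{1/p}\|_{L_r}$; it has martingale cotype $q$ if, for some $r\in(1,\infty)$ and some $C$, always $\|(\|f_0\|^q+\sum_{k=1}^N\|f_k-f_{k-1}\|^q)^{1/q}\|_{L_r}\le C\|f_N\|_{L_r(X)}$. Let $X$ be a real or complex Banach space (not assumed to be UMD), let $b$ have values in its scalar field, and let $s\in(1,\infty)$. The constants $C$ below depend only on $X$, $s$, $c$, $\delta$, $r_0$, $r_1$ and, where present, on $p$ or $q$. 1. If $X$ has martingale type $p\in[1,2]$, then for all $b\in\mathrm{BMO}^2(\mathscr D)$, $\sigma\le\tau$ and $f\in L_s(\mu;X)$,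 $$\|\Pi_b^{\sigma,\tau}f\|_{L_s(\mu;X)}\le C\,n^{1/p-1/2}\,\|b\|_{\mathrm{BMO}^2(\mathscr D)}\,\|f\|_{L_s(\mu;X)}.$$ 2. If $X$ has martingale type $2$, then for every $b\in\mathrm{BMO}^2(\mathscr D)$ the limit $\Pi_b f=\lim_{\sigma\to-\infty,\,\tau\to\infty}\Pi_b^{\sigma,\tau}f$ exists in $L_s(\mu;X)$ for every $f\in L_s(\mu;X)$, and $\Pi_b$ is a bounded linear operator on $L_s(\mu;X)$ of norm at most $C\|b\|_{\mathrm{BMO}^2(\mathscr D)}$. 3. If $X$ has martingale cotype $q\in[2,\infty)$, then for all $b\in\mathrm{BMO}^2(\mathscr D)$, $\sigma\le\tau$ and $f\in L_s(\mu;X)$, $$\|(\Pi_b^{\sigma,\tau})^*f\|_{L_s(\mu;X)}\le C\,n^{1/2-1/q}\,\|b\|_{\mathrm{BMO}^2(\mathscr D)}\,\|f\|_{L_s(\mu;X)},$$ and $(\Pi_b^{\sigma,\tau})^*$ is dual to the paraproduct on $X'$-valued functions: $\int_E\langle(\Pi_b^{\sigma,\tau})^*f,g\rangle\,d\mu=\int_E\langle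 f,\Pi_b^{\sigma,\tau}g\rangle\,d\mu$ for all $g\in L_{s'}(\mu;X')$, $1/s+1/s'=1$. -/

import Mathlib

open MeasureTheory ProbabilityTheory Filter Topology
open scoped ENNReal NNReal

universe u v w

noncomputable section

/-- Martingale type `p`: for some `s ∈ (1, ∞)`, every finite martingale `f 0, …, f N` in `L_s` of
an arbitrary probability space satisfies
`‖f N‖_{L_s} ≤ C ‖(‖f 0‖ ^ p + ∑ ‖f (n + 1) - f n‖ ^ p) ^ (1 / p)‖_{L_s}`. -/
def HasMartingaleType (X : Type v) [NormedAddCommGroup X] [NormedSpace ℝ X] [CompleteSpace X]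
    (p : ℝ) : Prop :=
  ∃ s : ℝ≥0∞, 1 < s ∧ s ≠ ∞ ∧ ∃ C : ℝ≥0,
    ∀ (Ω : Type u) [mΩ : MeasurableSpace Ω] (P : Measure Ω) [IsProbabilityMeasure P]
      (ℱ : Filtration ℕ mΩ) (f : ℕ → Ω → X), Martingale f ℱ P →
      ∀ N : ℕ, (∀ n ≤ N, MemLp (f n) s P) →
        eLpNorm (f N) s P ≤
          C * eLpNorm (fun ω => (‖f 0 ω‖ ^ p
            + ∑ n ∈ Finset.range N, ‖f (n + 1) ω - f n ω‖ ^ p) ^ (1 / p)) s P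

/-- Martingale cotype `q`: the reverse inequality, for some `s ∈ (1, ∞)`. -/
def HasMartingaleCotype (X : Type v) [NormedAddCommGroup X] [NormedSpace ℝ X] [CompleteSpace X]
    (q : ℝ) : Prop :=
  ∃ s : ℝ≥0∞, 1 < s ∧ s ≠ ∞ ∧ ∃ C : ℝ≥0,
    ∀ (Ω : Type u) [mΩ : MeasurableSpace Ω] (P : Measure Ω) [IsProbabilityMeasure P]
      (ℱ : Filtration ℕ mΩ) (f : ℕ → Ω → X), Martingale f ℱ P →
      ∀ N : ℕ, (∀ n ≤ N, MemLp (f n) s P) →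
        eLpNorm (fun ω => (‖f 0 ω‖ ^ q
            + ∑ n ∈ Finset.range N, ‖f (n + 1) ω - f n ω‖ ^ q) ^ (1 / q)) s P ≤
          C * eLpNorm (f N) s P

/-- A doubling measure: balls have positive finite measure and
`μ (B (x, 2 t)) ≤ c * μ (B (x, t))`. -/
structure IsDoublingMeasure {E : Type u} [MetricSpace E] [MeasurableSpace E]
    (μ : Measure E) (c : ℝ≥0) : Prop where
  ball_pos : ∀ (x : E) (t : ℝ), 0 < t → 0 < μ (Metric.ball x t)
  ball_lt_top : ∀ (x : E) (t : ℝ), μ (Metric.ball x t) < ∞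
  doubling : ∀ (x : E) (t : ℝ), 0 < t → μ (Metric.ball x (2 * t)) ≤ c * μ (Metric.ball x t)

/-- A system of dyadic cubes: for every `k : ℤ` a countable partition of the space (up to null
sets, such as the boundaries of open or closed cubes) into measurable sets comparable with balls of
radius `δ ^ k`, every cube of generation `k + 1` being contained in a cube of generation `k`. -/
structure DyadicSystem {E : Type u} [MetricSpace E] [MeasurableSpace E]
    (μ : Measure E) (δ r₀ r₁ : ℝ) where
  cubes : ℤ → Set (Set E)
  countable : ∀ k, (cubes k).Countable
  measurableSet : ∀ k, ∀ Q ∈ cubes k, MeasurableSet Q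
  aedisjoint : ∀ k, (cubes k).Pairwise (AEDisjoint μ)
  ae_cover : ∀ k, ∀ᵐ x ∂μ, x ∈ ⋃₀ cubes k
  nested : ∀ k, ∀ P ∈ cubes (k + 1), ∃ Q ∈ cubes k, P ⊆ Q
  ball : ∀ k, ∀ Q ∈ cubes k, ∃ z : E,
    Metric.ball z (r₀ * δ ^ k) ⊆ Q ∧ Q ⊆ Metric.ball z (r₁ * δ ^ k)

namespace DyadicSystem

variable {E : Type u} [MetricSpace E] [MeasurableSpace E] {μ : Measure E} {δ r₀ r₁ : ℝ}

/-- The averaging operator `E_i f = ∑_{Q ∈ D_i} 1_Q ⟨f⟩_Q`. -/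
def avg (D : DyadicSystem μ δ r₀ r₁) {Y : Type v} [NormedAddCommGroup Y] [NormedSpace ℝ Y]
    (i : ℤ) (f : E → Y) (x : E) : Y :=
  ∑' Q : D.cubes i, (Q : Set E).indicator (fun _ => ⨍ y in (Q : Set E), f y ∂μ) x

/-- The difference operator `D_i f = E_{i+1} f - E_i f`. -/
def diff (D : DyadicSystem μ δ r₀ r₁) {Y : Type v} [NormedAddCommGroup Y] [NormedSpace ℝ Y]
    (i : ℤ) (f : E → Y) (x : E) : Y :=
  D.avg (i + 1) f x - D.avg i f x

/-- The dyadic `BMO²` norm `sup_Q (μ(Q)⁻¹ ∫_Q |b - ⟨b⟩_Q|² dμ) ^ (1/2)`, with values in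
`[0, ∞]`. -/
def bmoNorm (D : DyadicSystem μ δ r₀ r₁) {𝕜 : Type w} [RCLike 𝕜] (b : E → 𝕜) : ℝ≥0∞ :=
  ⨆ (k : ℤ) (Q ∈ D.cubes k),
    ((μ Q)⁻¹ * ∫⁻ x in Q, ‖b x - ⨍ y in Q, b y ∂μ‖ₑ ^ (2 : ℝ) ∂μ) ^ (1 / 2 : ℝ)

/-- `b` is measurable, integrable on every cube, and has finite dyadic `BMO²` norm. -/
structure MemBMO (D : DyadicSystem μ δ r₀ r₁) {𝕜 : Type w} [RCLike 𝕜] (b : E → 𝕜) : Prop where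
  aestronglyMeasurable : AEStronglyMeasurable b μ
  integrableOn : ∀ k, ∀ Q ∈ D.cubes k, IntegrableOn b Q μ
  bmoNorm_lt_top : D.bmoNorm b < ∞

/-- The truncated dyadic paraproduct `∑_{i=σ}^τ D_i b · E_i f`. -/
def paraproduct (D : DyadicSystem μ δ r₀ r₁) {𝕜 : Type w} [RCLike 𝕜] {Y : Type v}
    [NormedAddCommGroup Y] [NormedSpace ℝ Y] [NormedSpace 𝕜 Y]
    (b : E → 𝕜) (σ τ : ℤ) (f : E → Y) (x : E) : Y :=
  ∑ i ∈ Finset.Icc σ τ, D.diff i b x • D.avg i f x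

/-- The truncated dual paraproduct `∑_{i=σ}^τ E_i (D_i b · f)`. -/
def dualParaproduct (D : DyadicSystem μ δ r₀ r₁) {𝕜 : Type w} [RCLike 𝕜] {Y : Type v}
    [NormedAddCommGroup Y] [NormedSpace ℝ Y] [NormedSpace 𝕜 Y]
    (b : E → 𝕜) (σ τ : ℤ) (f : E → Y) (x : E) : Y :=
  ∑ i ∈ Finset.Icc σ τ, D.avg i (fun y => D.diff i b y • f y) x

end DyadicSystem

end

/-! Inside a cube `Q` of generation `σ`, with normalised measure, the averages `φ_i = E_i f` (`i ≥
σ`) form a martingale and the scalars `d_i = D_i b` form a martingale difference sequence. The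
truncated paraproduct is therefore a martingale transform `∑ d_i φ_i`, and since all its operators
act inside `Q`, a bound on each `Q` gives a global one. Only two facts about `b` enter, with `B` its
BMO norm. Doubling gives the pointwise bound `|d_i| ≤ L B`. Orthogonality gives the Carleson
property: the integral of `∑_{j ≥ i} |d_j|²` over an event `A` known at time `i` is at most `B²
P(A)`.

The `L_s` bound comes from a good-`λ` inequality between the maximal functions of the partial sums
`G` and of `φ` (`good_lambda_paraproduct`). Only the steps between the passages of `‖G‖` above `t`
and above `2t` are kept, and they stop once `‖φ‖` exceeds `γt` or the square sum of the `d_j`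
accumulated since the first passage exceeds `(KB)²`. The increments of the stopped transform then
have an `ℓ²` norm of order at most `γtB`; passing to `ℓ^p` over `n` terms costs `n^(1/p - 1/2)`, and
martingale type `p` with Chebyshev bounds the chance of climbing from `t` to `2t`. The Carleson
property bounds the chance of stopping because of the square sum. Integrating in `t` and applying
Doob's inequality to `φ` gives every `s ∈ (1, ∞)` from type at a single exponent. No
unconditionality is used, because the factors `d_i` are scalar and their square function is
controlled directly.

For cotype `q`, the dual space has martingale type `q'` with `1/q' - 1/2 = 1/2 - 1/q`
(`HasMartingaleCotype.hasMartingaleType_dual`). The dual paraproduct is paired with simple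
`X'`-valued functions, and averages being self-adjoint moves the paraproduct onto them.

For type `2` the factor in `n` disappears, so the truncations are uniformly bounded and convergence
is needed only on a dense set. For an indicator times a vector it is a scalar question: the summands
are orthogonal in `L_2` with summable squares, so outer blocks are small in `L_2`, and interpolation
with a uniform `L_t` bound makes them small in `L_s`. -/

noncomputable section

/-! ### Good-`λ` integration and Doob's maximal inequality. -/

section Maximal

variable {Ω : Type*} {mΩ : MeasurableSpace Ω} {P : Measure Ω}

/-- Integrated form of a good-`λ` inequality. -/
theorem lintegral_rpow_le_of_good_lambda {M F : Ω → ℝ} (hM : 0 ≤ M) (hF : 0 ≤ F)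
    (hMm : AEMeasurable M P) (hFm : AEMeasurable F P) {s γ : ℝ} (hs : 0 < s) (hγ : 0 < γ)
    (hgood : ∀ t : ℝ, 0 < t → P {ω | 2 * t < M ω} ≤
      P {ω | γ * t < F ω} + ENNReal.ofReal ((2 * 2 ^ s)⁻¹) * P {ω | t < M ω})
    (hfin : ∫⁻ ω, ENNReal.ofReal (M ω ^ s) ∂P ≠ ∞) :
    ∫⁻ ω, ENNReal.ofReal (M ω ^ s) ∂P ≤
      ENNReal.ofReal (2 * (2 / γ) ^ s) * ∫⁻ ω, ENNReal.ofReal (F ω ^ s) ∂P := by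
  have h2s : (0 : ℝ) < 2 ^ s := by positivity
  have scale : ∀ (G : Ω → ℝ), 0 ≤ G → ∀ a : ℝ, 0 < a →
      ∫⁻ ω, ENNReal.ofReal ((G ω / a) ^ s) ∂P
        = ENNReal.ofReal ((a ^ s)⁻¹) * ∫⁻ ω, ENNReal.ofReal (G ω ^ s) ∂P := by
    intro G hG a ha
    rw [← lintegral_const_mul' _ _ ENNReal.ofReal_ne_top]
    congr 1 with ω
    rw [← ENNReal.ofReal_mul (by positivity), Real.div_rpow (hG ω) ha.le, div_eq_inv_mul]
  have layer : ∀ (G : Ω → ℝ), 0 ≤ G → AEMeasurable G P → ∀ a : ℝ, 0 < a →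
      ∫⁻ ω, ENNReal.ofReal ((G ω / a) ^ s) ∂P
        = ENNReal.ofReal s * ∫⁻ t in Set.Ioi (0 : ℝ),
          P {ω | a * t < G ω} * ENNReal.ofReal (t ^ (s - 1)) := by
    intro G hG hGm a ha
    rw [lintegral_rpow_eq_lintegral_meas_lt_mul P
      (ae_of_all _ fun ω => div_nonneg (hG ω) ha.le) (hGm.div_const a) hs]
    simp_rw [lt_div_iff₀' ha]
  have key : ENNReal.ofReal ((2 ^ s)⁻¹) * ∫⁻ ω, ENNReal.ofReal (M ω ^ s) ∂P ≤
      ENNReal.ofReal ((γ ^ s)⁻¹) * ∫⁻ ω, ENNReal.ofReal (F ω ^ s) ∂P +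
        ENNReal.ofReal ((2 * 2 ^ s)⁻¹) * ∫⁻ ω, ENNReal.ofReal (M ω ^ s) ∂P := by
    have h1 : ∫⁻ ω, ENNReal.ofReal (M ω ^ s) ∂P = ENNReal.ofReal s * ∫⁻ t in Set.Ioi (0 : ℝ),
          P {ω | t < M ω} * ENNReal.ofReal (t ^ (s - 1)) := by
      have := layer M hM hMm 1 one_pos
      simpa using this
    rw [← scale M hM 2 two_pos, ← scale F hF γ hγ, layer M hM hMm 2 two_pos,
      layer F hF hFm γ hγ, h1, mul_left_comm, ← mul_add,
      ← lintegral_const_mul' (ENNReal.ofReal ((2 * 2 ^ s)⁻¹)) _ ENNReal.ofReal_ne_top,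
      ← lintegral_add_left']
    · refine mul_le_mul' le_rfl ?_
      refine setLIntegral_mono' measurableSet_Ioi fun t ht => ?_
      rw [← mul_assoc, ← add_mul]
      gcongr
      exact hgood t ht
    · have : Antitone fun t : ℝ => P {ω | γ * t < F ω} := fun a b hab =>
        measure_mono fun ω (h : γ * b < F ω) => lt_of_le_of_lt (by gcongr) h
      exact (this.measurable.mul (by fun_prop)).aemeasurable
  set I := ∫⁻ ω, ENNReal.ofReal (M ω ^ s) ∂P
  set J := ∫⁻ ω, ENNReal.ofReal (F ω ^ s) ∂P
  -- The weight in the good-`λ` inequality is exactly half of `2 ^ (-s)`, so one of the two halves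
  -- on the left absorbs the last term. The cancellation needs `hfin`.
  have hsplit : ENNReal.ofReal ((2 ^ s)⁻¹) * I =
      ENNReal.ofReal ((2 * 2 ^ s)⁻¹) * I + ENNReal.ofReal ((2 * 2 ^ s)⁻¹) * I := by
    rw [← add_mul, ← ENNReal.ofReal_add (by positivity) (by positivity)]
    congr 2
    field_simp
    norm_num
  rw [hsplit] at key
  have key2 := (ENNReal.add_le_add_iff_right
    (ENNReal.mul_ne_top ENNReal.ofReal_ne_top hfin)).1 key
  calc I = ENNReal.ofReal (2 * 2 ^ s) * (ENNReal.ofReal ((2 * 2 ^ s)⁻¹) * I) := by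
        rw [← mul_assoc, ← ENNReal.ofReal_mul (by positivity), mul_inv_cancel₀ (by positivity)]
        simp
    _ ≤ ENNReal.ofReal (2 * 2 ^ s) * (ENNReal.ofReal ((γ ^ s)⁻¹) * J) := by gcongr
    _ = _ := by
        rw [← mul_assoc, ← ENNReal.ofReal_mul (by positivity), Real.div_rpow two_pos.le hγ.le,
          div_eq_mul_inv, mul_assoc]

/-- Doob's maximal inequality in `L_s`. -/
theorem lintegral_sup_rpow_le_of_submartingale [IsFiniteMeasure P] {ℱ : Filtration ℕ mΩ}
    {m : ℕ → Ω → ℝ} (hm : Submartingale m ℱ P) (hm0 : 0 ≤ m) {s : ℝ} (hs : 1 < s) (n : ℕ) :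
    ∫⁻ ω, ENNReal.ofReal
        (((Finset.range (n + 1)).sup' Finset.nonempty_range_add_one fun k => m k ω) ^ s) ∂P ≤
      ENNReal.ofReal (2 ^ s * (s / (s - 1))) * ∫⁻ ω, ENNReal.ofReal (m n ω ^ s) ∂P := by
  have hmm : ∀ k, Measurable (m k) := fun k => ((hm.1 k).mono (ℱ.le k)).measurable
  set M : Ω → ℝ := fun ω =>
    (Finset.range (n + 1)).sup' Finset.nonempty_range_add_one fun k => m k ω with hMdef
  have hMm : Measurable M := by
    have := Finset.measurable_range_sup'' (f := m) (n := n) fun k _ => hmm k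
    exact this
  have hnM : ∀ ω, m n ω ≤ M ω := fun ω =>
    Finset.le_sup' (fun k => m k ω) (Finset.self_mem_range_succ n)
  have hM0 : ∀ ω, 0 ≤ M ω := fun ω => (hm0 n ω).trans (hnM ω)
  have hs0 : 0 < s := by linarith
  -- With `ν = m_n P`, the weak-type bound compares distribution functions, and the layer-cake
  -- formula applies with exponent `s` to `M / 2` under `P` and with exponent `s - 1` to `m_n` under
  -- `ν`.
  set ν : Measure Ω := P.withDensity fun ω => ENNReal.ofReal (m n ω)
  have weak : ∀ t : ℝ, 0 < t → ENNReal.ofReal t * P {ω | t < M ω / 2} ≤ ν {ω | t < m n ω} := by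
    intro t ht
    set A : Set Ω := {ω | 2 * t ≤ M ω}
    have hA : MeasurableSet A := measurableSet_le measurable_const hMm
    have h1 : ENNReal.ofReal (2 * t) * P A ≤ ENNReal.ofReal (∫ ω in A, m n ω ∂P) := by
      have := maximal_ineq hm hm0 (ε := ⟨2 * t, by positivity⟩) n
      rw [ENNReal.ofReal, Real.toNNReal_of_nonneg (by positivity : (0 : ℝ) ≤ 2 * t)]
      exact this
    have h2 : ENNReal.ofReal (∫ ω in A, m n ω ∂P) = ∫⁻ ω in A, ENNReal.ofReal (m n ω) ∂P :=
      ofReal_integral_eq_lintegral_ofReal (hm.2.2 n).integrableOn (ae_of_all _ fun ω => hm0 n ω)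
    have hB : MeasurableSet {ω | t < m n ω} := measurableSet_lt measurable_const (hmm n)
    -- The part of `A` where `m_n ≤ t` contributes at most `t P(A)`, half of the left side `2t P(A)`
    -- of the maximal inequality, and is absorbed.
    have h3 : ∫⁻ ω in A, ENNReal.ofReal (m n ω) ∂P ≤
        ν {ω | t < m n ω} + ENNReal.ofReal t * P A := by
      rw [withDensity_apply _ hB, ← lintegral_indicator hA, ← lintegral_indicator hB,
        ← lintegral_indicator_const hA, ← lintegral_add_left
        ((hmm n).ennreal_ofReal.indicator hB)]
      refine lintegral_mono fun ω => ?_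
      by_cases h : t < m n ω
      · by_cases h' : ω ∈ A <;> simp [Set.indicator, h, h']
      · by_cases h' : ω ∈ A
        · simp only [Set.indicator, h, h', Set.mem_ofPred_eq, if_true, if_false, zero_add]
          exact ENNReal.ofReal_le_ofReal (not_lt.1 h)
        · simp [Set.indicator, h']
    have h4 : ENNReal.ofReal t * P A + ENNReal.ofReal t * P A ≤
        ν {ω | t < m n ω} + ENNReal.ofReal t * P A := by
      rw [← add_mul, ← ENNReal.ofReal_add ht.le ht.le, ← two_mul]
      exact h1.trans (h2.le.trans h3)
    have h5 := (ENNReal.add_le_add_iff_right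
      (ENNReal.mul_ne_top ENNReal.ofReal_ne_top (measure_ne_top P A))).1 h4
    refine le_trans ?_ h5
    gcongr
    intro ω (hω : t < M ω / 2)
    show 2 * t ≤ M ω
    linarith
  have hL : ∫⁻ ω, ENNReal.ofReal ((M ω / 2) ^ s) ∂P =
      ENNReal.ofReal ((2 ^ s)⁻¹) * ∫⁻ ω, ENNReal.ofReal (M ω ^ s) ∂P := by
    rw [← lintegral_const_mul' _ _ ENNReal.ofReal_ne_top]
    congr 1 with ω
    rw [← ENNReal.ofReal_mul (by positivity), Real.div_rpow (hM0 ω) two_pos.le, div_eq_inv_mul]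
  have hR : ∫⁻ ω, ENNReal.ofReal (m n ω ^ (s - 1)) ∂ν = ∫⁻ ω, ENNReal.ofReal (m n ω ^ s) ∂P := by
    rw [lintegral_withDensity_eq_lintegral_mul _ (hmm n).ennreal_ofReal
      (((hmm n).pow_const _).ennreal_ofReal)]
    congr 1 with ω
    rw [Pi.mul_apply, ← ENNReal.ofReal_mul (hm0 n ω)]
    congr 1
    rcases (hm0 n ω).eq_or_lt with h | h
    · simp only [Pi.zero_apply] at h
      rw [← h, Real.zero_rpow hs0.ne', zero_mul]
    · rw [mul_comm, ← Real.rpow_add_one h.ne']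
      congr 1
      ring
  have main : ∫⁻ ω, ENNReal.ofReal ((M ω / 2) ^ s) ∂P ≤
      ENNReal.ofReal (s / (s - 1)) * ∫⁻ ω, ENNReal.ofReal (m n ω ^ (s - 1)) ∂ν := by
    rw [lintegral_rpow_eq_lintegral_meas_lt_mul P
      (ae_of_all _ fun ω => div_nonneg (hM0 ω) two_pos.le) (hMm.div_const 2).aemeasurable hs0,
      lintegral_rpow_eq_lintegral_meas_lt_mul ν (ae_of_all _ fun ω => hm0 n ω)
      (hmm n).aemeasurable (by linarith : 0 < s - 1), ← mul_assoc, ← ENNReal.ofReal_mul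
      (by have := sub_pos.2 hs; positivity), div_mul_cancel₀ _ (by linarith : s - 1 ≠ 0)]
    refine mul_le_mul' le_rfl ?_
    refine setLIntegral_mono' measurableSet_Ioi fun t (ht : 0 < t) => ?_
    have : ENNReal.ofReal (t ^ (s - 1)) = ENNReal.ofReal t * ENNReal.ofReal (t ^ (s - 1 - 1)) := by
      rw [← ENNReal.ofReal_mul ht.le, mul_comm, ← Real.rpow_add_one ht.ne']
      congr 2
      ring
    rw [this, ← mul_assoc, mul_comm (P _)]
    gcongr
    exact weak t ht
  rw [hL, hR] at main
  calc ∫⁻ ω, ENNReal.ofReal (M ω ^ s) ∂P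
      = ENNReal.ofReal (2 ^ s) * (ENNReal.ofReal ((2 ^ s)⁻¹) *
          ∫⁻ ω, ENNReal.ofReal (M ω ^ s) ∂P) := by
        rw [← mul_assoc, ← ENNReal.ofReal_mul (by positivity), mul_inv_cancel₀ (by positivity)]
        simp
    _ ≤ ENNReal.ofReal (2 ^ s) * (ENNReal.ofReal (s / (s - 1)) *
          ∫⁻ ω, ENNReal.ofReal (m n ω ^ s) ∂P) := by gcongr
    _ = _ := by rw [← mul_assoc, ← ENNReal.ofReal_mul (by positivity)]

/-- The norm of a vector-valued martingale is a submartingale. -/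
theorem submartingale_norm_of_martingale {X : Type*} [NormedAddCommGroup X] [NormedSpace ℝ X]
    [CompleteSpace X] [IsFiniteMeasure P] {ℱ : Filtration ℕ mΩ} {φ : ℕ → Ω → X}
    (hφ : Martingale φ ℱ P) : Submartingale (fun i ω => ‖φ i ω‖) ℱ P := by
  refine ⟨fun i => (hφ.1 i).norm, fun i j hij => ?_, fun i => (hφ.integrable i).norm⟩
  filter_upwards [hφ.2 i j hij, norm_condExp_le (μ := P) (m := ℱ i) (φ j)] with ω h1 h2
  rw [← h1]
  exact h2

end Maximal

/-! ### Deterministic facts about passages and stopped sums. -/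

section Stopping

variable {X : Type*} [NormedAddCommGroup X]

/-- If the partial sums of a sequence with small terms exceed `2 t`, then so do, up to the constant,
the sums over the indices between the passage above `t` and the passage above `2 t`. -/
theorem half_le_norm_sum_between_passages {a : ℕ → X} {n : ℕ} {t : ℝ} (ht : 0 < t)
    (ha : ∀ i < n, ‖a i‖ ≤ t / 2) {V : ℕ → Prop} [DecidablePred V]
    (hV : ∀ i < n, (V i ↔ (∃ l ≤ i, t < ‖∑ j ∈ Finset.range l, a j‖) ∧
      ∀ l ≤ i, ‖∑ j ∈ Finset.range l, a j‖ ≤ 2 * t))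
    (hex : ∃ k ≤ n, 2 * t < ‖∑ j ∈ Finset.range k, a j‖) :
    t / 2 ≤ ‖∑ i ∈ Finset.range n, if V i then a i else 0‖ := by
  classical
  obtain ⟨k, hk, hkt⟩ := hex
  have e2 : ∃ k, 2 * t < ‖∑ j ∈ Finset.range k, a j‖ := ⟨k, hkt⟩
  have e1 : ∃ k, t < ‖∑ j ∈ Finset.range k, a j‖ := ⟨k, by linarith⟩
  -- With `T` and `U` the first passages above `t` and `2t`, the selected indices are exactly `T ≤ i
  -- < U`.
  set U := Nat.find e2 with hU
  set T := Nat.find e1 with hT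
  have hUn : U ≤ n := (Nat.find_min' e2 hkt).trans hk
  have hUt := Nat.find_spec e2
  have hTt := Nat.find_spec e1
  have hTU : T ≤ U := Nat.find_min' e1 (by linarith [hUt])
  have hT0 : T ≠ 0 := by
    intro h
    rw [← hT, h] at hTt
    simp at hTt
    linarith
  have hsum : ∑ i ∈ Finset.range n, (if V i then a i else 0) = ∑ i ∈ Finset.Ico T U, a i := by
    rw [← Finset.sum_filter]
    congr 1
    ext i
    simp only [Finset.mem_filter, Finset.mem_range, Finset.mem_Ico]
    constructor
    · rintro ⟨hi, hv⟩
      obtain ⟨⟨l, hl, hlt⟩, h2⟩ := (hV i hi).1 hv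
      refine ⟨(Nat.find_min' e1 hlt).trans hl, ?_⟩
      by_contra! hc
      exact absurd (h2 U hc) (not_le.2 hUt)
    · rintro ⟨h1, h2⟩
      have hi : i < n := h2.trans_le hUn
      exact ⟨hi, (hV i hi).2 ⟨⟨T, h1, hTt⟩, fun l hl =>
        not_lt.1 (Nat.find_min e2 (hl.trans_lt h2))⟩⟩
  obtain ⟨m, hm⟩ := Nat.exists_eq_succ_of_ne_zero hT0
  -- The sum just before `T` is at most `t` and the next term at most `t / 2`, so the increment from
  -- `T` to `U` exceeds `2t - 3t/2`.
  have hTb : ‖∑ j ∈ Finset.range T, a j‖ ≤ t + t / 2 := by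
    rw [hm, Finset.sum_range_succ]
    refine (norm_add_le _ _).trans (add_le_add ?_ (ha m ?_))
    · exact not_lt.1 (Nat.find_min e1 (by omega))
    · omega
  rw [hsum, Finset.sum_Ico_eq_sub _ hTU]
  have := norm_sub_norm_le (∑ j ∈ Finset.range U, a j) (∑ j ∈ Finset.range T, a j)
  linarith

/-- A sum stopped when its partial sums exceed `M₁` is at most `M₁` plus the size of a term. -/
theorem sum_stopped_le {e : ℕ → ℝ} {M₁ M₂ : ℝ} (he : ∀ i, 0 ≤ e i) (he2 : ∀ i, e i ≤ M₂)
    (hM₁ : 0 ≤ M₁) (A V : ℕ → Prop) [DecidablePred A] [DecidablePred V] (hVA : ∀ i, V i → A i)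
    (hV : ∀ i, V i → ∑ j ∈ Finset.range i, (if A j then e j else 0) ≤ M₁) (n : ℕ) :
    ∑ i ∈ Finset.range n, (if V i then e i else 0) ≤ M₁ + M₂ := by
  induction n with
  | zero => simpa using add_nonneg hM₁ ((he 0).trans (he2 0))
  | succ n ih =>
    -- If step `n` is selected, the stopping rule bounds everything before it by `M₁` and only one
    -- further term is added; otherwise nothing is added.
    by_cases h : V n
    · rw [Finset.sum_range_succ, if_pos h]
      refine add_le_add (le_trans (Finset.sum_le_sum fun i _ => ?_) (hV n h)) (he2 n)
      by_cases hi : V i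
      · simp [hi, hVA i hi]
      · rw [if_neg hi]
        split_ifs
        exacts [he i, le_rfl]
    · rw [Finset.sum_range_succ, if_neg h, add_zero]
      exact ih

/-- Comparison of the `ℓ^p` and the `ℓ^2` norm of `n` numbers, `p ≤ 2`. -/
theorem sum_rpow_le_card_rpow_mul {p : ℝ} (hp1 : 1 ≤ p) (hp2 : p ≤ 2) {n : ℕ} {x : ℕ → ℝ}
    (hx : ∀ i, 0 ≤ x i) :
    (∑ i ∈ Finset.range n, x i ^ p) ^ (1 / p) ≤
      (n : ℝ) ^ (1 / p - 1 / 2) * Real.sqrt (∑ i ∈ Finset.range n, x i ^ (2 : ℝ)) := by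
  have hp0 : 0 < p := by linarith
  -- The power mean inequality with exponent `2 / p`, applied to the numbers `x i ^ p`; its square
  -- root is the claim.
  have h := Real.rpow_sum_le_const_mul_sum_rpow (Finset.range n) (fun i => x i ^ p)
    (p := 2 / p) (by rw [le_div_iff₀ hp0]; linarith)
  have hx' : ∀ i, |x i ^ p| = x i ^ p := fun i => abs_of_nonneg (Real.rpow_nonneg (hx i) _)
  simp_rw [hx', ← Real.rpow_mul (hx _), mul_div_cancel₀ _ hp0.ne', Finset.card_range] at h
  have hs : 0 ≤ ∑ i ∈ Finset.range n, x i ^ p :=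
    Finset.sum_nonneg fun i _ => Real.rpow_nonneg (hx i) _
  have h2 := Real.rpow_le_rpow (by positivity) h (by norm_num : (0 : ℝ) ≤ 1 / 2)
  rw [← Real.rpow_mul hs, Real.mul_rpow (by positivity)
    (Finset.sum_nonneg fun i _ => Real.rpow_nonneg (hx i) _), ← Real.rpow_mul (by positivity),
    ← Real.sqrt_eq_rpow] at h2
  convert h2 using 3
  · field_simp
  · field_simp

end Stopping

/-! ### Martingale transforms, the Carleson property and the good-`λ` inequality. -/

section GoodLambda

variable {𝕜 : Type*} [RCLike 𝕜] {X : Type*} [NormedAddCommGroup X] [NormedSpace ℝ X]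
  [NormedSpace 𝕜 X] [IsScalarTower ℝ 𝕜 X] [CompleteSpace X]
  {Ω : Type*} {mΩ : MeasurableSpace Ω} {P : Measure Ω} [IsProbabilityMeasure P]
  {ℱ : Filtration ℕ mΩ}

/-- The martingale transform of a martingale difference sequence by a bounded predictable
sequence. -/
theorem martingale_sum_smul {d : ℕ → Ω → 𝕜} {ψ : ℕ → Ω → X}
    (hd : ∀ i, StronglyMeasurable[ℱ (i + 1)] (d i)) (hψ : ∀ i, StronglyMeasurable[ℱ i] (ψ i))
    {D R : ℝ} (hdD : ∀ i ω, ‖d i ω‖ ≤ D) (hψR : ∀ i ω, ‖ψ i ω‖ ≤ R)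
    (hd0 : ∀ i, P[d i | ℱ i] =ᵐ[P] 0) :
    Martingale (fun k ω => ∑ i ∈ Finset.range k, d i ω • ψ i ω) ℱ P := by
  have hD : 0 ≤ D := (norm_nonneg _).trans
    (hdD 0 (Classical.choice (nonempty_of_isProbabilityMeasure P)))
  have hmeas : ∀ i, StronglyMeasurable[ℱ (i + 1)] fun ω => d i ω • ψ i ω := fun i =>
    (hd i).smul ((hψ i).mono (ℱ.mono i.le_succ))
  have hint : ∀ i, Integrable (fun ω => d i ω • ψ i ω) P := fun i =>
    Integrable.of_bound ((hmeas i).mono (ℱ.le _)).aestronglyMeasurable (D * R)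
      (ae_of_all _ fun ω => by
        rw [norm_smul]
        exact mul_le_mul (hdD i ω) (hψR i ω) (norm_nonneg _) hD)
  refine martingale_of_condExp_sub_eq_zero_nat (fun k => ?_) (fun k => ?_) fun i => ?_
  · exact Finset.stronglyMeasurable_fun_sum _ fun i hi =>
      (hmeas i).mono (ℱ.mono (Finset.mem_range.1 hi))
  · exact integrable_finsetSum _ fun i _ => hint i
  · have h1 : (fun ω => ∑ j ∈ Finset.range (i + 1), d j ω • ψ j ω) -
        (fun ω => ∑ j ∈ Finset.range i, d j ω • ψ j ω) = fun ω => d i ω • ψ i ω := by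
      ext ω
      simp [Finset.sum_range_succ]
    rw [h1]
    have hdi : Integrable (d i) P := Integrable.of_bound
      ((hd i).mono (ℱ.le _)).aestronglyMeasurable D (ae_of_all _ (hdD i))
    -- `ψ i` is known at time `i`, so it leaves the conditional expectation, and what remains is
    -- that of `d i`, which vanishes.
    have h2 := condExp_bilin_of_stronglyMeasurable_right (m := ℱ i) (μ := P)
      (ContinuousLinearMap.lsmul ℝ 𝕜 : 𝕜 →L[ℝ] X →L[ℝ] X) (hψ i) (hint i) hdi
    filter_upwards [h2, hd0 i] with ω h3 h4
    simp only [ContinuousLinearMap.lsmul_apply] at h3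
    rw [h3, h4]
    simp

variable {d : ℕ → Ω → 𝕜} {n : ℕ} {B : ℝ}

omit [IsProbabilityMeasure P] in
/-- The Carleson property controls the square function started at a stopping time. -/
theorem lintegral_sum_indicator_le
    (hcarl : ∀ i, ∀ A, MeasurableSet[ℱ i] A →
      ∫⁻ ω in A, ∑ j ∈ Finset.Ico i n, ENNReal.ofReal (‖d j ω‖ ^ 2) ∂P ≤
        ENNReal.ofReal (B ^ 2) * P A)
    (hdm : ∀ i, StronglyMeasurable (d i))
    {A : ℕ → Set Ω} (hA : ∀ i, MeasurableSet[ℱ i] (A i)) :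
    ∫⁻ ω, ∑ j ∈ Finset.range n,
        (⋃ l ≤ j, A l).indicator (fun ω => ENNReal.ofReal (‖d j ω‖ ^ 2)) ω ∂P ≤
      ENNReal.ofReal (B ^ 2) * P (⋃ l ≤ n, A l) := by
  -- `disjointed A l` is the event that `l` is the first index at which `A` occurs. On it the sum
  -- runs over `j ≥ l`, so the Carleson property at time `l` applies.
  have hAm : ∀ i, MeasurableSet[ℱ i] (disjointed A i) := fun i => by
    rw [disjointed_apply]
    exact (hA i).diff (by
      rw [Finset.sup_set_eq_biUnion]
      exact Finset.measurableSet_biUnion _ fun j hj =>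
        ℱ.mono (Finset.mem_Iio.1 hj).le _ (hA j))
  have hun : ∀ j, (⋃ l ≤ j, A l) = ⋃ l ∈ Finset.range (j + 1), disjointed A l := fun j => by
    have := biUnion_range_succ_disjointed A j
    rw [this, partialSups_eq_biSup]
    rfl
  have hdisj : ∀ j, Set.PairwiseDisjoint (↑(Finset.range (j + 1))) (disjointed A) := fun j =>
    (disjoint_disjointed A).set_pairwise _
  have hmeas : ∀ j, Measurable fun ω => ENNReal.ofReal (‖d j ω‖ ^ 2) := fun j =>
    ((hdm j).norm.measurable.pow_const 2).ennreal_ofReal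
  have hswap : ∀ ω, ∑ j ∈ Finset.range n,
        (⋃ l ≤ j, A l).indicator (fun ω => ENNReal.ofReal (‖d j ω‖ ^ 2)) ω =
      ∑ l ∈ Finset.range n, (disjointed A l).indicator
        (fun ω => ∑ j ∈ Finset.Ico l n, ENNReal.ofReal (‖d j ω‖ ^ 2)) ω := by
    intro ω
    have h1 : ∀ j, (⋃ l ≤ j, A l).indicator (fun ω => ENNReal.ofReal (‖d j ω‖ ^ 2)) ω =
        ∑ l ∈ Finset.range (j + 1), (disjointed A l).indicator
          (fun ω => ENNReal.ofReal (‖d j ω‖ ^ 2)) ω := fun j => by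
      rw [hun j, Finset.indicator_biUnion_apply _ _ (hdisj j)]
    have h2 : ∀ l, (disjointed A l).indicator
        (fun ω => ∑ j ∈ Finset.Ico l n, ENNReal.ofReal (‖d j ω‖ ^ 2)) ω =
        ∑ j ∈ Finset.Ico l n, (disjointed A l).indicator
          (fun ω => ENNReal.ofReal (‖d j ω‖ ^ 2)) ω := fun l => by
      by_cases h : ω ∈ disjointed A l <;> simp [h]
    simp_rw [h1, h2, Finset.range_eq_Ico]
    rw [Finset.sum_Ico_Ico_comm]
  simp_rw [hswap]
  rw [lintegral_finsetSum' _ fun l _ => ((Finset.measurable_fun_sum _ fun j _ =>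
    hmeas j).indicator (ℱ.le l _ (hAm l))).aemeasurable]
  calc _ ≤ ∑ l ∈ Finset.range n, ENNReal.ofReal (B ^ 2) * P (disjointed A l) := by
        refine Finset.sum_le_sum fun l _ => ?_
        rw [lintegral_indicator (ℱ.le l _ (hAm l))]
        exact hcarl l _ (hAm l)
    _ ≤ ∑ l ∈ Finset.range (n + 1), ENNReal.ofReal (B ^ 2) * P (disjointed A l) :=
        Finset.sum_le_sum_of_subset (Finset.range_subset_range.2 n.le_succ)
    _ = _ := by
        rw [← Finset.mul_sum, hun n, measure_biUnion_finset (hdisj n)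
          fun l _ => ℱ.le l _ (hAm l)]

end GoodLambda

section GoodLambda

variable {𝕜 : Type*} [RCLike 𝕜] {X : Type*} [NormedAddCommGroup X] [NormedSpace ℝ X]
  [NormedSpace 𝕜 X] [IsScalarTower ℝ 𝕜 X] [CompleteSpace X]
  {Ω : Type*} {mΩ : MeasurableSpace Ω} {P : Measure Ω} [IsProbabilityMeasure P]
  {ℱ : Filtration ℕ mΩ}

/-- The good-`λ` inequality between the partial sums of a paraproduct and its coefficients. -/
theorem good_lambda_paraproduct {p : ℝ} (hp1 : 1 ≤ p) (hp2 : p ≤ 2) {r : ℝ≥0∞} (hr1 : 1 < r)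
    (hr : r ≠ ∞) {C : ℝ≥0}
    (hT : ∀ f : ℕ → Ω → X, Martingale f ℱ P → ∀ N : ℕ, (∀ n ≤ N, MemLp (f n) r P) →
        eLpNorm (f N) r P ≤
          C * eLpNorm (fun ω => (‖f 0 ω‖ ^ p
            + ∑ n ∈ Finset.range N, ‖f (n + 1) ω - f n ω‖ ^ p) ^ (1 / p)) r P)
    {d : ℕ → Ω → 𝕜} {φ : ℕ → Ω → X} {n : ℕ} {B D K γ t : ℝ}
    (hd : ∀ i, StronglyMeasurable[ℱ (i + 1)] (d i)) (hφ : ∀ i, StronglyMeasurable[ℱ i] (φ i))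
    (hdD : ∀ i ω, ‖d i ω‖ ≤ D) (hd0 : ∀ i, P[d i | ℱ i] =ᵐ[P] 0)
    (hcarl : ∀ i, ∀ A, MeasurableSet[ℱ i] A →
      ∫⁻ ω in A, ∑ j ∈ Finset.Ico i n, ENNReal.ofReal (‖d j ω‖ ^ 2) ∂P ≤
        ENNReal.ofReal (B ^ 2) * P A)
    (hB : 0 < B) (hK : 0 < K) (hγ : 0 < γ) (ht : 0 < t) (hDγ : D * γ ≤ 1 / 2) :
    P {ω | ∃ k ≤ n, 2 * t < ‖∑ i ∈ Finset.range k, d i ω • φ i ω‖} ≤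
      P {ω | ∃ i < n, γ * t < ‖φ i ω‖} +
      (ENNReal.ofReal ((K ^ 2)⁻¹) + (C * ENNReal.ofReal (2 * γ * (n : ℝ) ^ (1 / p - 1 / 2) *
        Real.sqrt ((K * B) ^ 2 + D ^ 2))) ^ r.toReal) *
      P {ω | ∃ k ≤ n, t < ‖∑ i ∈ Finset.range k, d i ω • φ i ω‖} := by
  classical
  have hD : 0 ≤ D := (norm_nonneg _).trans
    (hdD 0 (Classical.choice (nonempty_of_isProbabilityMeasure P)))
  have hp0 : 0 < p := by linarith
  have hr0 : r ≠ 0 := (zero_lt_one.trans hr1).ne'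
  have hrp : 0 < r.toReal := ENNReal.toReal_pos hr0 hr
  set G : ℕ → Ω → X := fun k ω => ∑ i ∈ Finset.range k, d i ω • φ i ω with hG
  have hGm : ∀ k, StronglyMeasurable[ℱ k] (G k) := fun k =>
    Finset.stronglyMeasurable_fun_sum _ fun i hi =>
      ((hd i).mono (ℱ.mono (Finset.mem_range.1 hi))).smul
        ((hφ i).mono (ℱ.mono (Finset.mem_range.1 hi).le))
  set A : ℕ → Set Ω := fun l => {ω | t < ‖G l ω‖} with hAdef
  have hAm : ∀ l, MeasurableSet[ℱ l] (A l) := fun l =>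
    (@measurable_const _ _ _ (ℱ l) t).stronglyMeasurable.measurableSet_lt (hGm l).norm
  have hAm' : ∀ j, MeasurableSet[ℱ j] (⋃ l ≤ j, A l) := fun j =>
    MeasurableSet.biUnion (Set.to_countable _) fun l hl => ℱ.mono hl _ (hAm l)
  -- The square sum of the `d j`, started only once `‖G‖` has exceeded `t`; this start is what
  -- yields `P U` instead of `1` in the estimate `hSn`.
  set S : ℕ → Ω → ℝ := fun k ω =>
    ∑ j ∈ Finset.range k, if ω ∈ ⋃ l ≤ j, A l then ‖d j ω‖ ^ 2 else 0 with hS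
  have hSm : ∀ k, StronglyMeasurable[ℱ k] (S k) := fun k =>
    Finset.stronglyMeasurable_fun_sum _ fun j hj =>
      StronglyMeasurable.ite (ℱ.mono (Finset.mem_range.1 hj).le _ (hAm' j))
        (((hd j).mono (ℱ.mono (Finset.mem_range.1 hj))).norm.pow 2) stronglyMeasurable_const
  have hSmono : ∀ ω, Monotone fun k => S k ω := fun ω => by
    refine monotone_nat_of_le_succ fun k => ?_
    simp only [hS, Finset.sum_range_succ]
    refine le_add_of_nonneg_right ?_
    split_ifs <;> positivity
  have hS0 : ∀ k ω, 0 ≤ S k ω := fun k ω => Finset.sum_nonneg fun j _ => by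
    split_ifs <;> positivity
  -- The event that step `i` counts: `‖G‖` has passed `t` but not `2t`, `‖φ‖` has stayed below `γ
  -- t`, and the started square sum is still at most `(K B)²`. All of this is known at time `i`, so
  -- cutting `φ i` off by it keeps the martingale property of the transform.
  set V : ℕ → Set Ω := fun i =>
    (⋃ l ≤ i, A l) ∩ ((⋂ l ≤ i, {ω | ‖G l ω‖ ≤ 2 * t}) ∩ (⋂ l ≤ i, {ω | ‖φ l ω‖ ≤ γ * t}) ∩
      {ω | S i ω ≤ (K * B) ^ 2}) with hV
  have hVm : ∀ i, MeasurableSet[ℱ i] (V i) := fun i => by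
    refine (hAm' i).inter (((MeasurableSet.biInter (Set.to_countable _) fun l hl => ?_).inter
      (MeasurableSet.biInter (Set.to_countable _) fun l hl => ?_)).inter ?_)
    · exact (((hGm l).mono (ℱ.mono hl)).norm).measurableSet_le stronglyMeasurable_const
    · exact (((hφ l).mono (ℱ.mono hl)).norm).measurableSet_le stronglyMeasurable_const
    · exact (hSm i).measurableSet_le stronglyMeasurable_const
  have hγt : 0 < γ * t := by positivity
  set ψ : ℕ → Ω → X := fun i => (V i).indicator (φ i) with hψ
  have hψm : ∀ i, StronglyMeasurable[ℱ i] (ψ i) := fun i => (hφ i).indicator (hVm i)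
  have hψR : ∀ i ω, ‖ψ i ω‖ ≤ γ * t := fun i ω => by
    by_cases h : ω ∈ V i
    · simp only [hψ, Set.indicator_of_mem h]
      exact Set.mem_iInter₂.1 h.2.1.2 i le_rfl
    · simp only [hψ, Set.indicator_of_notMem h, norm_zero]
      exact hγt.le
  set H : ℕ → Ω → X := fun k ω => ∑ i ∈ Finset.range k, d i ω • ψ i ω with hH
  have hHm : Martingale H ℱ P := martingale_sum_smul hd hψm hdD hψR hd0
  have hHLp : ∀ k, MemLp (H k) r P := fun k => by
    refine MemLp.of_bound ((hHm.1 k).mono (ℱ.le k)).aestronglyMeasurable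
      (∑ i ∈ Finset.range k, D * (γ * t)) (ae_of_all _ fun ω => ?_)
    refine norm_sum_le_of_le _ fun i _ => ?_
    rw [norm_smul]
    exact mul_le_mul (hdD i ω) (hψR i ω) (norm_nonneg _) hD
  have hn0 : (0 : ℝ) ≤ (n : ℝ) ^ (1 / p - 1 / 2) := by positivity
  set R : ℝ := γ * t * (n : ℝ) ^ (1 / p - 1 / 2) * Real.sqrt ((K * B) ^ 2 + D ^ 2) with hR
  set U : Set Ω := ⋃ l ≤ n, A l with hU
  have hUm : MeasurableSet U := ℱ.le n _ (hAm' n)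
  -- Pointwise control of the `p`-variation of `H`. Off `U` no step counts. On `U` the square sum of
  -- the counted `d i` is at most `(K B)²` plus one overshooting term `D²`, and passing from `ℓ²` to
  -- `ℓ^p` costs the power of `n`.
  have hsq : ∀ ω, (‖H 0 ω‖ ^ p + ∑ i ∈ Finset.range n, ‖H (i + 1) ω - H i ω‖ ^ p) ^ (1 / p) ≤
      U.indicator (fun _ => R) ω := by
    intro ω
    have hdiff : ∀ i, H (i + 1) ω - H i ω = d i ω • ψ i ω := fun i => by
      simp [hH, Finset.sum_range_succ]
    have h0 : H 0 ω = 0 := by simp [hH]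
    simp_rw [hdiff, h0, norm_zero, Real.zero_rpow hp0.ne', zero_add]
    by_cases hω : ω ∈ U
    · rw [Set.indicator_of_mem hω]
      have h1 : ∀ i, ‖d i ω • ψ i ω‖ ≤ γ * t * (if ω ∈ V i then ‖d i ω‖ else 0) := fun i => by
        by_cases h : ω ∈ V i
        · rw [if_pos h, norm_smul, mul_comm]
          exact mul_le_mul_of_nonneg_right (hψR i ω) (norm_nonneg _)
        · simp [hψ, h]
      have h2 := sum_rpow_le_card_rpow_mul hp1 hp2 (n := n)
        (x := fun i => if ω ∈ V i then ‖d i ω‖ else 0) fun i => by positivity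
      have h3 : ∑ i ∈ Finset.range n, (if ω ∈ V i then ‖d i ω‖ else 0) ^ (2 : ℝ) ≤
          (K * B) ^ 2 + D ^ 2 := by
        have := sum_stopped_le (e := fun i => ‖d i ω‖ ^ 2) (M₁ := (K * B) ^ 2) (M₂ := D ^ 2)
          (fun i => by positivity) (fun i => by gcongr; exact hdD i ω) (by positivity)
          (fun j => ω ∈ ⋃ l ≤ j, A l) (fun i => ω ∈ V i) (fun i h => h.1) (fun i h => h.2.2) n
        refine le_trans (le_of_eq (Finset.sum_congr rfl fun i _ => ?_)) this
        split_ifs <;> simp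
      calc (∑ i ∈ Finset.range n, ‖d i ω • ψ i ω‖ ^ p) ^ (1 / p)
          ≤ (∑ i ∈ Finset.range n, (γ * t * (if ω ∈ V i then ‖d i ω‖ else 0)) ^ p) ^ (1 / p) := by
            gcongr with i _
            exact h1 i
        _ = γ * t * (∑ i ∈ Finset.range n, (if ω ∈ V i then ‖d i ω‖ else 0) ^ p) ^ (1 / p) := by
            have : ∀ i, (γ * t * (if ω ∈ V i then ‖d i ω‖ else 0)) ^ p =
                (γ * t) ^ p * (if ω ∈ V i then ‖d i ω‖ else 0) ^ p := fun i =>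
              Real.mul_rpow hγt.le (by positivity)
            simp_rw [this]
            rw [← Finset.mul_sum, Real.mul_rpow (by positivity)
              (Finset.sum_nonneg fun i _ => by positivity), ← Real.rpow_mul hγt.le,
              mul_one_div_cancel hp0.ne', Real.rpow_one]
        _ ≤ γ * t * ((n : ℝ) ^ (1 / p - 1 / 2) * Real.sqrt ((K * B) ^ 2 + D ^ 2)) := by
            gcongr
            exact h2.trans (by gcongr)
        _ = R := by rw [hR]; ring
    · rw [Set.indicator_of_notMem hω, Finset.sum_eq_zero, Real.zero_rpow (by positivity)]
      intro i hi
      have : ω ∉ V i := fun h => hω (by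
        have := h.1
        simp only [hU, Set.mem_iUnion] at this ⊢
        obtain ⟨l, hl, hlA⟩ := this
        exact ⟨l, hl.trans (Finset.mem_range.1 hi).le, hlA⟩)
      simp [hψ, this, Real.zero_rpow hp0.ne']
  have hR0 : 0 ≤ R := by positivity
  have hHn : eLpNorm (H n) r P ≤ C * (ENNReal.ofReal R * P U ^ (1 / r.toReal)) := by
    refine (hT H hHm n fun k _ => hHLp k).trans ?_
    gcongr
    refine (eLpNorm_mono_real (g := U.indicator fun _ => R) fun ω => ?_).trans ?_
    · rw [Real.norm_of_nonneg (by positivity)]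
      exact hsq ω
    · rw [eLpNorm_indicator_const hUm hr0 hr, Real.enorm_of_nonneg hR0]
  -- Chebyshev at height `t / 2`; the factor `t` in `R` cancels, so the bound is uniform in `t`.
  have hcheb : P {ω | t / 2 ≤ ‖H n ω‖} ≤ (C * ENNReal.ofReal (2 * γ * (n : ℝ) ^ (1 / p - 1 / 2) *
        Real.sqrt ((K * B) ^ 2 + D ^ 2))) ^ r.toReal * P U := by
    have h1 := meas_ge_le_mul_pow_eLpNorm_enorm P hr0 hr (hHLp n).1
      (ε := ENNReal.ofReal (t / 2)) (by simpa using ht) (by simp)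
    have h2 : {ω | t / 2 ≤ ‖H n ω‖} = {ω | ENNReal.ofReal (t / 2) ≤ ‖H n ω‖ₑ} := by
      ext ω
      simp only [Set.mem_ofPred_eq]
      rw [← ofReal_norm, ENNReal.ofReal_le_ofReal_iff (norm_nonneg _)]
    rw [h2]
    refine h1.trans ?_
    calc (ENNReal.ofReal (t / 2))⁻¹ ^ r.toReal * eLpNorm (H n) r P ^ r.toReal
        ≤ (ENNReal.ofReal (t / 2))⁻¹ ^ r.toReal *
          (C * (ENNReal.ofReal R * P U ^ (1 / r.toReal))) ^ r.toReal := by gcongr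
      _ = ((C * (ENNReal.ofReal ((t / 2)⁻¹) * ENNReal.ofReal R)) *
          P U ^ (1 / r.toReal)) ^ r.toReal := by
          rw [← ENNReal.mul_rpow_of_nonneg _ _ hrp.le, ENNReal.ofReal_inv_of_pos (by positivity)]
          congr 1
          ring
      _ = _ := by
          rw [ENNReal.mul_rpow_of_nonneg _ _ hrp.le, ← ENNReal.rpow_mul,
            one_div_mul_cancel hrp.ne', ENNReal.rpow_one, ← ENNReal.ofReal_mul (by positivity)]
          have : (t / 2)⁻¹ * R = 2 * γ * (n : ℝ) ^ (1 / p - 1 / 2) *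
              Real.sqrt ((K * B) ^ 2 + D ^ 2) := by
            rw [hR]
            field_simp
          rw [this]
  have hSn : P {ω | (K * B) ^ 2 < S n ω} ≤ ENNReal.ofReal ((K ^ 2)⁻¹) * P U := by
    have h1 : ∫⁻ ω, ENNReal.ofReal (S n ω) ∂P ≤ ENNReal.ofReal (B ^ 2) * P U := by
      refine le_trans (le_of_eq ?_)
        (lintegral_sum_indicator_le hcarl (fun i => (hd i).mono (ℱ.le _)) hAm)
      congr 1 with ω
      rw [hS, ENNReal.ofReal_sum_of_nonneg fun j _ => by split_ifs <;> positivity]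
      refine Finset.sum_congr rfl fun j _ => ?_
      by_cases h : ω ∈ ⋃ l ≤ j, A l
      · rw [if_pos h, Set.indicator_of_mem h]
      · rw [if_neg h, Set.indicator_of_notMem h, ENNReal.ofReal_zero]
    have hKB : 0 < (K * B) ^ 2 := by positivity
    have h2 : ENNReal.ofReal ((K * B) ^ 2) * P {ω | (K * B) ^ 2 < S n ω} ≤
        ENNReal.ofReal (B ^ 2) * P U := by
      refine le_trans (le_trans ?_ (mul_meas_ge_le_lintegral₀
        ((hSm n).mono (ℱ.le n)).measurable.ennreal_ofReal.aemeasurable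
        (ENNReal.ofReal ((K * B) ^ 2)))) h1
      refine mul_le_mul' le_rfl (measure_mono fun ω (hω : (K * B) ^ 2 < S n ω) => ?_)
      exact ENNReal.ofReal_le_ofReal hω.le
    calc P {ω | (K * B) ^ 2 < S n ω}
        = ENNReal.ofReal (((K * B) ^ 2)⁻¹) *
          (ENNReal.ofReal ((K * B) ^ 2) * P {ω | (K * B) ^ 2 < S n ω}) := by
          rw [← mul_assoc, ← ENNReal.ofReal_mul (by positivity), inv_mul_cancel₀ hKB.ne']
          simp
      _ ≤ ENNReal.ofReal (((K * B) ^ 2)⁻¹) * (ENNReal.ofReal (B ^ 2) * P U) := by gcongr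
      _ = _ := by
          rw [← mul_assoc, ← ENNReal.ofReal_mul (by positivity)]
          congr 2
          field_simp
  -- If neither `φ` nor the square sum causes stopping, the counted steps are exactly those between
  -- the two passages, and `H n` is the increment of `G` over them.
  have hsub : {ω | ∃ k ≤ n, 2 * t < ‖G k ω‖} ⊆ {ω | ∃ i < n, γ * t < ‖φ i ω‖} ∪
      ({ω | (K * B) ^ 2 < S n ω} ∪ {ω | t / 2 ≤ ‖H n ω‖}) := by
    intro ω hω
    by_cases h1 : ∃ i < n, γ * t < ‖φ i ω‖
    · exact Or.inl h1
    by_cases h2 : (K * B) ^ 2 < S n ω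
    · exact Or.inr (Or.inl h2)
    refine Or.inr (Or.inr ?_)
    push Not at h1 h2
    have h3 := half_le_norm_sum_between_passages (a := fun i => d i ω • φ i ω) (n := n) ht
      (fun i hi => by
        rw [norm_smul]
        calc ‖d i ω‖ * ‖φ i ω‖ ≤ D * (γ * t) :=
              mul_le_mul (hdD i ω) (h1 i hi) (norm_nonneg _) hD
          _ = D * γ * t := by ring
          _ ≤ 1 / 2 * t := by gcongr
          _ = t / 2 := by ring) (V := fun i => ω ∈ V i) (fun i hi => by
        simp only [hV, Set.mem_inter_iff, Set.mem_iUnion, Set.mem_iInter, Set.mem_ofPred_eq, hAdef,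
          exists_prop, hG]
        refine and_congr Iff.rfl ⟨fun h => h.1.1, fun h => ⟨⟨h, fun l hl =>
          h1 l (hl.trans_lt hi)⟩, (hSmono ω hi.le).trans h2⟩⟩) hω
    refine h3.trans (le_of_eq ?_)
    simp only [hH, hψ]
    congr 1
    refine Finset.sum_congr rfl fun i _ => ?_
    by_cases h : ω ∈ V i <;> simp [h]
  have hUeq : {ω | ∃ k ≤ n, t < ‖G k ω‖} = U := by
    ext ω
    simp [hU, hAdef]
  rw [hUeq]
  calc _ ≤ _ := measure_mono hsub
    _ ≤ _ := (measure_union_le _ _).trans (add_le_add le_rfl (measure_union_le _ _))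
    _ ≤ _ := by
      rw [add_mul]
      exact add_le_add le_rfl (add_le_add hSn hcheb)

end GoodLambda

/-! ### The abstract `L_s` bound. -/

section Bound

variable {Ω : Type*} {mΩ : MeasurableSpace Ω} {P : Measure Ω}

theorem lintegral_ofReal_norm_rpow {Y : Type*} [NormedAddCommGroup Y] (g : Ω → Y) {s : ℝ≥0∞}
    (hs0 : s ≠ 0) (hs : s ≠ ∞) :
    ∫⁻ ω, ENNReal.ofReal (‖g ω‖ ^ s.toReal) ∂P = eLpNorm g s P ^ s.toReal := by
  rw [eLpNorm_eq_lintegral_rpow_enorm_toReal hs0 hs, ← ENNReal.rpow_mul,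
    one_div_mul_cancel (ENNReal.toReal_pos hs0 hs).ne', ENNReal.rpow_one]
  congr 1 with ω
  rw [← ENNReal.ofReal_rpow_of_nonneg (norm_nonneg _) ENNReal.toReal_nonneg, ofReal_norm]

/-- `L_s` bounds for paraproducts with values in a space of martingale type `p`, over an abstract
filtration on a probability space. -/
theorem exists_eLpNorm_paraproduct_le {𝕜 : Type w} [RCLike 𝕜] {X : Type v}
    [NormedAddCommGroup X] [NormedSpace ℝ X] [NormedSpace 𝕜 X] [IsScalarTower ℝ 𝕜 X]
    [CompleteSpace X] {p : ℝ} (hp1 : 1 ≤ p) (hp2 : p ≤ 2) (hT : HasMartingaleType.{u} X p)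
    {s : ℝ≥0∞} (hs1 : 1 < s) (hs : s ≠ ∞) (L : ℝ≥0) :
    ∃ C : ℝ≥0, ∀ (Ω : Type u) [mΩ : MeasurableSpace Ω] (P : Measure Ω) [IsProbabilityMeasure P]
      (ℱ : Filtration ℕ mΩ) (d : ℕ → Ω → 𝕜) (φ : ℕ → Ω → X) (n : ℕ) (B : ℝ), 0 < n → 0 < B →
      Martingale φ ℱ P → MemLp (φ n) s P →
      (∀ i, StronglyMeasurable[ℱ (i + 1)] (d i)) → (∀ i ω, ‖d i ω‖ ≤ L * B) →
      (∀ i, P[d i | ℱ i] =ᵐ[P] 0) →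
      (∀ i, ∀ A, MeasurableSet[ℱ i] A →
        ∫⁻ ω in A, ∑ j ∈ Finset.Ico i n, ENNReal.ofReal (‖d j ω‖ ^ 2) ∂P ≤
          ENNReal.ofReal (B ^ 2) * P A) →
      eLpNorm (fun ω => ∑ i ∈ Finset.range n, d i ω • φ i ω) s P ≤
        C * ENNReal.ofReal ((n : ℝ) ^ (1 / p - 1 / 2)) * ENNReal.ofReal B *
          eLpNorm (φ n) s P := by
  obtain ⟨r, hr1, hr, CT, hT⟩ := hT
  have hp0 : 0 < p := by linarith
  have hs0 : s ≠ 0 := (zero_lt_one.trans hs1).ne'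
  have hr0 : r ≠ 0 := (zero_lt_one.trans hr1).ne'
  set σ := s.toReal with hσ
  have hσ1 : 1 < σ := by
    rw [hσ, ← ENNReal.toReal_one]
    exact (ENNReal.toReal_lt_toReal ENNReal.one_ne_top hs).2 hs1
  have hσ0 : 0 < σ := by linarith
  have hrp : 0 < r.toReal := ENNReal.toReal_pos hr0 hr
  -- The weight admissible in the good-`λ` lemma. Half of it is spent on `K⁻²` (Carleson term), the
  -- other half on the martingale type term.
  set ε : ℝ := (2 * 2 ^ σ)⁻¹ with hε
  have hε0 : 0 < ε := by positivity
  set K : ℝ := Real.sqrt (ε / 2)⁻¹ with hK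
  have hK0 : 0 < K := Real.sqrt_pos.2 (by positivity)
  have hK2 : (K ^ 2)⁻¹ = ε / 2 := by
    rw [hK, Real.sq_sqrt (by positivity), inv_inv]
  set a : ℝ := 2 * CT * Real.sqrt (K ^ 2 + L ^ 2) with ha
  have ha0 : 0 ≤ a := by positivity
  -- The first entry keeps each `‖d i • φ i‖` below `t / 2`; the second makes the martingale type
  -- term at most `ε / 2`.
  set γ₀ : ℝ := min (1 / (2 * (L + 1))) ((ε / 2) ^ (1 / r.toReal) / (a + 1)) with hγ₀
  have hγ₀0 : 0 < γ₀ := lt_min (by positivity) (by positivity)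
  have hLγ₀ : L * γ₀ ≤ 1 / 2 := by
    calc L * γ₀ ≤ L * (1 / (2 * (L + 1))) := by gcongr; exact min_le_left _ _
      _ ≤ 1 / 2 := by
        rw [mul_one_div, div_le_div_iff₀ (by positivity) two_pos]
        nlinarith [L.2]
  have haγ₀ : (a * γ₀) ^ r.toReal ≤ ε / 2 := by
    have h1 : a * γ₀ ≤ (ε / 2) ^ (1 / r.toReal) := by
      calc a * γ₀ ≤ a * ((ε / 2) ^ (1 / r.toReal) / (a + 1)) := by
            gcongr; exact min_le_right _ _
        _ = (ε / 2) ^ (1 / r.toReal) * (a / (a + 1)) := by ring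
        _ ≤ (ε / 2) ^ (1 / r.toReal) * 1 := by
            gcongr
            rw [div_le_one (by positivity)]
            linarith
        _ = _ := mul_one _
    calc (a * γ₀) ^ r.toReal ≤ ((ε / 2) ^ (1 / r.toReal)) ^ r.toReal := by gcongr
      _ = ε / 2 := by
        rw [← Real.rpow_mul (by positivity), one_div_mul_cancel hrp.ne', Real.rpow_one]
  set C₀ : ℝ := (2 * 2 ^ σ * (2 ^ σ * (σ / (σ - 1)))) ^ (1 / σ) / γ₀ with hC₀
  have hσ10 : 0 < σ - 1 := by linarith
  refine ⟨C₀.toNNReal, ?_⟩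
  intro Ω mΩ P _ ℱ d φ n B hn hB hφ hφn hd hdD hd0 hcarl
  set N : ℝ := (n : ℝ) ^ (1 / p - 1 / 2) with hN
  have hN1 : 1 ≤ N := Real.one_le_rpow (by exact_mod_cast hn) (by
    rw [sub_nonneg]
    exact one_div_le_one_div_of_le hp0 hp2)
  have hN0 : 0 < N := by linarith
  -- Dividing by `N * B` makes both smallness requirements independent of `n` and `B`; the final
  -- constant is proportional to `1 / γ`, which is where the factor `N * B` of the estimate comes
  -- from.
  set γ : ℝ := γ₀ / (N * B) with hγ
  have hγ0 : 0 < γ := by positivity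
  have hDγ : L * B * γ ≤ 1 / 2 := by
    calc L * B * γ = L * γ₀ / N := by rw [hγ]; field_simp
      _ ≤ L * γ₀ / 1 := by gcongr
      _ ≤ 1 / 2 := by rw [div_one]; exact hLγ₀
  set G : ℕ → Ω → X := fun k ω => ∑ i ∈ Finset.range k, d i ω • φ i ω with hG
  have hφm : ∀ i, StronglyMeasurable (φ i) := fun i => (hφ.1 i).mono (ℱ.le i)
  have hGm : ∀ k, StronglyMeasurable (G k) := fun k =>
    Finset.stronglyMeasurable_fun_sum _ fun i _ => ((hd i).mono (ℱ.le _)).smul (hφm i)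
  set M : Ω → ℝ := fun ω =>
    (Finset.range (n + 1)).sup' Finset.nonempty_range_add_one fun k => ‖G k ω‖ with hM
  set F : Ω → ℝ := fun ω =>
    (Finset.range (n + 1)).sup' Finset.nonempty_range_add_one fun k => ‖φ k ω‖ with hF
  have hMm : Measurable M :=
    Finset.measurable_range_sup'' (f := fun k ω => ‖G k ω‖) fun k _ => (hGm k).norm.measurable
  have hFm : Measurable F :=
    Finset.measurable_range_sup'' (f := fun k ω => ‖φ k ω‖) fun k _ => (hφm k).norm.measurable
  have hGM : ∀ k ≤ n, ∀ ω, ‖G k ω‖ ≤ M ω := fun k hk ω =>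
    Finset.le_sup' (fun k => ‖G k ω‖) (Finset.mem_range_succ_iff.2 hk)
  have hφF : ∀ k ≤ n, ∀ ω, ‖φ k ω‖ ≤ F ω := fun k hk ω =>
    Finset.le_sup' (fun k => ‖φ k ω‖) (Finset.mem_range_succ_iff.2 hk)
  have hM0 : 0 ≤ M := fun ω => (norm_nonneg _).trans (hGM 0 n.zero_le ω)
  have hF0 : 0 ≤ F := fun ω => (norm_nonneg _).trans (hφF 0 n.zero_le ω)
  have hMset : ∀ t : ℝ, {ω | t < M ω} = {ω | ∃ k ≤ n, t < ‖G k ω‖} := fun t => by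
    ext ω
    simp [hM, Finset.lt_sup'_iff]
  have hφLp : ∀ i ≤ n, MemLp (φ i) s P := fun i hi =>
    (hφn.condExp (m := ℱ i) hs1.le).ae_eq (hφ.2 i n hi)
  -- The a priori finiteness needed for absorption: for fixed `n`, `M` is dominated by a finite sum
  -- of `L_s` functions. The size of this bound does not enter the constant.
  have hfin : ∫⁻ ω, ENNReal.ofReal (M ω ^ σ) ∂P ≠ ∞ := by
    have h1 : MemLp (fun ω => ∑ i ∈ Finset.range n, L * B * ‖φ i ω‖) s P :=
      memLp_finsetSum _ fun i hi => (hφLp i (Finset.mem_range.1 hi).le).norm.const_mul _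
    have h2 : MemLp M s P := h1.mono hMm.aestronglyMeasurable (ae_of_all _ fun ω => by
      rw [Real.norm_of_nonneg (hM0 ω), Real.norm_of_nonneg (by positivity)]
      refine Finset.sup'_le _ _ fun k hk => ?_
      calc ‖G k ω‖ ≤ ∑ i ∈ Finset.range k, L * B * ‖φ i ω‖ :=
            norm_sum_le_of_le _ fun i _ => by
              rw [norm_smul]
              exact mul_le_mul_of_nonneg_right (hdD i ω) (norm_nonneg _)
        _ ≤ _ := Finset.sum_le_sum_of_subset_of_nonneg
            (Finset.range_subset_range.2 (Finset.mem_range_succ_iff.1 hk))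
            fun i _ _ => by positivity)
    have h3 := lintegral_ofReal_norm_rpow (P := P) M hs0 hs
    simp_rw [Real.norm_of_nonneg (hM0 _)] at h3
    rw [hσ, h3]
    exact ENNReal.rpow_ne_top_of_nonneg ENNReal.toReal_nonneg h2.2.ne
  have hgood : ∀ t : ℝ, 0 < t → P {ω | 2 * t < M ω} ≤
      P {ω | γ * t < F ω} + ENNReal.ofReal ((2 * 2 ^ σ)⁻¹) * P {ω | t < M ω} := by
    intro t ht
    have h := good_lambda_paraproduct hp1 hp2 hr1 hr (fun f hf N hN => hT Ω P ℱ f hf N hN)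
      (K := K) (γ := γ) (t := t) hd hφ.1 hdD hd0 hcarl hB hK0 hγ0 ht hDγ
    rw [hMset, hMset]
    refine h.trans (add_le_add (measure_mono ?_) (mul_le_mul' ?_ le_rfl))
    · rintro ω ⟨i, hi, hit⟩
      exact hit.trans_le (hφF i hi.le ω)
    · rw [hK2]
      have h1 : (CT : ℝ≥0∞) * ENNReal.ofReal (2 * γ * (n : ℝ) ^ (1 / p - 1 / 2) *
          Real.sqrt ((K * B) ^ 2 + (L * B) ^ 2)) = ENNReal.ofReal (a * γ₀) := by
        rw [← ENNReal.ofReal_coe_nnreal, ← ENNReal.ofReal_mul (by positivity)]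
        congr 1
        rw [show (K * B) ^ 2 + (L * B) ^ 2 = (K ^ 2 + L ^ 2) * B ^ 2 by ring,
          Real.sqrt_mul (by positivity), Real.sqrt_sq hB.le, ha, hγ, ← hN]
        field_simp
      rw [h1, ENNReal.ofReal_rpow_of_nonneg (by positivity) hrp.le,
        ← ENNReal.ofReal_add (by positivity) (by positivity)]
      apply ENNReal.ofReal_le_ofReal
      linarith
  have h1 := lintegral_rpow_le_of_good_lambda hM0 hF0 hMm.aemeasurable hFm.aemeasurable hσ0 hγ0
    hgood hfin
  have h2 := lintegral_sup_rpow_le_of_submartingale (submartingale_norm_of_martingale hφ)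
    (fun i ω => norm_nonneg _) hσ1 n
  rw [lintegral_ofReal_norm_rpow (φ n) hs0 hs] at h2
  have h3 : eLpNorm (G n) s P ^ σ ≤ ENNReal.ofReal (2 * (2 / γ) ^ σ) *
      (ENNReal.ofReal (2 ^ σ * (σ / (σ - 1))) * eLpNorm (φ n) s P ^ σ) := by
    rw [hσ, ← lintegral_ofReal_norm_rpow (G n) hs0 hs]
    refine le_trans (lintegral_mono fun ω => ?_) (h1.trans ?_)
    · exact ENNReal.ofReal_le_ofReal
        (Real.rpow_le_rpow (norm_nonneg _) (hGM n le_rfl ω) hσ0.le)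
    · gcongr
  have h4 := ENNReal.rpow_le_rpow h3 (by positivity : 0 ≤ 1 / σ)
  rw [← ENNReal.rpow_mul, mul_one_div_cancel hσ0.ne', ENNReal.rpow_one, ← mul_assoc,
    ← ENNReal.ofReal_mul (by positivity), ENNReal.mul_rpow_of_nonneg _ _ (by positivity),
    ← ENNReal.rpow_mul, mul_one_div_cancel hσ0.ne', ENNReal.rpow_one,
    ENNReal.ofReal_rpow_of_nonneg (by positivity) (by positivity)] at h4
  refine h4.trans (mul_le_mul' (le_of_eq ?_) le_rfl)
  rw [← ENNReal.ofReal_coe_nnreal, Real.coe_toNNReal _ (by positivity),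
    ← ENNReal.ofReal_mul (by positivity), ← ENNReal.ofReal_mul (by positivity)]
  congr 1
  rw [Real.div_rpow two_pos.le hγ0.le,
    show 2 * (2 ^ σ / γ ^ σ) * (2 ^ σ * (σ / (σ - 1))) =
      (2 * 2 ^ σ * (2 ^ σ * (σ / (σ - 1)))) / γ ^ σ by ring,
    Real.div_rpow (by positivity) (by positivity), ← Real.rpow_mul hγ0.le,
    mul_one_div_cancel hσ0.ne', Real.rpow_one, hC₀, hγ]
  field_simp

end Bound

/-! ### Computing `L_s` norms by pairing with simple functions. -/

section Norming

variable {𝕜 : Type*} [RCLike 𝕜] {Y Z : Type*} [NormedAddCommGroup Y] [NormedSpace 𝕜 Y]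
  [NormedAddCommGroup Z] [NormedSpace 𝕜 Z]
  {Ω : Type*} {mΩ : MeasurableSpace Ω} {μ : Measure Ω}

theorem enorm_integral_bilin_le (b : Y →L[𝕜] Z →L[𝕜] 𝕜) (hb : ∀ y z, ‖b y z‖ ≤ ‖y‖ * ‖z‖)
    {s s' : ℝ≥0∞} [ENNReal.HolderConjugate s s'] {h : Ω → Y} {k : Ω → Z}
    (hh : AEStronglyMeasurable h μ) (hk : AEStronglyMeasurable k μ) :
    ‖∫ ω, b (h ω) (k ω) ∂μ‖ₑ ≤ eLpNorm h s μ * eLpNorm k s' μ := by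
  have h1 := eLpNorm_le_eLpNorm_mul_eLpNorm_of_nnnorm (p := s) (q := s') (r := 1) hh hk
    (fun y z => b y z) 1 (ae_of_all _ fun ω => by
      rw [one_mul]
      exact hb _ _)
  rw [ENNReal.coe_one, one_mul, eLpNorm_one_eq_lintegral_enorm] at h1
  exact (enorm_integral_le_lintegral_enorm _).trans h1

/-- The `L_s` norm of a vector-valued function is determined by pairing it with simple functions
with values in a norming space. -/
theorem eLpNorm_le_of_forall_simpleFunc (b : Y →L[𝕜] Z →L[𝕜] 𝕜)
    (hb : ∀ y z, ‖b y z‖ ≤ ‖y‖ * ‖z‖)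
    (hnorming : ∀ y, ∀ c : ℝ, 0 < c → c < 1 → ∃ z, ‖z‖ ≤ 1 ∧ c * ‖y‖ ≤ RCLike.re (b y z))
    {s s' : ℝ≥0∞} [hss : ENNReal.HolderConjugate s s'] (hs1 : 1 < s) (hs : s ≠ ∞) {h : Ω → Y}
    (hh : MemLp h s μ) {A : ℝ≥0∞}
    (H : ∀ k : SimpleFunc Ω Z, MemLp k s' μ → ‖∫ ω, b (h ω) (k ω) ∂μ‖ₑ ≤ A * eLpNorm k s' μ) :
    eLpNorm h s μ ≤ A := by
  have hs0 : s ≠ 0 := (zero_lt_one.trans hs1).ne'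
  have hs'1 : 1 < s' := (ENNReal.HolderConjugate.lt_top_iff_one_lt s s').1 hs.lt_top
  have hs' : s' ≠ ∞ := ((ENNReal.HolderConjugate.lt_top_iff_one_lt s' s).2 hs1).ne
  have hs'0 : s' ≠ 0 := (zero_lt_one.trans hs'1).ne'
  set σ := s.toReal with hσ
  set σ' := s'.toReal with hσ'
  have hconj : σ.HolderConjugate σ' := ENNReal.HolderConjugate.toReal_of_ne_top hs hs'
  have hσ1 : 1 < σ := hconj.lt
  have hσ0 : 0 < σ := hconj.pos
  have hσ'0 : 0 < σ' := hconj.symm.pos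
  by_cases hA : A = ∞
  · simp [hA]
  have step : ∀ c : ℝ, 0 < c → c < 1 → ∀ ε : ℝ≥0∞, ε ≠ 0 →
      ENNReal.ofReal c * eLpNorm h s μ ≤ A + 2 * ε := by
    intro c hc0 hc1 ε hε
    obtain ⟨h', hh'ε, hh'⟩ := hh.exists_simpleFunc_eLpNorm_sub_lt hs hε
    choose z hz1 hz2 using fun y => hnorming y c hc0 hc1
    -- The extremal function of Hölder's inequality, up to the factor `c`. Since `h'` is simple, the
    -- choice of the norming vectors `z` raises no measurability question and `k` is simple again.
    set k : SimpleFunc Ω Z := h'.map fun y => ((‖y‖ ^ (σ - 1) : ℝ) : 𝕜) • z y with hk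
    have hkω : ∀ ω, k ω = ((‖h' ω‖ ^ (σ - 1) : ℝ) : 𝕜) • z (h' ω) := fun ω => rfl
    set N := eLpNorm h' s μ with hN
    have hNtop : N ≠ ∞ := hh'.2.ne
    have hknorm : eLpNorm k s' μ ≤ N ^ (σ - 1) := by
      have h1 : eLpNorm k s' μ ^ σ' ≤ N ^ σ := by
        rw [hσ', hN, hσ, ← lintegral_ofReal_norm_rpow _ hs'0 hs',
          ← lintegral_ofReal_norm_rpow _ hs0 hs]
        refine lintegral_mono fun ω => ENNReal.ofReal_le_ofReal ?_
        have h2 : ‖k ω‖ ≤ ‖h' ω‖ ^ (σ - 1) := by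
          rw [hkω, norm_smul, RCLike.norm_ofReal, abs_of_nonneg (by positivity)]
          exact mul_le_of_le_one_right (by positivity) (hz1 _)
        calc ‖k ω‖ ^ σ' ≤ (‖h' ω‖ ^ (σ - 1)) ^ σ' := by gcongr
          _ = ‖h' ω‖ ^ σ := by
            rw [← Real.rpow_mul (norm_nonneg _), hconj.sub_one_mul_conj]
      calc eLpNorm k s' μ = (eLpNorm k s' μ ^ σ') ^ (1 / σ') := by
            rw [← ENNReal.rpow_mul, mul_one_div_cancel hσ'0.ne', ENNReal.rpow_one]
        _ ≤ (N ^ σ) ^ (1 / σ') := by gcongr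
        _ = N ^ (σ - 1) := by
            rw [← ENNReal.rpow_mul, mul_one_div, hconj.div_conj_eq_sub_one]
    have hkLp : MemLp k s' μ := ⟨k.aestronglyMeasurable, hknorm.trans_lt
      (ENNReal.rpow_lt_top_of_nonneg (by linarith) hNtop)⟩
    have hlow : ENNReal.ofReal c * N ^ σ ≤ ‖∫ ω, b (h' ω) (k ω) ∂μ‖ₑ := by
      have hint : Integrable (fun ω => b (h' ω) (k ω)) μ := memLp_one_iff_integrable.1
        (b.memLp_of_bilin 1 hh' hkLp)
      have hintn : Integrable (fun ω => c * ‖h' ω‖ ^ σ) μ :=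
        (hh'.integrable_norm_rpow hs0 hs).const_mul c
      have h1 : ∫ ω, c * ‖h' ω‖ ^ σ ∂μ ≤ ∫ ω, RCLike.re (b (h' ω) (k ω)) ∂μ := by
        refine integral_mono hintn hint.re fun ω => ?_
        simp only [hkω, map_smul, smul_eq_mul, RCLike.re_ofReal_mul]
        rcases (norm_nonneg (h' ω)).eq_or_lt with h0 | h0
        · rw [← h0, Real.zero_rpow hσ0.ne', Real.zero_rpow (by linarith)]
          simp
        · calc c * ‖h' ω‖ ^ σ = ‖h' ω‖ ^ (σ - 1) * (c * ‖h' ω‖) := by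
                rw [mul_left_comm, ← Real.rpow_add_one h0.ne', sub_add_cancel]
            _ ≤ _ := by gcongr; exact hz2 _
      have h2 : ∫ ω, RCLike.re (b (h' ω) (k ω)) ∂μ ≤ ‖∫ ω, b (h' ω) (k ω) ∂μ‖ := by
        rw [integral_re hint]
        exact RCLike.re_le_norm _
      have h3 : ENNReal.ofReal c * N ^ σ = ENNReal.ofReal (∫ ω, c * ‖h' ω‖ ^ σ ∂μ) := by
        rw [ofReal_integral_eq_lintegral_ofReal hintn (ae_of_all _ fun ω => by positivity), hN, hσ,
          ← lintegral_ofReal_norm_rpow _ hs0 hs, ← lintegral_const_mul' _ _ ENNReal.ofReal_ne_top]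
        congr 1 with ω
        rw [ENNReal.ofReal_mul hc0.le]
      rw [h3, ← ofReal_norm]
      exact ENNReal.ofReal_le_ofReal (h1.trans h2)
    have hup : ‖∫ ω, b (h' ω) (k ω) ∂μ‖ₑ ≤ (A + ε) * N ^ (σ - 1) := by
      have i1 : Integrable (fun ω => b (h ω) (k ω)) μ := memLp_one_iff_integrable.1
        (b.memLp_of_bilin 1 hh hkLp)
      have i2 : Integrable (fun ω => b ((h - h') ω) (k ω)) μ := memLp_one_iff_integrable.1
        (b.memLp_of_bilin 1 (hh.sub hh') hkLp)
      have h1 : ∫ ω, b (h' ω) (k ω) ∂μ =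
          ∫ ω, b (h ω) (k ω) ∂μ - ∫ ω, b ((h - h') ω) (k ω) ∂μ := by
        rw [← integral_sub i1 i2]
        congr 1 with ω
        simp
      rw [h1]
      refine (enorm_sub_le).trans ?_
      rw [add_mul]
      refine add_le_add ((H k hkLp).trans (by gcongr)) ?_
      refine (enorm_integral_bilin_le b hb (s := s) (s' := s') (hh.sub hh').1 hkLp.1).trans ?_
      gcongr
    -- The lower bound `c N^σ` and the upper bound `(A + ε) N^(σ - 1)` for the same pairing are
    -- divided by `N^(σ - 1)`.
    have hcN : ENNReal.ofReal c * N ≤ A + ε := by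
      by_cases hN0 : N = 0
      · simp [hN0]
      have h1 := hlow.trans hup
      have h2 : N ^ σ = N * N ^ (σ - 1) := by
        nth_rewrite 2 [← ENNReal.rpow_one N]
        rw [← ENNReal.rpow_add _ _ hN0 hNtop]
        congr 1
        ring
      rw [h2, ← mul_assoc] at h1
      have hne : N ^ (σ - 1) ≠ 0 := by simp [ENNReal.rpow_eq_zero_iff, hN0, hNtop]
      have hnt : N ^ (σ - 1) ≠ ∞ := ENNReal.rpow_ne_top_of_nonneg (by linarith) hNtop
      exact (ENNReal.mul_le_mul_iff_left hne hnt).1 h1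
    have htri : eLpNorm h s μ ≤ ε + N := by
      have h1 : h = (h - h') + h' := by simp
      rw [h1]
      exact (eLpNorm_add_le (hh.sub hh').1 hh'.1 hs1.le).trans (by gcongr)
    calc ENNReal.ofReal c * eLpNorm h s μ ≤ ENNReal.ofReal c * (ε + N) := by gcongr
      _ = ENNReal.ofReal c * ε + ENNReal.ofReal c * N := mul_add _ _ _
      _ ≤ 1 * ε + (A + ε) := by
          gcongr
          exact ENNReal.ofReal_le_one.2 hc1.le
      _ = A + 2 * ε := by ring
  have step2 : ∀ c : ℝ, 0 < c → c < 1 → ENNReal.ofReal c * eLpNorm h s μ ≤ A := by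
    intro c hc0 hc1
    refine ENNReal.le_of_forall_pos_le_add fun ε hε _ => ?_
    have := step c hc0 hc1 (ε / 2 : ℝ≥0) (by simpa using hε.ne')
    refine this.trans (le_of_eq ?_)
    congr 1
    rw [ENNReal.coe_div two_ne_zero]
    exact ENNReal.mul_div_cancel two_ne_zero (by simp)
  have hlim : Tendsto (fun c : ℝ => ENNReal.ofReal c * eLpNorm h s μ) (𝓝[<] 1)
      (𝓝 (ENNReal.ofReal 1 * eLpNorm h s μ)) := by
    refine ENNReal.Tendsto.mul_const ?_ (Or.inr hh.2.ne)
    exact (ENNReal.continuous_ofReal.tendsto 1).mono_left nhdsWithin_le_nhds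
  rw [ENNReal.ofReal_one, one_mul] at hlim
  refine le_of_tendsto hlim ?_
  filter_upwards [Ioo_mem_nhdsLT (zero_lt_one' ℝ)] with c hc
  exact step2 c hc.1 hc.2

/-- A functional almost attains its norm. -/
theorem exists_le_re_apply (y : StrongDual 𝕜 Z) (c : ℝ) (hc1 : c < 1) :
    ∃ z, ‖z‖ ≤ 1 ∧ c * ‖y‖ ≤ RCLike.re (y z) := by
  by_cases hy : ‖y‖ = 0
  · exact ⟨0, by simp, by simp [hy]⟩
  have hy0 : 0 < ‖y‖ := lt_of_le_of_ne (norm_nonneg _) (Ne.symm hy)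
  obtain ⟨x, hx1, hx2⟩ := y.exists_lt_apply_of_lt_opNorm
    (mul_lt_of_lt_one_left hy0 hc1 : c * ‖y‖ < ‖y‖)
  obtain ⟨α, hα1, hα⟩ := RCLike.exists_norm_eq_mul_self (y x)
  refine ⟨α • x, ?_, ?_⟩
  · rw [norm_smul, hα1, one_mul]
    exact hx1.le
  · rw [map_smul, smul_eq_mul, ← hα, RCLike.ofReal_re]
    exact hx2.le

end Norming

/-! ### Martingale cotype of a space and martingale type of its dual. -/

section Duality

variable {𝕜 : Type w} [RCLike 𝕜] {X : Type v} [NormedAddCommGroup X] [NormedSpace ℝ X]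
  [NormedSpace 𝕜 X] [IsScalarTower ℝ 𝕜 X] [CompleteSpace X]
  {Ω : Type*} {mΩ : MeasurableSpace Ω} {P : Measure Ω} [IsProbabilityMeasure P]

/-- The factor known at time `m` leaves the conditional expectation of the pairing, and the other
one averages to zero. Together with its mirror image this kills the cross terms when two martingales
are paired. -/
theorem integral_apply_eq_zero_of_condExp_right {m : MeasurableSpace Ω} (hm : m ≤ mΩ)
    {g : Ω → StrongDual 𝕜 X} {f : Ω → X} (hg : StronglyMeasurable[m] g) (hf : Integrable f P)
    (hgf : Integrable (fun ω => g ω (f ω)) P) (h0 : P[f | m] =ᵐ[P] 0) :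
    ∫ ω, g ω (f ω) ∂P = 0 := by
  have h := condExp_bilin_of_stronglyMeasurable_left (m := m) (μ := P)
    (ContinuousLinearMap.restrictScalarsL 𝕜 X 𝕜 ℝ ℝ) hg hgf hf
  rw [← integral_condExp hm]
  refine integral_eq_zero_of_ae ?_
  filter_upwards [h, h0] with ω h1 h2
  refine h1.trans ?_
  simp [h2]

omit [CompleteSpace X] in
theorem integral_apply_eq_zero_of_condExp_left {m : MeasurableSpace Ω} (hm : m ≤ mΩ)
    {g : Ω → StrongDual 𝕜 X} {f : Ω → X} (hf : StronglyMeasurable[m] f) (hg : Integrable g P)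
    (hgf : Integrable (fun ω => g ω (f ω)) P) (h0 : P[g | m] =ᵐ[P] 0) :
    ∫ ω, g ω (f ω) ∂P = 0 := by
  have h := condExp_bilin_of_stronglyMeasurable_right (m := m) (μ := P)
    (ContinuousLinearMap.restrictScalarsL 𝕜 X 𝕜 ℝ ℝ) hf hgf hg
  rw [← integral_condExp hm]
  refine integral_eq_zero_of_ae ?_
  filter_upwards [h, h0] with ω h1 h2
  refine h1.trans ?_
  simp [h2]

/-- Summation by parts for the pairing of two martingales. -/
theorem integral_martingale_pairing {ℱ : Filtration ℕ mΩ} {g : ℕ → Ω → StrongDual 𝕜 X}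
    {f : ℕ → Ω → X} (hg : Martingale g ℱ P) (hf : Martingale f ℱ P) {r r' : ℝ≥0∞}
    [ENNReal.HolderConjugate r' r] {N : ℕ} (hgLp : ∀ n ≤ N, MemLp (g n) r' P)
    (hfLp : ∀ n ≤ N, MemLp (f n) r P) :
    ∫ ω, g N ω (f N ω) ∂P = ∫ ω, (g 0 ω (f 0 ω) + ∑ n ∈ Finset.range N,
      (g (n + 1) ω - g n ω) (f (n + 1) ω - f n ω)) ∂P := by
  have hint : ∀ {u : Ω → StrongDual 𝕜 X} {v : Ω → X}, MemLp u r' P → MemLp v r P →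
      Integrable (fun ω => u ω (v ω)) P := fun hu hv => memLp_one_iff_integrable.1
    ((ContinuousLinearMap.id 𝕜 (StrongDual 𝕜 X)).memLp_of_bilin 1 hu hv)
  induction N with
  | zero => simp
  | succ N ih =>
    have gN := hgLp N N.le_succ
    have gN' := hgLp (N + 1) le_rfl
    have fN := hfLp N N.le_succ
    have fN' := hfLp (N + 1) le_rfl
    have dg0 : P[fun ω => g (N + 1) ω - g N ω | ℱ N] =ᵐ[P] 0 := by
      refine (condExp_sub (hg.integrable _) (hg.integrable _) _).trans ?_
      filter_upwards [hg.2 N (N + 1) N.le_succ, hg.2 N N le_rfl] with ω h1 h2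
      simp [h1, h2]
    have df0 : P[fun ω => f (N + 1) ω - f N ω | ℱ N] =ᵐ[P] 0 := by
      refine (condExp_sub (hf.integrable _) (hf.integrable _) _).trans ?_
      filter_upwards [hf.2 N (N + 1) N.le_succ, hf.2 N N le_rfl] with ω h1 h2
      simp [h1, h2]
    have i1 : Integrable (fun ω => (g N ω) (f (N + 1) ω - f N ω)) P := hint gN (fN'.sub fN)
    have i2 : Integrable (fun ω => (g (N + 1) ω - g N ω) (f N ω)) P := hint (gN'.sub gN) fN
    have i3 : Integrable (fun ω => (g (N + 1) ω - g N ω) (f (N + 1) ω - f N ω)) P :=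
      hint (gN'.sub gN) (fN'.sub fN)
    have i0 := hint gN fN
    have z1 : ∫ ω, (g N ω) (f (N + 1) ω - f N ω) ∂P = 0 :=
      integral_apply_eq_zero_of_condExp_right (ℱ.le N) (hg.1 N)
      ((hf.integrable (N + 1)).sub (hf.integrable N)) i1 df0
    have z2 : ∫ ω, (g (N + 1) ω - g N ω) (f N ω) ∂P = 0 :=
      integral_apply_eq_zero_of_condExp_left (ℱ.le N) (hf.1 N)
      ((hg.integrable (N + 1)).sub (hg.integrable N)) i2 dg0
    have hsum : ∀ M ≤ N, Integrable (fun ω => g 0 ω (f 0 ω) + ∑ n ∈ Finset.range M,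
        (g (n + 1) ω - g n ω) (f (n + 1) ω - f n ω)) P := fun M hM =>
      (hint (hgLp 0 (by omega)) (hfLp 0 (by omega))).add (integrable_finsetSum _ fun n hn => by
        have := Finset.mem_range.1 hn
        exact hint ((hgLp (n + 1) (by omega)).sub (hgLp n (by omega)))
          ((hfLp (n + 1) (by omega)).sub (hfLp n (by omega))))
    simp_rw [Finset.sum_range_succ, ← add_assoc]
    rw [integral_add (hsum N le_rfl) i3, ← ih (fun n hn => hgLp n (hn.trans N.le_succ))
      (fun n hn => hfLp n (hn.trans N.le_succ))]
    -- Both factors are split into value at `N` plus increment; the two mixed terms are `z1` and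
    -- `z2`.
    have : (fun ω => g (N + 1) ω (f (N + 1) ω)) = fun ω => ((g N ω (f N ω) +
        (g N ω) (f (N + 1) ω - f N ω)) + (g (N + 1) ω - g N ω) (f N ω)) +
          (g (N + 1) ω - g N ω) (f (N + 1) ω - f N ω) := by
      ext ω
      simp only [map_sub, sub_apply]
      ring
    have j1 : Integrable (fun ω => (g N ω) (f N ω) + (g N ω) (f (N + 1) ω - f N ω)) P := i0.add i1
    have j2 : Integrable (fun ω => (g N ω) (f N ω) + (g N ω) (f (N + 1) ω - f N ω) +
      (g (N + 1) ω - g N ω) (f N ω)) P := j1.add i2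
    rw [this, integral_add j2 i3, integral_add j1 i2, integral_add i0 i1, z2, z1, add_zero,
      add_zero]

/-- Martingale cotype `q` of a space implies martingale type `q / (q - 1)` of its dual. -/
theorem HasMartingaleCotype.hasMartingaleType_dual {q q' : ℝ} (hq : q.HolderConjugate q')
    (hX : HasMartingaleCotype.{u} X q) : HasMartingaleType.{u} (StrongDual 𝕜 X) q' := by
  obtain ⟨r, hr1, hr, C, hC⟩ := hX
  have : Fact (1 ≤ r) := ⟨hr1.le⟩
  set r' := r.conjExponent
  have hrr : ENNReal.HolderConjugate r r' := .conjExponent hr1.le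
  have hrr' : ENNReal.HolderConjugate r' r := hrr.symm
  have hr'1 : 1 < r' := (ENNReal.HolderConjugate.lt_top_iff_one_lt r r').1 hr.lt_top
  have hr' : r' ≠ ∞ := ((ENNReal.HolderConjugate.lt_top_iff_one_lt r' r).2 hr1).ne
  refine ⟨r', hr'1, hr', C, fun Ω mΩ P _ ℱ g hg N hgLp => ?_⟩
  refine eLpNorm_le_of_forall_simpleFunc (ContinuousLinearMap.id 𝕜 (StrongDual 𝕜 X))
    (fun y z => y.le_opNorm z) (fun y c _ hc => exists_le_re_apply y c hc) (s' := r) hr'1 hr'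
    (hgLp N le_rfl) fun k hk => ?_
  -- Conditioning the test function gives an `X`-valued martingale to which the cotype inequality
  -- applies; `g N` cannot distinguish `k` from `f N`.
  set f : ℕ → Ω → X := fun n => P[k | ℱ n] with hf
  have hfm : Martingale f ℱ P := martingale_condExp _ _ _
  have hfLp : ∀ n ≤ N, MemLp (f n) r P := fun n _ => hk.condExp hr1.le
  have hkint : Integrable k P := hk.integrable hr1.le
  have hgk : Integrable (fun ω => g N ω (k ω)) P := memLp_one_iff_integrable.1
    ((ContinuousLinearMap.id 𝕜 (StrongDual 𝕜 X)).memLp_of_bilin 1 (hgLp N le_rfl) hk)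
  have h1 : ∫ ω, (g N ω) (k ω) ∂P = ∫ ω, g N ω (f N ω) ∂P := by
    rw [← integral_condExp (ℱ.le N)]
    exact integral_congr_ae (condExp_bilin_of_stronglyMeasurable_left (m := ℱ N) (μ := P)
      (ContinuousLinearMap.restrictScalarsL 𝕜 X 𝕜 ℝ ℝ) (hg.1 N) hgk hkint)
  simp only [ContinuousLinearMap.id_apply]
  rw [h1, integral_martingale_pairing hg hfm hgLp hfLp]
  set u : Ω → ℝ := fun ω => (‖g 0 ω‖ ^ q' +
    ∑ n ∈ Finset.range N, ‖g (n + 1) ω - g n ω‖ ^ q') ^ (1 / q') with hu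
  set v : Ω → ℝ := fun ω => (‖f 0 ω‖ ^ q +
    ∑ n ∈ Finset.range N, ‖f (n + 1) ω - f n ω‖ ^ q) ^ (1 / q) with hv
  have hgm : ∀ n, AEStronglyMeasurable (g n) P := fun n =>
    ((hg.1 n).mono (ℱ.le n)).aestronglyMeasurable
  have hfmm : ∀ n, AEStronglyMeasurable (f n) P := fun n =>
    ((hfm.1 n).mono (ℱ.le n)).aestronglyMeasurable
  have hum : AEStronglyMeasurable u P := by
    refine AEMeasurable.aestronglyMeasurable (AEMeasurable.pow_const (AEMeasurable.add
      ((hgm 0).norm.aemeasurable.pow_const _) (Finset.aemeasurable_fun_sum _ fun n _ => ?_)) _)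
    exact ((hgm (n + 1)).sub (hgm n)).norm.aemeasurable.pow_const _
  have hvm : AEStronglyMeasurable v P := by
    refine AEMeasurable.aestronglyMeasurable (AEMeasurable.pow_const (AEMeasurable.add
      ((hfmm 0).norm.aemeasurable.pow_const _) (Finset.aemeasurable_fun_sum _ fun n _ => ?_)) _)
    exact ((hfmm (n + 1)).sub (hfmm n)).norm.aemeasurable.pow_const _
  have hpt : ∀ ω, ‖g 0 ω (f 0 ω) + ∑ n ∈ Finset.range N,
      (g (n + 1) ω - g n ω) (f (n + 1) ω - f n ω)‖ ≤ u ω * v ω := by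
    intro ω
    -- Index `0` carries the initial value and index `n + 1` the `n`-th increment, so that a single
    -- Hölder inequality covers both.
    set a : ℕ → ℝ := fun n => Nat.casesOn n ‖g 0 ω‖ fun n => ‖g (n + 1) ω - g n ω‖
    set c : ℕ → ℝ := fun n => Nat.casesOn n ‖f 0 ω‖ fun n => ‖f (n + 1) ω - f n ω‖
    have h := Real.inner_le_Lp_mul_Lq_of_nonneg (Finset.range (N + 1)) (f := a) (g := c) hq.symm
      (fun i _ => by cases i <;> exact norm_nonneg _)
      (fun i _ => by cases i <;> exact norm_nonneg _)
    simp_rw [Finset.sum_range_succ'] at h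
    have e1 : (∑ n ∈ Finset.range N, a (n + 1) ^ q' + a 0 ^ q') ^ (1 / q') = u ω := by
      rw [add_comm]
      rfl
    have e2 : (∑ n ∈ Finset.range N, c (n + 1) ^ q + c 0 ^ q) ^ (1 / q) = v ω := by
      rw [add_comm]
      rfl
    rw [e1, e2] at h
    refine le_trans ?_ h
    rw [add_comm]
    refine (norm_add_le _ _).trans (add_le_add (norm_sum_le_of_le _ fun n _ => ?_) ?_)
    exacts [ContinuousLinearMap.le_opNorm _ _, ContinuousLinearMap.le_opNorm _ _]
  calc _ ≤ ∫⁻ ω, ‖u ω * v ω‖ₑ ∂P := by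
        refine (enorm_integral_le_lintegral_enorm _).trans (lintegral_mono fun ω => ?_)
        refine enorm_le_iff_norm_le.2 ((hpt ω).trans (le_abs_self _))
    _ ≤ eLpNorm u r' P * eLpNorm v r P := by
        have := eLpNorm_le_eLpNorm_mul_eLpNorm_of_nnnorm (p := r') (q := r) (r := 1) hum hvm
          (fun y z => y * z) 1 (ae_of_all _ fun ω => by simp)
        rwa [ENNReal.coe_one, one_mul, eLpNorm_one_eq_lintegral_enorm] at this
    _ ≤ eLpNorm u r' P * (C * eLpNorm (f N) r P) := by
        gcongr
        exact hC Ω P ℱ f hfm N hfLp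
    _ ≤ eLpNorm u r' P * (C * eLpNorm k r P) := by
        gcongr
        exact eLpNorm_condExp_le_eLpNorm _ hr1.le
    _ = _ := by ring

end Duality

/-! ### Dyadic cubes as labels of points, and the filtration they generate. -/

theorem stronglyMeasurable_comap_comp_of_countable_range {α β Y : Type*} [TopologicalSpace Y]
    [TopologicalSpace.PseudoMetrizableSpace Y] {c : α → β} (hc : (Set.range c).Countable)
    (h : β → Y) : StronglyMeasurable[MeasurableSpace.comap c ⊤] fun x => h (c x) := by
  borelize Y
  let _ : MeasurableSpace α := MeasurableSpace.comap c ⊤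
  refine stronglyMeasurable_iff_measurable_separable.2 ⟨?_, ?_⟩
  · exact (measurable_from_top (f := h)).comp (comap_measurable _)
  · refine Set.Countable.isSeparable ((hc.image h).mono ?_)
    rintro _ ⟨x, rfl⟩
    exact ⟨_, ⟨x, rfl⟩, rfl⟩

namespace DyadicSystem

variable {E : Type u} [MetricSpace E] [MeasurableSpace E] {μ : Measure E} {δ r₀ r₁ : ℝ}
  (D : DyadicSystem μ δ r₀ r₁)

/-- A measurable set of full measure, each point of which lies in exactly one cube of each
generation. -/
def goodSet : Set E := (toMeasurable μ {x | ∀ k, ∃! Q, Q ∈ D.cubes k ∧ x ∈ Q}ᶜ)ᶜ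

theorem measurableSet_goodSet : MeasurableSet D.goodSet := (measurableSet_toMeasurable _ _).compl

theorem existsUnique_of_mem_goodSet {x : E} (hx : x ∈ D.goodSet) (k : ℤ) :
    ∃! Q, Q ∈ D.cubes k ∧ x ∈ Q := by
  by_contra h
  exact hx (subset_toMeasurable μ _ fun h' => h (h' k))

theorem ae_mem_goodSet : ∀ᵐ x ∂μ, x ∈ D.goodSet := by
  have h1 : ∀ᵐ x ∂μ, ∀ k, ∃! Q, Q ∈ D.cubes k ∧ x ∈ Q := by
    rw [ae_all_iff]
    intro k
    have h2 : ∀ᵐ x ∂μ, ∀ Q ∈ D.cubes k, ∀ R ∈ D.cubes k, Q ≠ R → ¬ (x ∈ Q ∧ x ∈ R) := by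
      rw [ae_ball_iff (D.countable k)]
      intro Q hQ
      rw [ae_ball_iff (D.countable k)]
      intro R hR
      by_cases h : Q = R
      · exact ae_of_all _ fun x h' => absurd h h'
      · have h3 : μ (Q ∩ R) = 0 := D.aedisjoint k hQ hR h
        filter_upwards [measure_eq_zero_iff_ae_notMem.1 h3] with x hx _ using hx
    filter_upwards [h2, D.ae_cover k] with x hx hx'
    obtain ⟨Q, hQ, hxQ⟩ := hx'
    refine ⟨Q, ⟨hQ, hxQ⟩, fun R hR => ?_⟩
    by_contra h
    exact hx R hR.1 Q hQ h ⟨hR.2, hxQ⟩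
  have h4 : μ {x | ∀ k, ∃! Q, Q ∈ D.cubes k ∧ x ∈ Q}ᶜ = 0 := h1
  have h5 : μ (D.goodSet)ᶜ = 0 := by
    rw [goodSet, compl_compl, measure_toMeasurable, h4]
  exact h5

/-- The cube of generation `k` around a good point; empty at the other points. -/
def cube (k : ℤ) (x : E) : Set E := {y | x ∈ D.goodSet ∧ ∃ Q ∈ D.cubes k, x ∈ Q ∧ y ∈ Q}

theorem cube_eq {k : ℤ} {x : E} (hx : x ∈ D.goodSet) {Q : Set E} (hQ : Q ∈ D.cubes k)
    (hxQ : x ∈ Q) : D.cube k x = Q := by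
  ext y
  constructor
  · rintro ⟨_, R, hR, hxR, hyR⟩
    rwa [(D.existsUnique_of_mem_goodSet hx k).unique ⟨hQ, hxQ⟩ ⟨hR, hxR⟩]
  · exact fun hy => ⟨hx, Q, hQ, hxQ, hy⟩

theorem cube_eq_empty {k : ℤ} {x : E} (hx : x ∉ D.goodSet) : D.cube k x = ∅ := by
  ext y
  simp [cube, hx]

theorem cube_mem_cubes {k : ℤ} {x : E} (hx : x ∈ D.goodSet) :
    D.cube k x ∈ D.cubes k ∧ x ∈ D.cube k x := by
  obtain ⟨Q, ⟨hQ, hxQ⟩, _⟩ := D.existsUnique_of_mem_goodSet hx k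
  rw [D.cube_eq hx hQ hxQ]
  exact ⟨hQ, hxQ⟩

theorem exists_ancestor {j k : ℤ} (hjk : j ≤ k) {Q : Set E} (hQ : Q ∈ D.cubes k) :
    ∃ R ∈ D.cubes j, Q ⊆ R := by
  induction k, hjk using Int.leInduction generalizing Q with
  | base => exact ⟨Q, hQ, subset_rfl⟩
  | succ k _ ih =>
    obtain ⟨Q', hQ', h⟩ := D.nested k Q hQ
    obtain ⟨R, hR, h'⟩ := ih hQ'
    exact ⟨R, hR, h.trans h'⟩

theorem cube_subset_cube {j k : ℤ} (hjk : j ≤ k) (x : E) : D.cube k x ⊆ D.cube j x := by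
  by_cases hx : x ∈ D.goodSet
  · obtain ⟨h1, h2⟩ := D.cube_mem_cubes (k := k) hx
    obtain ⟨R, hR, h⟩ := D.exists_ancestor hjk h1
    rwa [D.cube_eq hx hR (h h2)]
  · rw [D.cube_eq_empty hx, D.cube_eq_empty hx]

/-- The finer cube determines the coarser one, by nesting and uniqueness. Points outside `goodSet`
share the label `∅`, which no good point carries, so they cause no conflict. This is what makes the
filtration increasing, for all points and not only almost all. -/
theorem factorsThrough_cube {j k : ℤ} (hjk : j ≤ k) :
    Function.FactorsThrough (D.cube j) (D.cube k) := by
  intro x y hxy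
  by_cases hx : x ∈ D.goodSet
  · obtain ⟨h1, h2⟩ := D.cube_mem_cubes (k := k) hx
    by_cases hy : y ∈ D.goodSet
    · obtain ⟨h3, h4⟩ := D.cube_mem_cubes (k := k) hy
      obtain ⟨R, hR, h⟩ := D.exists_ancestor hjk h1
      rw [D.cube_eq hx hR (h h2), D.cube_eq hy hR (h (hxy ▸ h4))]
    · rw [hxy, D.cube_eq_empty hy] at h2
      exact absurd h2 (Set.notMem_empty _)
  · by_cases hy : y ∈ D.goodSet
    · obtain ⟨_, h4⟩ := D.cube_mem_cubes (k := k) hy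
      rw [← hxy, D.cube_eq_empty hx] at h4
      exact absurd h4 (Set.notMem_empty _)
    · rw [D.cube_eq_empty hx, D.cube_eq_empty hy]

theorem measurable_cube (k : ℤ) : @Measurable E (Set E) _ ⊤ (D.cube k) := by
  intro S _
  have h : D.cube k ⁻¹' S =
      (⋃ Q ∈ D.cubes k ∩ S, Q ∩ D.goodSet) ∪ (D.goodSetᶜ ∩ {_x | ∅ ∈ S}) := by
    ext x
    simp only [Set.mem_preimage, Set.mem_union, Set.mem_iUnion, Set.mem_inter_iff, exists_prop,
      Set.mem_compl_iff, Set.mem_ofPred_eq]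
    by_cases hx : x ∈ D.goodSet
    · obtain ⟨h1, h2⟩ := D.cube_mem_cubes (k := k) hx
      constructor
      · exact fun h => Or.inl ⟨_, ⟨h1, h⟩, h2, hx⟩
      · rintro (⟨Q, ⟨hQ, hQS⟩, hxQ, _⟩ | h)
        · rwa [D.cube_eq hx hQ hxQ]
        · exact absurd hx h.1
    · simp [hx, D.cube_eq_empty hx]
  rw [h]
  refine (MeasurableSet.biUnion ((D.countable k).mono Set.inter_subset_left) fun Q hQ =>
    (D.measurableSet k Q hQ.1).inter D.measurableSet_goodSet).union
    (D.measurableSet_goodSet.compl.inter (MeasurableSet.const _))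

theorem countable_range_cube (k : ℤ) : (Set.range (D.cube k)).Countable := by
  refine ((D.countable k).insert ∅).mono ?_
  rintro _ ⟨x, rfl⟩
  by_cases hx : x ∈ D.goodSet
  · exact Or.inr (D.cube_mem_cubes hx).1
  · exact Or.inl (D.cube_eq_empty hx)

/-- The filtration of the `σ`-algebras generated by the cubes of generation `σ, σ + 1, …`. -/
def filtration (σ : ℤ) : Filtration ℕ (inferInstance : MeasurableSpace E) where
  seq j := MeasurableSpace.comap (D.cube (σ + j)) ⊤
  mono' i j hij := by
    -- The coarser label is written as a function of the finer one, hence generates a smaller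
    -- `σ`-algebra.
    have h := (D.factorsThrough_cube (j := σ + i) (k := σ + j) (by gcongr)).extend_comp
      (fun _ => ∅)
    show MeasurableSpace.comap (D.cube (σ + i)) ⊤ ≤ MeasurableSpace.comap (D.cube (σ + j)) ⊤
    rw [← h, ← MeasurableSpace.comap_comp]
    exact MeasurableSpace.comap_mono le_top
  le' j := (D.measurable_cube _).comap_le

theorem stronglyMeasurable_comp_cube {Y : Type*} [TopologicalSpace Y]
    [TopologicalSpace.PseudoMetrizableSpace Y] (k : ℤ) (h : Set E → Y) :
    StronglyMeasurable[MeasurableSpace.comap (D.cube k) ⊤] fun x => h (D.cube k x) :=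
  stronglyMeasurable_comap_comp_of_countable_range (D.countable_range_cube k) h

end DyadicSystem

/-! ### Regularity of cubes, and averages as conditional expectations. -/

namespace DyadicSystem

variable {E : Type u} [MetricSpace E] [MeasurableSpace E] {μ : Measure E} {δ r₀ r₁ : ℝ}

/-- Quantitative regularity: cubes have positive finite measure, comparable to that of their
parents. -/
structure IsRegular (D : DyadicSystem μ δ r₀ r₁) (L : ℝ≥0) : Prop where
  ne_zero : ∀ k, ∀ Q ∈ D.cubes k, μ Q ≠ 0
  ne_top : ∀ k, ∀ Q ∈ D.cubes k, μ Q ≠ ∞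
  parent_le : ∀ k, ∀ Q ∈ D.cubes (k + 1), ∀ R ∈ D.cubes k, Q ⊆ R → μ R ≤ L * μ Q

theorem _root_.IsDoublingMeasure.measure_ball_two_pow_le {c : ℝ≥0} (hμ : IsDoublingMeasure μ c)
    (m : ℕ) (x : E) {t : ℝ} (ht : 0 < t) :
    μ (Metric.ball x (2 ^ m * t)) ≤ (c : ℝ≥0∞) ^ m * μ (Metric.ball x t) := by
  induction m with
  | zero => simp
  | succ m ih =>
    calc μ (Metric.ball x (2 ^ (m + 1) * t)) = μ (Metric.ball x (2 * (2 ^ m * t))) := by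
          congr 2; ring
      _ ≤ c * μ (Metric.ball x (2 ^ m * t)) := hμ.doubling x _ (by positivity)
      _ ≤ c * ((c : ℝ≥0∞) ^ m * μ (Metric.ball x t)) := by gcongr
      _ = _ := by ring

/-- Dyadic systems for doubling measures are regular. -/
theorem exists_isRegular (c : ℝ≥0) {δ r₀ r₁ : ℝ} (hδ₀ : 0 < δ) (hr₀ : 0 < r₀) :
    ∃ L : ℝ≥0, ∀ (E : Type u) [MetricSpace E] [MeasurableSpace E] (μ : Measure E),
      IsDoublingMeasure μ c → ∀ D : DyadicSystem μ δ r₀ r₁, D.IsRegular L := by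
  -- `m` doublings of the inner ball of a cube cover its parent, whose points are less than `2 r₁
  -- δ^k` apart; hence `L = c ^ m`.
  obtain ⟨m, hm⟩ := pow_unbounded_of_one_lt (2 * r₁ / (r₀ * δ)) one_lt_two
  refine ⟨c ^ m, fun E _ _ μ hμ D => ⟨fun k Q hQ => ?_, fun k Q hQ => ?_, fun k Q hQ R hR h => ?_⟩⟩
  · obtain ⟨z, hz, _⟩ := D.ball k Q hQ
    exact ((hμ.ball_pos z _ (by positivity)).trans_le (measure_mono hz)).ne'
  · obtain ⟨z, _, hz⟩ := D.ball k Q hQ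
    exact ((measure_mono hz).trans_lt (hμ.ball_lt_top z _)).ne
  · obtain ⟨z, hz, _⟩ := D.ball (k + 1) Q hQ
    obtain ⟨y, _, hy⟩ := D.ball k R hR
    have hρ : 0 < r₀ * δ ^ (k + 1) := by positivity
    have hzR : z ∈ Metric.ball y (r₁ * δ ^ k) := hy (h (hz (Metric.mem_ball_self hρ)))
    have h1 : R ⊆ Metric.ball z (2 ^ m * (r₀ * δ ^ (k + 1))) := by
      intro x hx
      have hxy := Metric.mem_ball.1 (hy hx)
      have hzy := Metric.mem_ball.1 hzR
      rw [Metric.mem_ball]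
      calc dist x z ≤ dist x y + dist z y := dist_triangle_right _ _ _
        _ < r₁ * δ ^ k + r₁ * δ ^ k := add_lt_add hxy hzy
        _ = 2 * r₁ / (r₀ * δ) * (r₀ * δ ^ (k + 1)) := by
          rw [zpow_add_one₀ hδ₀.ne']
          field_simp
          ring
        _ ≤ 2 ^ m * (r₀ * δ ^ (k + 1)) := by gcongr
    calc μ R ≤ μ (Metric.ball z (2 ^ m * (r₀ * δ ^ (k + 1)))) := measure_mono h1
      _ ≤ (c : ℝ≥0∞) ^ m * μ (Metric.ball z (r₀ * δ ^ (k + 1))) :=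
        hμ.measure_ball_two_pow_le m z hρ
      _ ≤ ((c ^ m : ℝ≥0) : ℝ≥0∞) * μ Q := by
        rw [ENNReal.coe_pow]
        gcongr

variable (D : DyadicSystem μ δ r₀ r₁) {Y : Type v} [NormedAddCommGroup Y] [NormedSpace ℝ Y]

/-- The average over the cube of generation `k` around a point. -/
def cubeAvg (k : ℤ) (f : E → Y) (x : E) : Y := ⨍ y in D.cube k x, f y ∂μ

theorem avg_eq_cubeAvg (k : ℤ) (f : E → Y) {x : E} (hx : x ∈ D.goodSet) :
    D.avg k f x = D.cubeAvg k f x := by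
  obtain ⟨h1, h2⟩ := D.cube_mem_cubes (k := k) hx
  rw [avg, tsum_eq_single ⟨D.cube k x, h1⟩, Set.indicator_of_mem h2]
  · rfl
  · intro Q hQ
    refine Set.indicator_of_notMem (fun hxQ => hQ ?_) _
    exact Subtype.ext (D.cube_eq hx Q.2 hxQ).symm

theorem avg_ae_eq (k : ℤ) (f : E → Y) : D.avg k f =ᵐ[μ] D.cubeAvg k f := by
  filter_upwards [D.ae_mem_goodSet] with x hx using D.avg_eq_cubeAvg k f hx

theorem stronglyMeasurable_cubeAvg_comap (k : ℤ) (f : E → Y) :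
    StronglyMeasurable[MeasurableSpace.comap (D.cube k) ⊤] (D.cubeAvg k f) :=
  D.stronglyMeasurable_comp_cube k fun Q => ⨍ y in Q, f y ∂μ

theorem stronglyMeasurable_cubeAvg (k : ℤ) (f : E → Y) : StronglyMeasurable (D.cubeAvg k f) :=
  (D.stronglyMeasurable_cubeAvg_comap k f).mono (D.measurable_cube k).comap_le

theorem cubeAvg_ae_eq_const {k : ℤ} {Q : Set E} (hQ : Q ∈ D.cubes k) (f : E → Y) :
    D.cubeAvg k f =ᵐ[μ.restrict Q] fun _ => ⨍ y in Q, f y ∂μ := by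
  rw [EventuallyEq, ae_restrict_iff' (D.measurableSet k Q hQ)]
  filter_upwards [D.ae_mem_goodSet] with x hx hxQ
  rw [cubeAvg, D.cube_eq hx hQ hxQ]

/-- Measurable unions of cubes of generation `k`, up to null sets. -/
structure IsSaturated (k : ℤ) (A : Set E) : Prop where
  measurableSet : MeasurableSet A
  dichotomy : ∀ Q ∈ D.cubes k, (Q ∩ A : Set E) =ᵐ[μ] Q ∨ (Q ∩ A : Set E) =ᵐ[μ] (∅ : Set E)

theorem isSaturated_univ (k : ℤ) : D.IsSaturated k Set.univ :=
  ⟨MeasurableSet.univ, fun Q _ => Or.inl (by rw [Set.inter_univ]; exact ae_eq_refl Q)⟩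

variable {D}

theorem IsSaturated.inter {k : ℤ} {A A' : Set E} (hA : D.IsSaturated k A)
    (hA' : D.IsSaturated k A') : D.IsSaturated k (A ∩ A') := by
  refine ⟨hA.1.inter hA'.1, fun Q hQ => ?_⟩
  rw [← Set.inter_assoc]
  rcases hA.2 Q hQ with h | h
  · rcases hA'.2 Q hQ with h' | h'
    · exact Or.inl ((h.inter (ae_eq_refl A')).trans h')
    · exact Or.inr ((h.inter (ae_eq_refl A')).trans h')
  · refine Or.inr ((h.inter (ae_eq_refl A')).trans ?_)
    rw [Set.empty_inter]
    exact ae_eq_refl _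

theorem IsSaturated.mono {j k : ℤ} (hjk : j ≤ k) {A : Set E} (hA : D.IsSaturated j A) :
    D.IsSaturated k A := by
  refine ⟨hA.1, fun Q hQ => ?_⟩
  obtain ⟨R, hR, hQR⟩ := D.exists_ancestor hjk hQ
  have h0 : Q ∩ (R ∩ A) = Q ∩ A := by rw [← Set.inter_assoc, Set.inter_eq_left.2 hQR]
  rcases hA.2 R hR with h | h
  · have := (ae_eq_refl Q).inter h
    rw [h0, Set.inter_eq_left.2 hQR] at this
    exact Or.inl this
  · have := (ae_eq_refl Q).inter h
    rw [h0, Set.inter_empty] at this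
    exact Or.inr this

variable (D)

theorem isSaturated_of_mem_cubes {k : ℤ} {Q : Set E} (hQ : Q ∈ D.cubes k) : D.IsSaturated k Q := by
  refine ⟨D.measurableSet k Q hQ, fun R hR => ?_⟩
  by_cases h : R = Q
  · rw [h, Set.inter_self]
    exact Or.inl (ae_eq_refl Q)
  · exact Or.inr (ae_eq_empty.2 (D.aedisjoint k hR hQ h))

theorem isSaturated_preimage_cube (k : ℤ) (S : Set (Set E)) :
    D.IsSaturated k (D.cube k ⁻¹' S) := by
  refine ⟨D.measurable_cube k trivial, fun Q hQ => ?_⟩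
  by_cases h : Q ∈ S
  · left
    filter_upwards [D.ae_mem_goodSet] with x hx
    refine propext ⟨fun h' => h'.1, fun h' => ⟨h', ?_⟩⟩
    rw [Set.mem_preimage, D.cube_eq hx hQ h']
    exact h
  · right
    filter_upwards [D.ae_mem_goodSet] with x hx
    refine propext ⟨fun h' => h ?_, fun h' => h'.elim⟩
    have := h'.2
    rwa [Set.mem_preimage, D.cube_eq hx hQ h'.1] at this

theorem ae_eq_iUnion_cubes_inter (k : ℤ) (A : Set E) :
    A =ᵐ[μ] (⋃ Q : D.cubes k, (Q : Set E) ∩ A : Set E) := by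
  filter_upwards [D.ae_cover k] with x hx
  refine propext ⟨fun h => ?_, fun h => ?_⟩
  · obtain ⟨Q, hQ, hxQ⟩ := hx
    exact Set.mem_iUnion.2 ⟨⟨Q, hQ⟩, hxQ, h⟩
  · obtain ⟨Q, hQ⟩ := Set.mem_iUnion.1 h
    exact hQ.2

theorem pairwise_aedisjoint_cubes_inter (k : ℤ) (A : Set E) :
    Pairwise (Function.onFun (AEDisjoint μ) fun Q : D.cubes k => (Q : Set E) ∩ A) := fun Q R h =>
  (D.aedisjoint k Q.2 R.2 (fun h' => h (Subtype.ext h'))).mono Set.inter_subset_left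
    Set.inter_subset_left

theorem setLIntegral_eq_tsum_cubes (k : ℤ) {A : Set E} (hA : MeasurableSet A) (f : E → ℝ≥0∞) :
    ∫⁻ x in A, f x ∂μ = ∑' Q : D.cubes k, ∫⁻ x in (Q : Set E) ∩ A, f x ∂μ := by
  have := (D.countable k).to_subtype
  rw [setLIntegral_congr (D.ae_eq_iUnion_cubes_inter k A), lintegral_iUnion₀
    (fun Q : D.cubes k => ((D.measurableSet k Q Q.2).inter hA).nullMeasurableSet)
    (D.pairwise_aedisjoint_cubes_inter k A)]

theorem setIntegral_eq_tsum_cubes (k : ℤ) {A : Set E} (hA : MeasurableSet A) {f : E → Y}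
    (hf : IntegrableOn f A μ) :
    ∫ x in A, f x ∂μ = ∑' Q : D.cubes k, ∫ x in (Q : Set E) ∩ A, f x ∂μ := by
  have := (D.countable k).to_subtype
  rw [setIntegral_congr_set (D.ae_eq_iUnion_cubes_inter k A), integral_iUnion_ae
    (fun Q : D.cubes k => ((D.measurableSet k Q Q.2).inter hA).nullMeasurableSet)
    (D.pairwise_aedisjoint_cubes_inter k A)
    (hf.mono_set (Set.iUnion_subset fun Q => Set.inter_subset_right))]

variable {D}

/-- A saturated set takes from each cube everything or nothing up to null sets, so its integrals are
sums of integrals over whole cubes. -/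
theorem IsSaturated.setLIntegral_le {k : ℤ} {A : Set E} (hA : D.IsSaturated k A) {g f : E → ℝ≥0∞}
    (h : ∀ Q ∈ D.cubes k, ∫⁻ x in Q, g x ∂μ ≤ ∫⁻ x in Q, f x ∂μ) :
    ∫⁻ x in A, g x ∂μ ≤ ∫⁻ x in A, f x ∂μ := by
  rw [D.setLIntegral_eq_tsum_cubes k hA.1, D.setLIntegral_eq_tsum_cubes k hA.1]
  refine ENNReal.tsum_le_tsum fun Q => ?_
  rcases hA.2 Q Q.2 with h' | h'
  · rw [setLIntegral_congr h', setLIntegral_congr h']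
    exact h Q Q.2
  · rw [setLIntegral_congr h', setLIntegral_congr h']
    simp

theorem IsSaturated.setIntegral_congr {k : ℤ} {A : Set E} (hA : D.IsSaturated k A) {g f : E → Y}
    (hg : IntegrableOn g A μ) (hf : IntegrableOn f A μ)
    (h : ∀ Q ∈ D.cubes k, IntegrableOn f Q μ → ∫ x in Q, g x ∂μ = ∫ x in Q, f x ∂μ) :
    ∫ x in A, g x ∂μ = ∫ x in A, f x ∂μ := by
  rw [D.setIntegral_eq_tsum_cubes k hA.1 hg, D.setIntegral_eq_tsum_cubes k hA.1 hf]
  congr 1 with Q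
  rcases hA.2 Q Q.2 with h' | h'
  · rw [setIntegral_congr_set h', setIntegral_congr_set h']
    refine h Q Q.2 ?_
    exact (hf.mono_set Set.inter_subset_right).congr_set_ae h'.symm
  · rw [setIntegral_congr_set h', setIntegral_congr_set h']
    simp

variable {L : ℝ≥0}

theorem IsRegular.measureReal_pos (hD : D.IsRegular L) {k : ℤ} {Q : Set E} (hQ : Q ∈ D.cubes k) :
    0 < μ.real Q :=
  ENNReal.toReal_pos (hD.ne_zero k Q hQ) (hD.ne_top k Q hQ)

theorem IsRegular.setIntegral_cube_cubeAvg [CompleteSpace Y] (hD : D.IsRegular L) {k : ℤ}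
    {Q : Set E} (hQ : Q ∈ D.cubes k) (f : E → Y) :
    ∫ x in Q, D.cubeAvg k f x ∂μ = ∫ x in Q, f x ∂μ := by
  rw [integral_congr_ae (D.cubeAvg_ae_eq_const hQ f), setIntegral_const, setAverage_eq,
    smul_inv_smul₀ (hD.measureReal_pos hQ).ne']

theorem IsRegular.setLIntegral_cube_cubeAvg_le (hD : D.IsRegular L) {k : ℤ} {Q : Set E}
    (hQ : Q ∈ D.cubes k) (f : E → Y) :
    ∫⁻ x in Q, ‖D.cubeAvg k f x‖ₑ ∂μ ≤ ∫⁻ x in Q, ‖f x‖ₑ ∂μ := by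
  have h1 : ∫⁻ x in Q, ‖D.cubeAvg k f x‖ₑ ∂μ = ‖⨍ y in Q, f y ∂μ‖ₑ * μ Q := by
    rw [← setLIntegral_const]
    exact lintegral_congr_ae ((D.cubeAvg_ae_eq_const hQ f).fun_comp (‖·‖ₑ))
  rw [h1, setAverage_eq, enorm_smul, mul_comm, ← mul_assoc]
  have h2 : μ Q * ‖(μ.real Q)⁻¹‖ₑ = 1 := by
    rw [Real.enorm_of_nonneg (by positivity), ENNReal.ofReal_inv_of_pos (hD.measureReal_pos hQ),
      ofReal_measureReal (hD.ne_top k Q hQ),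
      ENNReal.mul_inv_cancel (hD.ne_zero k Q hQ) (hD.ne_top k Q hQ)]
  rw [h2, one_mul]
  exact enorm_integral_le_lintegral_enorm _

theorem IsSaturated.integrableOn_cubeAvg (hD : D.IsRegular L) {k : ℤ} {A : Set E}
    (hA : D.IsSaturated k A) {f : E → Y} (hf : IntegrableOn f A μ) :
    IntegrableOn (D.cubeAvg k f) A μ := by
  refine ⟨(D.stronglyMeasurable_cubeAvg k f).aestronglyMeasurable, ?_⟩
  exact (hA.setLIntegral_le fun Q hQ => hD.setLIntegral_cube_cubeAvg_le hQ f).trans_lt hf.2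

theorem IsSaturated.setIntegral_cubeAvg [CompleteSpace Y] (hD : D.IsRegular L) {k : ℤ} {A : Set E}
    (hA : D.IsSaturated k A) {f : E → Y} (hf : IntegrableOn f A μ) :
    ∫ x in A, D.cubeAvg k f x ∂μ = ∫ x in A, f x ∂μ :=
  hA.setIntegral_congr (hA.integrableOn_cubeAvg hD hf) hf fun _ hQ _ =>
    hD.setIntegral_cube_cubeAvg hQ f

/-- Averages over cubes are conditional expectations. -/
theorem IsRegular.cubeAvg_ae_eq_condExp [CompleteSpace Y] (hD : D.IsRegular L) {σ : ℤ} {Q : Set E}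
    (hQ : Q ∈ D.cubes σ) {f : E → Y} (hf : IntegrableOn f Q μ) (j : ℕ) :
    D.cubeAvg (σ + j) f =ᵐ[μ[|Q]] (μ[|Q])[f | D.filtration σ j] := by
  have := cond_isProbabilityMeasure_of_finite (hD.ne_zero σ Q hQ) (hD.ne_top σ Q hQ)
  have hsat := (D.isSaturated_of_mem_cubes hQ).mono (by simp : σ ≤ σ + j)
  have hc : (μ Q)⁻¹ ≠ ∞ := ENNReal.inv_ne_top.2 (hD.ne_zero σ Q hQ)
  have hint : ∀ {g : E → Y}, IntegrableOn g Q μ → Integrable g (μ[|Q]) := fun hg =>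
    Integrable.smul_measure hg hc
  have hav := hint (hsat.integrableOn_cubeAvg hD hf)
  refine ae_eq_condExp_of_forall_setIntegral_eq ((D.filtration σ).le j) (hint hf)
    (fun s _ _ => hav.integrableOn) (fun s hs _ => ?_)
    (D.stronglyMeasurable_cubeAvg_comap (σ + j) f).aestronglyMeasurable
  -- A set of the `σ`-algebra at time `j` is given by a family of labels; cut with `Q` it is a union
  -- of cubes up to null sets, and averaging preserves the integral over it.
  obtain ⟨S, _, rfl⟩ := hs
  have hS := (D.isSaturated_preimage_cube (σ + j) S).inter hsat
  rw [ProbabilityTheory.cond, Measure.restrict_smul, Measure.restrict_restrict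
    (D.isSaturated_preimage_cube (σ + j) S).1, integral_smul_measure, integral_smul_measure,
    hS.setIntegral_cubeAvg hD (hf.mono_set Set.inter_subset_right)]

theorem IsRegular.martingale_cubeAvg [CompleteSpace Y] (hD : D.IsRegular L) {σ : ℤ} {Q : Set E}
    (hQ : Q ∈ D.cubes σ) {f : E → Y} (hf : IntegrableOn f Q μ) :
    Martingale (fun j : ℕ => D.cubeAvg (σ + j) f) (D.filtration σ) (μ[|Q]) := by
  have := cond_isProbabilityMeasure_of_finite (hD.ne_zero σ Q hQ) (hD.ne_top σ Q hQ)
  exact (martingale_condExp f (D.filtration σ) (μ[|Q])).congr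
    (fun j => D.stronglyMeasurable_cubeAvg_comap (σ + j) f)
    fun j => (hD.cubeAvg_ae_eq_condExp hQ hf j).symm

end DyadicSystem

/-! ### Orthogonality of martingale differences. -/

section Orthogonality

variable {𝕜 : Type*} [RCLike 𝕜] {Ω : Type*} {mΩ : MeasurableSpace Ω} {P : Measure Ω}

theorem lintegral_enorm_rpow_toReal {Y : Type*} [NormedAddCommGroup Y] (g : Ω → Y) {s : ℝ≥0∞}
    (hs0 : s ≠ 0) (hs : s ≠ ∞) :
    ∫⁻ ω, ‖g ω‖ₑ ^ s.toReal ∂P = eLpNorm g s P ^ s.toReal := by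
  rw [eLpNorm_eq_lintegral_rpow_enorm_toReal hs0 hs, ← ENNReal.rpow_mul,
    one_div_mul_cancel (ENNReal.toReal_pos hs0 hs).ne', ENNReal.rpow_one]

/-- Orthogonality of martingale differences. -/
theorem integral_norm_sq_martingale [IsProbabilityMeasure P] {ℱ : Filtration ℕ mΩ}
    {β : ℕ → Ω → 𝕜} (hβ : Martingale β ℱ P) {N : ℕ} (hLp : ∀ n ≤ N, MemLp (β n) 2 P) :
    ∫ ω, ‖β N ω‖ ^ 2 ∂P =
      ∫ ω, (‖β 0 ω‖ ^ 2 + ∑ n ∈ Finset.range N, ‖β (n + 1) ω - β n ω‖ ^ 2) ∂P := by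
  -- Through the real inner product a scalar martingale is also a martingale of functionals, and
  -- pairing it with itself produces the squares.
  set Λ : 𝕜 →L[ℝ] StrongDual ℝ 𝕜 := innerSL ℝ with hΛ
  have hnorm : ∀ z : 𝕜, Λ z z = ‖z‖ ^ 2 := fun z => real_inner_self_eq_norm_sq z
  have hg : Martingale (fun n ω => Λ (β n ω)) ℱ P := by
    refine ⟨fun n => Λ.continuous.comp_stronglyMeasurable (hβ.1 n), fun i j hij => ?_⟩
    have h1 := Λ.comp_condExp_comm (m := ℱ i) (hβ.integrable j)
    filter_upwards [h1, hβ.2 i j hij] with ω h2 h3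
    have h4 : (P[fun ω => Λ (β j ω) | ℱ i]) ω = Λ ((P[β j | ℱ i]) ω) := h2.symm
    rw [h4, h3]
  have h := integral_martingale_pairing (𝕜 := ℝ) (X := 𝕜) (r := 2) (r' := 2) hg hβ (N := N)
    (fun n hn => Λ.comp_memLp' (hLp n hn)) hLp
  simp_rw [← map_sub, hnorm] at h
  exact h

end Orthogonality

/-! ### Localisation to cubes, and functions of bounded mean oscillation. -/

namespace DyadicSystem

variable {E : Type u} [MetricSpace E] [MeasurableSpace E] {μ : Measure E} {δ r₀ r₁ : ℝ}
  (D : DyadicSystem μ δ r₀ r₁) {Y : Type v} [NormedAddCommGroup Y] [NormedSpace ℝ Y]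
  {L : ℝ≥0}

/-- An `L_s` bound that holds on every cube of some generation holds globally. -/
theorem eLpNorm_le_of_forall_cube {W Z : Type*} [NormedAddCommGroup W] [NormedAddCommGroup Z]
    (k : ℤ) {s : ℝ≥0∞}
    (hs0 : s ≠ 0) (hs : s ≠ ∞) {g : E → Z} {f : E → W} {K : ℝ≥0∞} (hK : K ≠ ∞)
    (h : ∀ Q ∈ D.cubes k, eLpNorm g s (μ.restrict Q) ≤ K * eLpNorm f s (μ.restrict Q)) :
    eLpNorm g s μ ≤ K * eLpNorm f s μ := by
  have hσ : 0 < s.toReal := ENNReal.toReal_pos hs0 hs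
  have hKσ : K ^ s.toReal ≠ ∞ := ENNReal.rpow_ne_top_of_nonneg hσ.le hK
  rw [← ENNReal.rpow_le_rpow_iff hσ, ENNReal.mul_rpow_of_nonneg _ _ hσ.le,
    ← lintegral_enorm_rpow_toReal g hs0 hs, ← lintegral_enorm_rpow_toReal f hs0 hs,
    ← lintegral_const_mul' _ _ hKσ, ← setLIntegral_univ, ← setLIntegral_univ (μ := μ)]
  refine (D.isSaturated_univ k).setLIntegral_le fun Q hQ => ?_
  rw [lintegral_const_mul' _ _ hKσ, lintegral_enorm_rpow_toReal g hs0 hs,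
    lintegral_enorm_rpow_toReal f hs0 hs, ← ENNReal.mul_rpow_of_nonneg _ _ hσ.le]
  exact ENNReal.rpow_le_rpow (h Q hQ) hσ.le

variable {D}

/-- Normalising by `μ Q` multiplies both sides by the same positive finite factor. -/
theorem IsRegular.eLpNorm_restrict_le_of_cond {W Z : Type*} [NormedAddCommGroup W]
    [NormedAddCommGroup Z]
    (hD : D.IsRegular L) {k : ℤ} {Q : Set E} (hQ : Q ∈ D.cubes k) {s : ℝ≥0∞} (hs : s ≠ ∞)
    {g : E → Z} {f : E → W} {K : ℝ≥0∞} (h : eLpNorm g s (μ[|Q]) ≤ K * eLpNorm f s (μ[|Q])) :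
    eLpNorm g s (μ.restrict Q) ≤ K * eLpNorm f s (μ.restrict Q) := by
  rw [ProbabilityTheory.cond, eLpNorm_smul_measure_of_ne_top hs,
    eLpNorm_smul_measure_of_ne_top hs, smul_eq_mul, smul_eq_mul, mul_left_comm] at h
  refine (ENNReal.mul_le_mul_iff_right ?_ ?_).1 h
  · simp [ENNReal.rpow_eq_zero_iff, hD.ne_top k Q hQ, hD.ne_zero k Q hQ]
  · exact ENNReal.rpow_ne_top_of_nonneg ENNReal.toReal_nonneg
      (ENNReal.inv_ne_top.2 (hD.ne_zero k Q hQ))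

theorem IsRegular.integrableOn_of_memLp {W : Type*} [NormedAddCommGroup W]
    (hD : D.IsRegular L) {k : ℤ} {Q : Set E}
    (hQ : Q ∈ D.cubes k) {s : ℝ≥0∞} (hs1 : 1 ≤ s) {f : E → W} (hf : MemLp f s μ) :
    IntegrableOn f Q μ := by
  have : IsFiniteMeasure (μ.restrict Q) := ⟨by
    rw [Measure.restrict_apply_univ]
    exact (hD.ne_top k Q hQ).lt_top⟩
  exact (hf.restrict Q).integrable hs1

theorem IsRegular.memLp_cond {W : Type*} [NormedAddCommGroup W] (hD : D.IsRegular L)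
    {k : ℤ} {Q : Set E} (hQ : Q ∈ D.cubes k) {s : ℝ≥0∞} {f : E → W}
    (hf : MemLp f s (μ.restrict Q)) :
    MemLp f s (μ[|Q]) :=
  hf.smul_measure (ENNReal.inv_ne_top.2 (hD.ne_zero k Q hQ))

theorem IsRegular.eLpNorm_cubeAvg_le [CompleteSpace Y] (hD : D.IsRegular L) {s : ℝ≥0∞}
    (hs1 : 1 ≤ s) (hs : s ≠ ∞) (k : ℤ) {f : E → Y} (hf : MemLp f s μ) :
    eLpNorm (D.cubeAvg k f) s μ ≤ eLpNorm f s μ := by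
  rw [← one_mul (eLpNorm f s μ)]
  refine D.eLpNorm_le_of_forall_cube k (zero_lt_one.trans_le hs1).ne' hs ENNReal.one_ne_top
    fun Q hQ => hD.eLpNorm_restrict_le_of_cond hQ hs ?_
  have h := hD.cubeAvg_ae_eq_condExp hQ (hD.integrableOn_of_memLp hQ hs1 hf) 0
  simp only [Nat.cast_zero, add_zero] at h
  rw [one_mul, eLpNorm_congr_ae h]
  exact eLpNorm_condExp_le_eLpNorm _ hs1

theorem IsRegular.memLp_cubeAvg [CompleteSpace Y] (hD : D.IsRegular L) {s : ℝ≥0∞}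
    (hs1 : 1 ≤ s) (hs : s ≠ ∞) (k : ℤ) {f : E → Y} (hf : MemLp f s μ) :
    MemLp (D.cubeAvg k f) s μ :=
  ⟨(D.stronglyMeasurable_cubeAvg k f).aestronglyMeasurable,
    (hD.eLpNorm_cubeAvg_le hs1 hs k hf).trans_lt hf.2⟩

section BMO

variable {𝕜 : Type w} [RCLike 𝕜] {b : E → 𝕜} {B : ℝ}

theorem IsRegular.setLIntegral_sq_sub_average_le (hD : D.IsRegular L)
    (hB : D.bmoNorm b ≤ ENNReal.ofReal B) {k : ℤ} {Q : Set E} (hQ : Q ∈ D.cubes k) :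
    ∫⁻ x in Q, ‖b x - ⨍ y in Q, b y ∂μ‖ₑ ^ (2 : ℝ) ∂μ ≤ ENNReal.ofReal B ^ (2 : ℝ) * μ Q := by
  have h1 : ((μ Q)⁻¹ * ∫⁻ x in Q, ‖b x - ⨍ y in Q, b y ∂μ‖ₑ ^ (2 : ℝ) ∂μ) ^ (1 / 2 : ℝ) ≤
      ENNReal.ofReal B := by
    refine le_trans ?_ hB
    exact le_iSup_of_le k (le_iSup₂_of_le Q hQ le_rfl)
  have h2 := ENNReal.rpow_le_rpow h1 (by norm_num : (0 : ℝ) ≤ 2)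
  rw [← ENNReal.rpow_mul, one_div_mul_cancel two_ne_zero, ENNReal.rpow_one] at h2
  calc _ = μ Q * ((μ Q)⁻¹ * ∫⁻ x in Q, ‖b x - ⨍ y in Q, b y ∂μ‖ₑ ^ (2 : ℝ) ∂μ) := by
        rw [← mul_assoc, ENNReal.mul_inv_cancel (hD.ne_zero k Q hQ) (hD.ne_top k Q hQ), one_mul]
    _ ≤ μ Q * ENNReal.ofReal B ^ (2 : ℝ) := by gcongr
    _ = _ := mul_comm _ _

theorem IsRegular.eLpNorm_two_sub_average_le (hD : D.IsRegular L)
    (hB : D.bmoNorm b ≤ ENNReal.ofReal B) {k : ℤ} {Q : Set E} (hQ : Q ∈ D.cubes k) :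
    eLpNorm (fun x => b x - ⨍ y in Q, b y ∂μ) 2 (μ.restrict Q) ≤
      ENNReal.ofReal B * μ Q ^ (1 / 2 : ℝ) := by
  have h := hD.setLIntegral_sq_sub_average_le hB hQ
  have h1 := lintegral_enorm_rpow_toReal (P := μ.restrict Q)
    (fun x => b x - ⨍ y in Q, b y ∂μ) two_ne_zero ENNReal.ofNat_ne_top
  rw [ENNReal.toReal_ofNat] at h1
  rw [h1] at h
  have h2 := ENNReal.rpow_le_rpow h (by norm_num : (0 : ℝ) ≤ 1 / 2)
  rwa [← ENNReal.rpow_mul, mul_one_div_cancel two_ne_zero, ENNReal.rpow_one,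
    ENNReal.mul_rpow_of_nonneg _ _ (by norm_num), ← ENNReal.rpow_mul,
    mul_one_div_cancel two_ne_zero, ENNReal.rpow_one] at h2

theorem IsRegular.setLIntegral_sub_average_le (hD : D.IsRegular L) (hb : D.MemBMO b)
    (hB : D.bmoNorm b ≤ ENNReal.ofReal B) {k : ℤ} {Q : Set E} (hQ : Q ∈ D.cubes k) :
    ∫⁻ x in Q, ‖b x - ⨍ y in Q, b y ∂μ‖ₑ ∂μ ≤ ENNReal.ofReal B * μ Q := by
  have h1 := eLpNorm_le_eLpNorm_mul_rpow_measure_univ (μ := μ.restrict Q) (p := 1) (q := 2)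
    one_le_two ((hb.aestronglyMeasurable.restrict (s := Q)).sub
    (aestronglyMeasurable_const (b := ⨍ y in Q, b y ∂μ)))
  rw [eLpNorm_one_eq_lintegral_enorm, Measure.restrict_apply_univ] at h1
  refine h1.trans ((mul_le_mul' (hD.eLpNorm_two_sub_average_le hB hQ) le_rfl).trans
    (le_of_eq ?_))
  rw [mul_assoc, ← ENNReal.rpow_add _ _ (hD.ne_zero k Q hQ) (hD.ne_top k Q hQ)]
  norm_num

/-- The jump is the mean over the child of `b` minus its average over the parent; enlarging the
domain to the parent costs the ratio of the measures, at most `L`. -/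
theorem IsRegular.norm_cubeAvg_sub_le (hD : D.IsRegular L) (hb : D.MemBMO b) (hB0 : 0 ≤ B)
    (hB : D.bmoNorm b ≤ ENNReal.ofReal B) (k : ℤ) (x : E) :
    ‖D.cubeAvg (k + 1) b x - D.cubeAvg k b x‖ ≤ L * B := by
  by_cases hx : x ∈ D.goodSet
  swap
  -- Outside `goodSet` all averages are over `∅` and vanish, so the bound holds at every point, as
  -- the abstract estimate requires.
  · simp only [cubeAvg, D.cube_eq_empty hx, Measure.restrict_empty, average_zero_measure, sub_self,
      norm_zero]
    positivity
  obtain ⟨hQ, hxQ⟩ := D.cube_mem_cubes (k := k + 1) hx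
  obtain ⟨hR, hxR⟩ := D.cube_mem_cubes (k := k) hx
  have hQR := D.cube_subset_cube (by simp : k ≤ k + 1) x
  set Q := D.cube (k + 1) x
  set R := D.cube k x
  set a : 𝕜 := ⨍ y in R, b y ∂μ
  have hQm := hD.measureReal_pos hQ
  have h1 : D.cubeAvg (k + 1) b x - D.cubeAvg k b x = (μ.real Q)⁻¹ • ∫ y in Q, (b y - a) ∂μ := by
    rw [integral_sub (hb.integrableOn _ Q hQ) (integrableOn_const (hD.ne_top _ Q hQ)),
      setIntegral_const, smul_sub, inv_smul_smul₀ hQm.ne', ← setAverage_eq]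
    rfl
  have h2 : ‖∫ y in Q, (b y - a) ∂μ‖ₑ ≤ ENNReal.ofReal (L * B * μ.real Q) := by
    calc ‖∫ y in Q, (b y - a) ∂μ‖ₑ ≤ ∫⁻ y in Q, ‖b y - a‖ₑ ∂μ :=
          enorm_integral_le_lintegral_enorm _
      _ ≤ ∫⁻ y in R, ‖b y - a‖ₑ ∂μ := lintegral_mono_set hQR
      _ ≤ ENNReal.ofReal B * μ R := hD.setLIntegral_sub_average_le hb hB hR
      _ ≤ ENNReal.ofReal B * (L * μ Q) := by
          gcongr
          exact hD.parent_le k Q hQ R hR hQR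
      _ = _ := by
          rw [ENNReal.ofReal_mul (by positivity), ENNReal.ofReal_mul L.coe_nonneg,
            ofReal_measureReal (hD.ne_top _ Q hQ), ENNReal.ofReal_coe_nnreal]
          ring
  have h3 : ‖∫ y in Q, (b y - a) ∂μ‖ ≤ L * B * μ.real Q := by
    rw [← ofReal_norm] at h2
    exact (ENNReal.ofReal_le_ofReal_iff (by positivity)).1 h2
  rw [h1, norm_smul, norm_inv, Real.norm_of_nonneg hQm.le, inv_mul_le_iff₀ hQm]
  linarith

/-- The Carleson packing property of the martingale differences of a function of bounded mean
oscillation. -/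
theorem IsRegular.setLIntegral_sum_sq_le (hD : D.IsRegular L) (hb : D.MemBMO b)
    (hB0 : 0 ≤ B) (hB : D.bmoNorm b ≤ ENNReal.ofReal B) {k : ℤ} {Q : Set E} (hQ : Q ∈ D.cubes k)
    (m : ℕ) :
    ∫⁻ x in Q, ∑ j ∈ Finset.range m, ENNReal.ofReal
        (‖D.cubeAvg (k + j + 1) b x - D.cubeAvg (k + j) b x‖ ^ 2) ∂μ ≤
      ENNReal.ofReal (B ^ 2) * μ Q := by
  have hP := cond_isProbabilityMeasure_of_finite (hD.ne_zero k Q hQ) (hD.ne_top k Q hQ)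
  set a : 𝕜 := ⨍ y in Q, b y ∂μ with ha
  have hbQ := hb.integrableOn k Q hQ
  have hc : (μ Q)⁻¹ ≠ ∞ := ENNReal.inv_ne_top.2 (hD.ne_zero k Q hQ)
  have hbP : Integrable b (μ[|Q]) := Integrable.smul_measure hbQ hc
  -- Centring by `a` leaves the differences unchanged. By orthogonality their squares sum to at most
  -- the squared `L_2` norm of `β m`, hence to at most that of `b - a`, which the BMO norm controls.
  set β : ℕ → E → 𝕜 := fun j x => D.cubeAvg (k + j) b x - a with hβ
  have hβm : Martingale β (D.filtration k) (μ[|Q]) :=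
    (hD.martingale_cubeAvg hQ hbQ).sub (martingale_const (D.filtration k) (μ[|Q]) a)
  have h2 : MemLp (fun x => b x - a) 2 (μ.restrict Q) :=
    ⟨hb.aestronglyMeasurable.restrict.sub aestronglyMeasurable_const,
      (hD.eLpNorm_two_sub_average_le hB hQ).trans_lt (ENNReal.mul_lt_top ENNReal.ofReal_lt_top
        (ENNReal.rpow_lt_top_of_nonneg (by norm_num) (hD.ne_top k Q hQ)))⟩
  have hβc : ∀ j, β j =ᵐ[μ[|Q]] (μ[|Q])[fun x => b x - a | D.filtration k j] := fun j => by
    have h3 := condExp_sub hbP (integrable_const a) (D.filtration k j)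
    filter_upwards [h3, hD.cubeAvg_ae_eq_condExp hQ hbQ j] with x h4 h5
    rw [condExp_const ((D.filtration k).le j)] at h4
    simp only [hβ, h5]
    exact h4.symm
  have hβLp : ∀ j, MemLp (β j) 2 (μ[|Q]) := fun j =>
    ((hD.memLp_cond hQ h2).condExp one_le_two).ae_eq (hβc j).symm
  have horth := integral_norm_sq_martingale hβm (N := m) fun j _ => hβLp j
  have hdiff : ∀ (j : ℕ) x, D.cubeAvg (k + j + 1) b x - D.cubeAvg (k + j) b x =
      β (j + 1) x - β j x := by
    intro j x
    simp only [hβ, sub_sub_sub_cancel_right]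
    congr 2
    push_cast
    ring
  have hsqint : ∀ {g : E → 𝕜}, MemLp g 2 (μ[|Q]) → Integrable (fun x => ‖g x‖ ^ 2) (μ[|Q]) :=
    fun hg => hg.integrable_norm_pow two_ne_zero
  have h6 : ∫⁻ x, ∑ j ∈ Finset.range m, ENNReal.ofReal (‖β (j + 1) x - β j x‖ ^ 2) ∂(μ[|Q]) ≤
      ENNReal.ofReal (B ^ 2) := by
    calc _ ≤ ∫⁻ x, ENNReal.ofReal (‖β 0 x‖ ^ 2 +
            ∑ j ∈ Finset.range m, ‖β (j + 1) x - β j x‖ ^ 2) ∂(μ[|Q]) := by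
          refine lintegral_mono fun x => ?_
          rw [← ENNReal.ofReal_sum_of_nonneg fun j _ => by positivity]
          exact ENNReal.ofReal_le_ofReal (le_add_of_nonneg_left (by positivity))
      _ = ENNReal.ofReal (∫ x, ‖β m x‖ ^ 2 ∂(μ[|Q])) := by
          rw [horth, ofReal_integral_eq_lintegral_ofReal _ (ae_of_all _ fun x => by positivity)]
          exact (hsqint (hβLp 0)).add (integrable_finsetSum _ fun j _ =>
            hsqint ((hβLp (j + 1)).sub (hβLp j)))
      _ = eLpNorm (β m) 2 (μ[|Q]) ^ (2 : ℝ) := by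
          have := lintegral_ofReal_norm_rpow (P := μ[|Q]) (β m) two_ne_zero ENNReal.ofNat_ne_top
          rw [ENNReal.toReal_ofNat] at this
          rw [← this, ofReal_integral_eq_lintegral_ofReal (hsqint (hβLp m))
            (ae_of_all _ fun x => by positivity)]
          simp
      _ ≤ eLpNorm (fun x => b x - a) 2 (μ[|Q]) ^ (2 : ℝ) := by
          gcongr
          rw [eLpNorm_congr_ae (hβc m)]
          exact eLpNorm_condExp_le_eLpNorm _ one_le_two
      _ ≤ ENNReal.ofReal B ^ (2 : ℝ) := by
          gcongr
          rw [ProbabilityTheory.cond, eLpNorm_smul_measure_of_ne_top ENNReal.ofNat_ne_top,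
            smul_eq_mul]
          calc _ ≤ (μ Q)⁻¹ ^ (1 / 2 : ℝ≥0∞).toReal * (ENNReal.ofReal B * μ Q ^ (1 / 2 : ℝ)) := by
                gcongr
                exact hD.eLpNorm_two_sub_average_le hB hQ
            _ = ENNReal.ofReal B * ((μ Q)⁻¹ * μ Q) ^ (1 / 2 : ℝ) := by
                rw [ENNReal.mul_rpow_of_nonneg _ _ (by norm_num), mul_left_comm]
                simp
            _ = _ := by
                rw [ENNReal.inv_mul_cancel (hD.ne_zero k Q hQ) (hD.ne_top k Q hQ),
                  ENNReal.one_rpow, mul_one]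
      _ = ENNReal.ofReal (B ^ 2) := by
          rw [ENNReal.ofReal_pow hB0]
          simp
  simp_rw [hdiff]
  rw [ProbabilityTheory.cond, lintegral_smul_measure, smul_eq_mul] at h6
  calc _ = μ Q * ((μ Q)⁻¹ * ∫⁻ x in Q, ∑ j ∈ Finset.range m,
            ENNReal.ofReal (‖β (j + 1) x - β j x‖ ^ 2) ∂μ) := by
        rw [← mul_assoc, ENNReal.mul_inv_cancel (hD.ne_zero k Q hQ) (hD.ne_top k Q hQ), one_mul]
    _ ≤ μ Q * ENNReal.ofReal (B ^ 2) := by gcongr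
    _ = _ := mul_comm _ _

end BMO

end DyadicSystem

/-! ### Truncated paraproducts on dyadic systems. -/

theorem sum_Icc_int_eq_sum_range {M : Type*} [AddCommMonoid M] (σ τ : ℤ) (g : ℤ → M) :
    ∑ i ∈ Finset.Icc σ τ, g i = ∑ j ∈ Finset.range (τ - σ + 1).toNat, g (σ + j) := by
  refine Finset.sum_nbij' (fun i => (i - σ).toNat) (fun j => σ + j) ?_ ?_ ?_ ?_ ?_
  · intro i hi
    rw [Finset.mem_Icc] at hi
    rw [Finset.mem_range]
    omega
  · intro j hj
    rw [Finset.mem_range] at hj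
    rw [Finset.mem_Icc]
    omega
  · intro i hi
    rw [Finset.mem_Icc] at hi
    omega
  · intro j _
    simp
  · intro i hi
    rw [Finset.mem_Icc] at hi
    congr 1
    omega

namespace DyadicSystem

variable {E : Type u} [MetricSpace E] [MeasurableSpace E] {μ : Measure E} {δ r₀ r₁ : ℝ}
  (D : DyadicSystem μ δ r₀ r₁) {𝕜 : Type w} [RCLike 𝕜]
  {Y : Type v} [NormedAddCommGroup Y] [NormedSpace ℝ Y] [NormedSpace 𝕜 Y] {L : ℝ≥0}

/-- The dyadic martingale differences, defined through the cubes around a point. -/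
def cubeDiff (k : ℤ) (f : E → Y) (x : E) : Y := D.cubeAvg (k + 1) f x - D.cubeAvg k f x

/-- A paraproduct with `n` summands, starting from generation `σ`. -/
def cubeParaproduct (b : E → 𝕜) (σ : ℤ) (n : ℕ) (f : E → Y) (x : E) : Y :=
  ∑ j ∈ Finset.range n, D.cubeDiff (σ + j) b x • D.cubeAvg (σ + j) f x

theorem diff_ae_eq (k : ℤ) (f : E → Y) : D.diff k f =ᵐ[μ] D.cubeDiff k f := by
  filter_upwards [D.avg_ae_eq (k + 1) f, D.avg_ae_eq k f] with x h1 h2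
  rw [diff, h1, h2, cubeDiff]

theorem paraproduct_ae_eq (b : E → 𝕜) (σ τ : ℤ) (f : E → Y) :
    D.paraproduct b σ τ f =ᵐ[μ] D.cubeParaproduct b σ (τ - σ + 1).toNat f := by
  filter_upwards [D.ae_mem_goodSet] with x hx
  rw [paraproduct, cubeParaproduct, sum_Icc_int_eq_sum_range]
  refine Finset.sum_congr rfl fun j _ => ?_
  rw [diff, cubeDiff, D.avg_eq_cubeAvg _ _ hx, D.avg_eq_cubeAvg _ _ hx, D.avg_eq_cubeAvg _ _ hx]

theorem stronglyMeasurable_cubeDiff (k : ℤ) (f : E → Y) : StronglyMeasurable (D.cubeDiff k f) :=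
  (D.stronglyMeasurable_cubeAvg _ f).sub (D.stronglyMeasurable_cubeAvg _ f)

theorem stronglyMeasurable_filtration_cubeDiff (σ : ℤ) (b : E → 𝕜) (j : ℕ) :
    StronglyMeasurable[D.filtration σ (j + 1)] (D.cubeDiff (σ + j) b) := by
  have h1 := D.stronglyMeasurable_cubeAvg_comap (σ + (j + 1 : ℕ)) b
  have h2 := (D.stronglyMeasurable_cubeAvg_comap (σ + j) b).mono
    ((D.filtration σ).mono j.le_succ)
  have h3 : D.cubeDiff (σ + j) b =
      fun x => D.cubeAvg (σ + (j + 1 : ℕ)) b x - D.cubeAvg (σ + j) b x := by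
    funext x
    rw [cubeDiff, Nat.cast_add_one, add_assoc]
  rw [h3]
  exact h1.sub h2

theorem stronglyMeasurable_cubeParaproduct (b : E → 𝕜) (σ : ℤ) (n : ℕ) (f : E → Y) :
    StronglyMeasurable (D.cubeParaproduct b σ n f) :=
  Finset.stronglyMeasurable_fun_sum _ fun _ _ =>
    (D.stronglyMeasurable_cubeDiff _ b).smul (D.stronglyMeasurable_cubeAvg _ f)

variable {D}

theorem IsRegular.norm_cubeDiff_le (hD : D.IsRegular L) {b : E → 𝕜} (hb : D.MemBMO b) (k : ℤ)
    (x : E) : ‖D.cubeDiff k b x‖ ≤ L * (D.bmoNorm b).toReal :=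
  hD.norm_cubeAvg_sub_le hb ENNReal.toReal_nonneg
    (ENNReal.ofReal_toReal hb.bmoNorm_lt_top.ne).ge k x

theorem IsRegular.condExp_cubeDiff (hD : D.IsRegular L) {σ : ℤ} {Q : Set E} (hQ : Q ∈ D.cubes σ)
    {b : E → 𝕜} (hb : IntegrableOn b Q μ) (j : ℕ) :
    (μ[|Q])[D.cubeDiff (σ + j) b | D.filtration σ j] =ᵐ[μ[|Q]] 0 := by
  have := cond_isProbabilityMeasure_of_finite (hD.ne_zero σ Q hQ) (hD.ne_top σ Q hQ)
  have hM := hD.martingale_cubeAvg hQ hb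
  have h3 : D.cubeDiff (σ + j) b =
      (fun j : ℕ => D.cubeAvg (σ + j) b) (j + 1) - (fun j : ℕ => D.cubeAvg (σ + j) b) j := by
    funext x
    simp only [Pi.sub_apply]
    rw [cubeDiff, Nat.cast_add_one, add_assoc]
  rw [h3]
  refine (condExp_sub (hM.integrable _) (hM.integrable _) _).trans ?_
  filter_upwards [hM.2 j (j + 1) j.le_succ, hM.2 j j le_rfl] with x h1 h2
  rw [Pi.sub_apply, h1, h2, sub_self, Pi.zero_apply]

/-- An event known at time `i` is, inside `Q`, a union of cubes of generation `σ + i`, and the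
packing property holds on each of those. -/
theorem IsRegular.setLIntegral_sum_sq_cubeDiff_le (hD : D.IsRegular L) {b : E → 𝕜}
    (hb : D.MemBMO b) {B : ℝ} (hB0 : 0 ≤ B) (hB : D.bmoNorm b ≤ ENNReal.ofReal B) {σ : ℤ}
    {Q : Set E} (hQ : Q ∈ D.cubes σ) (n i : ℕ) {A : Set E}
    (hA : MeasurableSet[D.filtration σ i] A) :
    ∫⁻ x in A, ∑ j ∈ Finset.Ico i n, ENNReal.ofReal (‖D.cubeDiff (σ + j) b x‖ ^ 2) ∂(μ[|Q]) ≤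
      ENNReal.ofReal (B ^ 2) * (μ[|Q]) A := by
  have hAm : MeasurableSet A := (D.filtration σ).le i A hA
  have hsat : D.IsSaturated (σ + i) (A ∩ Q) := by
    obtain ⟨S, _, rfl⟩ := hA
    exact (D.isSaturated_preimage_cube (σ + i) S).inter
      ((D.isSaturated_of_mem_cubes hQ).mono (by simp : σ ≤ σ + i))
  have h1 : ∫⁻ x in A ∩ Q, ∑ j ∈ Finset.Ico i n,
      ENNReal.ofReal (‖D.cubeDiff (σ + j) b x‖ ^ 2) ∂μ ≤
      ∫⁻ x in A ∩ Q, ENNReal.ofReal (B ^ 2) ∂μ := by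
    refine hsat.setLIntegral_le fun R hR => ?_
    rw [setLIntegral_const]
    refine le_trans (le_of_eq (lintegral_congr fun x => ?_))
      (hD.setLIntegral_sum_sq_le hb hB0 hB hR (n - i))
    rw [Finset.sum_Ico_eq_sum_range]
    refine Finset.sum_congr rfl fun j _ => ?_
    rw [cubeDiff, Nat.cast_add, ← add_assoc]
  rw [setLIntegral_const] at h1
  rw [ProbabilityTheory.cond, Measure.restrict_smul, Measure.restrict_restrict hAm,
    lintegral_smul_measure, Measure.smul_apply, Measure.restrict_apply hAm, smul_eq_mul,
    smul_eq_mul, mul_left_comm]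
  gcongr

/-- Boundedness of truncated dyadic paraproducts under martingale type. -/
theorem exists_eLpNorm_cubeParaproduct_le {X : Type v} [NormedAddCommGroup X] [NormedSpace ℝ X]
    [NormedSpace 𝕜 X] [IsScalarTower ℝ 𝕜 X] [CompleteSpace X] {p : ℝ} (hp1 : 1 ≤ p) (hp2 : p ≤ 2)
    (hT : HasMartingaleType.{u} X p) {s : ℝ≥0∞} (hs1 : 1 < s) (hs : s ≠ ∞) (L : ℝ≥0) :
    ∃ C : ℝ≥0, ∀ (E : Type u) [MetricSpace E] [MeasurableSpace E] (μ : Measure E) (δ r₀ r₁ : ℝ)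
      (D : DyadicSystem μ δ r₀ r₁), D.IsRegular L → ∀ b : E → 𝕜, D.MemBMO b →
      ∀ (σ : ℤ) (n : ℕ), 0 < n → ∀ f : E → X, MemLp f s μ →
        eLpNorm (D.cubeParaproduct b σ n f) s μ ≤
          C * ENNReal.ofReal ((n : ℝ) ^ (1 / p - 1 / 2)) * D.bmoNorm b * eLpNorm f s μ := by
  obtain ⟨C, hC⟩ := exists_eLpNorm_paraproduct_le (𝕜 := 𝕜) hp1 hp2 hT hs1 hs L
  refine ⟨C, fun E _ _ μ δ r₀ r₁ D hD b hb σ n hn f hf => ?_⟩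
  have hs0 : s ≠ 0 := (zero_lt_one.trans hs1).ne'
  set β : ℝ := (D.bmoNorm b).toReal with hβ
  have hβb : ENNReal.ofReal β = D.bmoNorm b := ENNReal.ofReal_toReal hb.bmoNorm_lt_top.ne
  have hβ0 : 0 ≤ β := ENNReal.toReal_nonneg
  -- The abstract estimate needs a positive `B`, while the BMO norm may vanish; it is used for every
  -- `B` above the norm, and `B` decreases to the norm at the end.
  have key : ∀ B : ℝ, β < B → eLpNorm (D.cubeParaproduct b σ n f) s μ ≤
      C * ENNReal.ofReal ((n : ℝ) ^ (1 / p - 1 / 2)) * ENNReal.ofReal B * eLpNorm f s μ := by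
    intro B hβB
    have hB : 0 < B := hβ0.trans_lt hβB
    have hbB : D.bmoNorm b ≤ ENNReal.ofReal B := hβb ▸ ENNReal.ofReal_le_ofReal hβB.le
    refine D.eLpNorm_le_of_forall_cube σ hs0 hs (ENNReal.mul_ne_top (ENNReal.mul_ne_top
      ENNReal.coe_ne_top ENNReal.ofReal_ne_top) ENNReal.ofReal_ne_top) fun Q hQ =>
      hD.eLpNorm_restrict_le_of_cond hQ hs ?_
    have := cond_isProbabilityMeasure_of_finite (hD.ne_zero σ Q hQ) (hD.ne_top σ Q hQ)
    have hfQ := hD.integrableOn_of_memLp hQ hs1.le hf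
    have hfP : MemLp f s (μ[|Q]) := hD.memLp_cond hQ (hf.restrict Q)
    have hφc := hD.cubeAvg_ae_eq_condExp hQ hfQ n
    refine (hC E (μ[|Q]) (D.filtration σ) (fun j => D.cubeDiff (σ + j) b)
      (fun j => D.cubeAvg (σ + j) f) n B hn hB (hD.martingale_cubeAvg hQ hfQ)
      ((hfP.condExp hs1.le).ae_eq hφc.symm)
      (fun i => D.stronglyMeasurable_filtration_cubeDiff σ b i)
      (fun i x => hD.norm_cubeAvg_sub_le hb hB.le hbB _ x)
      (fun i => hD.condExp_cubeDiff hQ (hb.integrableOn σ Q hQ) i)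
      (fun i A hA => hD.setLIntegral_sum_sq_cubeDiff_le hb hB.le hbB hQ n i hA)).trans ?_
    gcongr
    rw [eLpNorm_congr_ae hφc]
    exact eLpNorm_condExp_le_eLpNorm _ hs1.le
  have hlim : Tendsto (fun B : ℝ => C * ENNReal.ofReal ((n : ℝ) ^ (1 / p - 1 / 2)) *
      ENNReal.ofReal B * eLpNorm f s μ) (𝓝[>] β)
      (𝓝 (C * ENNReal.ofReal ((n : ℝ) ^ (1 / p - 1 / 2)) * ENNReal.ofReal β * eLpNorm f s μ)) := by
    refine ENNReal.Tendsto.mul_const (ENNReal.Tendsto.const_mul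
      ((ENNReal.continuous_ofReal.tendsto β).mono_left nhdsWithin_le_nhds)
      (Or.inr (ENNReal.mul_ne_top ENNReal.coe_ne_top ENNReal.ofReal_ne_top))) (Or.inr hf.2.ne)
  rw [hβb] at hlim
  exact ge_of_tendsto hlim (eventually_nhdsWithin_of_forall fun B hB => key B hB)

theorem exists_eLpNorm_paraproduct_le {X : Type v} [NormedAddCommGroup X] [NormedSpace ℝ X]
    [NormedSpace 𝕜 X] [IsScalarTower ℝ 𝕜 X] [CompleteSpace X] {p : ℝ} (hp1 : 1 ≤ p) (hp2 : p ≤ 2)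
    (hT : HasMartingaleType.{u} X p) {s : ℝ≥0∞} (hs1 : 1 < s) (hs : s ≠ ∞) (L : ℝ≥0) :
    ∃ C : ℝ≥0, ∀ (E : Type u) [MetricSpace E] [MeasurableSpace E] (μ : Measure E) (δ r₀ r₁ : ℝ)
      (D : DyadicSystem μ δ r₀ r₁), D.IsRegular L → ∀ b : E → 𝕜, D.MemBMO b →
      ∀ (σ τ : ℤ), σ ≤ τ → ∀ f : E → X, MemLp f s μ →
        MemLp (D.paraproduct b σ τ f) s μ ∧ eLpNorm (D.paraproduct b σ τ f) s μ ≤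
          C * ENNReal.ofReal (((τ - σ + 1 : ℤ) : ℝ) ^ (1 / p - 1 / 2)) * D.bmoNorm b *
            eLpNorm f s μ := by
  obtain ⟨C, hC⟩ := exists_eLpNorm_cubeParaproduct_le (𝕜 := 𝕜) hp1 hp2 hT hs1 hs L
  refine ⟨C, fun E _ _ μ δ r₀ r₁ D hD b hb σ τ hστ f hf => ?_⟩
  have h1 := hC E μ δ r₀ r₁ D hD b hb σ (τ - σ + 1).toNat (by omega) f hf
  have h2 : (((τ - σ + 1).toNat : ℕ) : ℝ) = ((τ - σ + 1 : ℤ) : ℝ) := by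
    rw [← Int.cast_natCast, Int.toNat_of_nonneg (by omega)]
  rw [h2] at h1
  have hae := D.paraproduct_ae_eq b σ τ f
  rw [← eLpNorm_congr_ae hae] at h1
  refine ⟨⟨(D.stronglyMeasurable_cubeParaproduct b σ _ f).aestronglyMeasurable.congr hae.symm,
    h1.trans_lt ?_⟩, h1⟩
  exact ENNReal.mul_lt_top (ENNReal.mul_lt_top (ENNReal.mul_lt_top ENNReal.coe_lt_top
    ENNReal.ofReal_lt_top) hb.bmoNorm_lt_top) hf.2

end DyadicSystem

/-! ### Dual paraproducts and duality. -/

namespace DyadicSystem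

variable {E : Type u} [MetricSpace E] [MeasurableSpace E] {μ : Measure E} {δ r₀ r₁ : ℝ}
  (D : DyadicSystem μ δ r₀ r₁) {𝕜 : Type w} [RCLike 𝕜] {L : ℝ≥0}

section

variable {Y : Type v} [NormedAddCommGroup Y] [NormedSpace ℝ Y] [NormedSpace 𝕜 Y]

theorem cubeAvg_congr_ae (k : ℤ) {f g : E → Y} (h : f =ᵐ[μ] g) : D.cubeAvg k f = D.cubeAvg k g := by
  funext x
  rw [cubeAvg, cubeAvg, average_congr (ae_restrict_of_ae h)]

/-- A dual paraproduct with `n` summands, starting from generation `σ`. -/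
def cubeDualParaproduct (b : E → 𝕜) (σ : ℤ) (n : ℕ) (f : E → Y) (x : E) : Y :=
  ∑ j ∈ Finset.range n, D.cubeAvg (σ + j) (fun y => D.cubeDiff (σ + j) b y • f y) x

theorem dualParaproduct_ae_eq (b : E → 𝕜) (σ τ : ℤ) (f : E → Y) :
    D.dualParaproduct b σ τ f =ᵐ[μ] D.cubeDualParaproduct b σ (τ - σ + 1).toNat f := by
  filter_upwards [D.ae_mem_goodSet] with x hx
  rw [dualParaproduct, cubeDualParaproduct, sum_Icc_int_eq_sum_range]
  refine Finset.sum_congr rfl fun j _ => ?_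
  rw [D.avg_eq_cubeAvg _ _ hx]
  refine congrFun (D.cubeAvg_congr_ae _ ?_) x
  filter_upwards [D.diff_ae_eq (σ + j) b] with y hy
  rw [hy]

variable {D}

omit [NormedSpace ℝ Y] in
theorem IsRegular.memLp_cubeDiff_smul (hD : D.IsRegular L) {b : E → 𝕜} (hb : D.MemBMO b) (k : ℤ)
    {s : ℝ≥0∞} {f : E → Y} (hf : MemLp f s μ) : MemLp (fun x => D.cubeDiff k b x • f x) s μ :=
  hf.of_le_mul ((D.stronglyMeasurable_cubeDiff k b).aestronglyMeasurable.smul hf.1)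
    (ae_of_all _ fun x => by
      rw [norm_smul]
      exact mul_le_mul_of_nonneg_right (hD.norm_cubeDiff_le hb k x) (norm_nonneg _))

theorem IsRegular.memLp_cubeDualParaproduct [CompleteSpace Y] (hD : D.IsRegular L) {b : E → 𝕜}
    (hb : D.MemBMO b) (σ : ℤ) (n : ℕ) {s : ℝ≥0∞} (hs1 : 1 ≤ s) (hs : s ≠ ∞) {f : E → Y}
    (hf : MemLp f s μ) : MemLp (D.cubeDualParaproduct b σ n f) s μ :=
  memLp_finsetSum _ fun _ _ => hD.memLp_cubeAvg hs1 hs _ (hD.memLp_cubeDiff_smul hb _ hf)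

end

variable {X : Type v} [NormedAddCommGroup X] [NormedSpace ℝ X] [NormedSpace 𝕜 X]
  [IsScalarTower ℝ 𝕜 X] [CompleteSpace X]

omit [NormedSpace ℝ X] [IsScalarTower ℝ 𝕜 X] [CompleteSpace X] in
theorem integrable_dual_apply {Ω : Type*} {mΩ : MeasurableSpace Ω} {P : Measure Ω} {s s' : ℝ≥0∞}
    [ENNReal.HolderConjugate s' s] {g : Ω → StrongDual 𝕜 X} {f : Ω → X} (hg : MemLp g s' P)
    (hf : MemLp f s P) : Integrable (fun x => g x (f x)) P :=
  memLp_one_iff_integrable.1 ((ContinuousLinearMap.id 𝕜 (StrongDual 𝕜 X)).memLp_of_bilin 1 hg hf)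

variable {D}

/-- Averaging operators are self-adjoint. -/
theorem IsRegular.integral_apply_cubeAvg (hD : D.IsRegular L) (k : ℤ) {s s' : ℝ≥0∞}
    [hss : ENNReal.HolderConjugate s' s] (hs1 : 1 < s) (hs : s ≠ ∞) {g : E → StrongDual 𝕜 X}
    {f : E → X} (hg : MemLp g s' μ) (hf : MemLp f s μ) :
    ∫ x, g x (D.cubeAvg k f x) ∂μ = ∫ x, D.cubeAvg k g x (f x) ∂μ := by
  have hs'1 : 1 < s' := (ENNReal.HolderConjugate.lt_top_iff_one_lt s s').1 hs.lt_top
  have hs' : s' ≠ ∞ := ((ENNReal.HolderConjugate.lt_top_iff_one_lt s' s).2 hs1).ne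
  have h1 := integrable_dual_apply hg (hD.memLp_cubeAvg hs1.le hs k hf)
  have h2 := integrable_dual_apply (hD.memLp_cubeAvg hs'1.le hs' k hg) hf
  rw [← setIntegral_univ, ← setIntegral_univ (μ := μ)]
  refine (D.isSaturated_univ k).setIntegral_congr h1.integrableOn h2.integrableOn
    fun Q hQ _ => ?_
  have hgQ := hD.integrableOn_of_memLp hQ hs'1.le hg
  have hfQ := hD.integrableOn_of_memLp hQ hs1.le hf
  have h3 : ∫ x in Q, g x (D.cubeAvg k f x) ∂μ = ∫ x in Q, g x (⨍ y in Q, f y ∂μ) ∂μ := by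
    refine integral_congr_ae ?_
    filter_upwards [D.cubeAvg_ae_eq_const hQ f] with x hx
    rw [hx]
  have h4 : ∫ x in Q, D.cubeAvg k g x (f x) ∂μ = ∫ x in Q, (⨍ y in Q, g y ∂μ) (f x) ∂μ := by
    refine integral_congr_ae ?_
    filter_upwards [D.cubeAvg_ae_eq_const hQ g] with x hx
    rw [hx]
  -- Both sides are `μ(Q)⁻¹` times the integral of `g` over `Q` applied to the integral of `f` over
  -- `Q`.
  rw [h3, h4, ← ContinuousLinearMap.integral_apply hgQ,
    ContinuousLinearMap.integral_comp_comm _ hfQ, setAverage_eq, setAverage_eq, smul_apply]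
  exact ContinuousLinearMap.map_smul_of_tower _ _ _

theorem IsRegular.integral_apply_cubeDualParaproduct (hD : D.IsRegular L) {b : E → 𝕜}
    (hb : D.MemBMO b) (σ : ℤ) (n : ℕ) {s s' : ℝ≥0∞} [hss : ENNReal.HolderConjugate s' s]
    (hs1 : 1 < s) (hs : s ≠ ∞) {g : E → StrongDual 𝕜 X} {f : E → X} (hg : MemLp g s' μ)
    (hf : MemLp f s μ) :
    ∫ x, g x (D.cubeDualParaproduct b σ n f x) ∂μ =
      ∫ x, D.cubeParaproduct b σ n g x (f x) ∂μ := by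
  have hs'1 : 1 < s' := (ENNReal.HolderConjugate.lt_top_iff_one_lt s s').1 hs.lt_top
  have hs' : s' ≠ ∞ := ((ENNReal.HolderConjugate.lt_top_iff_one_lt s' s).2 hs1).ne
  have hdf := fun k => hD.memLp_cubeDiff_smul hb k hf
  have h1 : ∀ j : ℕ, Integrable
      (fun x => g x (D.cubeAvg (σ + j) (fun y => D.cubeDiff (σ + j) b y • f y) x)) μ := fun j =>
    integrable_dual_apply hg (hD.memLp_cubeAvg hs1.le hs _ (hdf (σ + j)))
  have h2 : ∀ j : ℕ, Integrable
      (fun x => D.cubeDiff (σ + j) b x • D.cubeAvg (σ + j) g x (f x)) μ := fun j => by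
    simpa using integrable_dual_apply (hD.memLp_cubeAvg hs'1.le hs' (σ + j) hg) (hdf (σ + j))
  simp only [cubeDualParaproduct, cubeParaproduct, map_sum, sum_apply, smul_apply]
  rw [integral_finsetSum _ fun j _ => h1 j, integral_finsetSum _ fun j _ => h2 j]
  refine Finset.sum_congr rfl fun j _ => ?_
  rw [hD.integral_apply_cubeAvg _ hs1 hs hg (hdf (σ + j))]
  simp only [map_smul]

/-- Boundedness of truncated dual paraproducts under martingale cotype, and duality. -/
theorem exists_eLpNorm_dualParaproduct_le {q : ℝ} (hq : 2 ≤ q) (hX : HasMartingaleCotype.{u} X q)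
    {s : ℝ≥0∞} (hs1 : 1 < s) (hs : s ≠ ∞) (L : ℝ≥0) :
    ∃ C : ℝ≥0, ∀ (E : Type u) [MetricSpace E] [MeasurableSpace E] (μ : Measure E) (δ r₀ r₁ : ℝ)
      (D : DyadicSystem μ δ r₀ r₁), D.IsRegular L → ∀ b : E → 𝕜, D.MemBMO b →
      ∀ (σ τ : ℤ), σ ≤ τ → ∀ f : E → X, MemLp f s μ →
        MemLp (D.dualParaproduct b σ τ f) s μ ∧ eLpNorm (D.dualParaproduct b σ τ f) s μ ≤
          C * ENNReal.ofReal (((τ - σ + 1 : ℤ) : ℝ) ^ (1 / 2 - 1 / q)) * D.bmoNorm b *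
            eLpNorm f s μ ∧
        ∀ s' : ℝ≥0∞, ENNReal.HolderConjugate s s' → ∀ g : E → StrongDual 𝕜 X, MemLp g s' μ →
          ∫ x, g x (D.dualParaproduct b σ τ f x) ∂μ =
            ∫ x, (D.paraproduct b σ τ g x) (f x) ∂μ := by
  have : Fact (1 ≤ s) := ⟨hs1.le⟩
  have hqq : q.HolderConjugate q.conjExponent := Real.HolderConjugate.conjExponent (by linarith)
  set q' := q.conjExponent
  have hq'1 : 1 ≤ q' := hqq.symm.lt.le
  have hq' : 1 / q' = 1 - 1 / q := by
    have := hqq.inv_add_inv_eq_one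
    rw [one_div, one_div]
    linarith
  have hq'2 : q' ≤ 2 := by
    have h1 : 1 / q ≤ 1 / 2 := one_div_le_one_div_of_le two_pos hq
    have h2 : 1 / 2 ≤ 1 / q' := by rw [hq']; linarith
    exact (one_div_le_one_div two_pos (by linarith)).1 h2
  set t := s.conjExponent
  have hst : ENNReal.HolderConjugate s t := .conjExponent hs1.le
  have hts : ENNReal.HolderConjugate t s := hst.symm
  have ht1 : 1 < t := (ENNReal.HolderConjugate.lt_top_iff_one_lt s t).1 hs.lt_top
  have ht : t ≠ ∞ := ((ENNReal.HolderConjugate.lt_top_iff_one_lt t s).2 hs1).ne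
  -- The first assertion is applied to the dual space, of type `q'`, in `L_t` with `t` conjugate to
  -- `s`.
  obtain ⟨C, hC⟩ := exists_eLpNorm_paraproduct_le (𝕜 := 𝕜) hq'1 hq'2
    (hX.hasMartingaleType_dual (𝕜 := 𝕜) hqq) ht1 ht L
  refine ⟨C, fun E _ _ μ δ r₀ r₁ D hD b hb σ τ hστ f hf => ?_⟩
  have hae := D.dualParaproduct_ae_eq b σ τ f
  have hmem : MemLp (D.dualParaproduct b σ τ f) s μ :=
    (hD.memLp_cubeDualParaproduct hb σ _ hs1.le hs hf).ae_eq hae.symm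
  have hdual : ∀ s' : ℝ≥0∞, ENNReal.HolderConjugate s s' → ∀ g : E → StrongDual 𝕜 X,
      MemLp g s' μ → ∫ x, g x (D.dualParaproduct b σ τ f x) ∂μ =
        ∫ x, (D.paraproduct b σ τ g x) (f x) ∂μ := by
    intro s' hs' g hg
    have := hs'.symm
    have h := hD.integral_apply_cubeDualParaproduct hb σ (τ - σ + 1).toNat hs1 hs hg hf
    refine Eq.trans (integral_congr_ae ?_) (h.trans (integral_congr_ae ?_))
    · filter_upwards [hae] with x hx
      rw [hx]
    · filter_upwards [D.paraproduct_ae_eq b σ τ g] with x hx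
      rw [hx]
  refine ⟨hmem, ?_, hdual⟩
  -- The dual space norms `X` by Hahn–Banach, so simple `X'`-valued test functions suffice and no
  -- description of the dual of `L_s(X)` is needed.
  refine eLpNorm_le_of_forall_simpleFunc (NormedSpace.inclusionInDoubleDual 𝕜 X)
    (fun y z => by
      rw [NormedSpace.dual_def, mul_comm]
      exact z.le_opNorm y)
    (fun y c _ hc => by
      obtain ⟨z, hz, hzy⟩ := exists_dual_vector'' 𝕜 y
      refine ⟨z, hz, ?_⟩
      rw [NormedSpace.dual_def, hzy, RCLike.ofReal_re]
      exact mul_le_of_le_one_left (norm_nonneg y) hc.le) (s' := t) hs1 hs hmem fun k hk => ?_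
  simp only [NormedSpace.dual_def]
  rw [hdual t hst k hk]
  obtain ⟨h1, h2⟩ := hC E μ δ r₀ r₁ D hD b hb σ τ hστ k hk
  refine (enorm_integral_bilin_le (ContinuousLinearMap.id 𝕜 (StrongDual 𝕜 X))
    (fun y z => y.le_opNorm z) (s := t) (s' := s) h1.1 hf.1).trans ?_
  calc _ ≤ C * ENNReal.ofReal (((τ - σ + 1 : ℤ) : ℝ) ^ (1 / q' - 1 / 2)) * D.bmoNorm b *
        eLpNorm k t μ * eLpNorm f s μ := by gcongr
    _ = _ := by
        rw [hq', show (1 - 1 / q - 1 / 2 : ℝ) = 1 / 2 - 1 / q by ring]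
        ring

end DyadicSystem

/-! ### Scalar paraproducts: orthogonality, interpolation and smallness of outer blocks. -/

section ScalarType

variable {𝕜 : Type w} [RCLike 𝕜]

theorem lintegral_ofReal_norm_sq {Ω Z : Type*} [NormedAddCommGroup Z] {mΩ : MeasurableSpace Ω}
    {P : Measure Ω} (g : Ω → Z) :
    ∫⁻ ω, ENNReal.ofReal (‖g ω‖ ^ 2) ∂P = eLpNorm g 2 P ^ (2 : ℝ) := by
  have := lintegral_ofReal_norm_rpow (P := P) g two_ne_zero ENNReal.ofNat_ne_top
  rw [ENNReal.toReal_ofNat] at this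
  rw [← this]
  simp

theorem lintegral_norm_sq_martingale {Ω : Type*} {mΩ : MeasurableSpace Ω} {P : Measure Ω}
    [IsProbabilityMeasure P] {ℱ : Filtration ℕ mΩ} {β : ℕ → Ω → 𝕜} (hβ : Martingale β ℱ P) {N : ℕ}
    (hLp : ∀ n ≤ N, MemLp (β n) 2 P) :
    ∫⁻ ω, ENNReal.ofReal (‖β N ω‖ ^ 2) ∂P = ∫⁻ ω, ENNReal.ofReal
      (‖β 0 ω‖ ^ 2 + ∑ n ∈ Finset.range N, ‖β (n + 1) ω - β n ω‖ ^ 2) ∂P := by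
  have hsqint : ∀ {g : Ω → 𝕜}, MemLp g 2 P → Integrable (fun x => ‖g x‖ ^ 2) P :=
    fun hg => hg.integrable_norm_pow two_ne_zero
  rw [← ofReal_integral_eq_lintegral_ofReal (hsqint (hLp N le_rfl))
      (ae_of_all _ fun x => by positivity), integral_norm_sq_martingale hβ hLp,
    ofReal_integral_eq_lintegral_ofReal _ (ae_of_all _ fun x => by positivity)]
  exact (hsqint (hLp 0 N.zero_le)).add (integrable_finsetSum _ fun j hj =>
    have hj := Finset.mem_range.1 hj
    hsqint ((hLp (j + 1) hj).sub (hLp j hj.le)))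

/-- Scalars have martingale type `2`. -/
theorem hasMartingaleType_two_scalar : HasMartingaleType.{u} 𝕜 2 := by
  refine ⟨2, ENNReal.one_lt_two, ENNReal.ofNat_ne_top, 1, fun Ω mΩ P _ ℱ f hf N hLp => ?_⟩
  rw [ENNReal.coe_one, one_mul, ← ENNReal.rpow_le_rpow_iff two_pos, ← lintegral_ofReal_norm_sq,
    ← lintegral_ofReal_norm_sq, lintegral_norm_sq_martingale hf hLp]
  refine lintegral_mono fun ω => ENNReal.ofReal_le_ofReal ?_
  simp only [Real.rpow_ofNat]
  rw [← Real.sqrt_eq_rpow, Real.norm_of_nonneg (Real.sqrt_nonneg _), Real.sq_sqrt (by positivity)]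

end ScalarType

/-- Interpolation of `L_s` between `L_2` and some `L_t`. -/
theorem exists_eLpNorm_rpow_le_interpolation {s : ℝ≥0∞} (hs1 : 1 < s) (hs : s ≠ ∞) :
    ∃ t : ℝ≥0∞, 1 < t ∧ t ≠ ∞ ∧ ∃ p q : ℝ, 0 < p ∧ 0 ≤ q ∧
      ∀ {Ω Z : Type*} [NormedAddCommGroup Z] {_ : MeasurableSpace Ω} {μ : Measure Ω} {g : Ω → Z},
        AEStronglyMeasurable g μ → eLpNorm g s μ ^ s.toReal ≤
          (eLpNorm g 2 μ ^ (2 : ℝ)) ^ p * (eLpNorm g t μ ^ t.toReal) ^ q := by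
  have hσ1 : 1 < s.toReal := by
    rw [← ENNReal.toReal_one]
    exact (ENNReal.toReal_lt_toReal ENNReal.one_ne_top hs).2 hs1
  set σ := s.toReal with hσ
  -- `p` is the share of `L_2` in `σ = 2 p + t (1 - p)`. It is positive, so that smallness in `L_2`
  -- survives, and below `σ - 1`, which is equivalent to `t > 1`.
  set p : ℝ := min (1 / 2) ((σ - 1) / 2) with hp
  have hp0 : 0 < p := lt_min (by norm_num) (by linarith)
  have hp1 : p ≤ 1 / 2 := min_le_left _ _
  have hp2 : p ≤ (σ - 1) / 2 := min_le_right _ _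
  set t : ℝ := (σ - 2 * p) / (1 - p) with ht
  have ht1 : 1 < t := by
    rw [ht, lt_div_iff₀ (by linarith)]
    linarith
  have htσ : 2 * p + t * (1 - p) = σ := by
    rw [ht, div_mul_cancel₀ _ (by linarith)]
    ring
  have htt : (ENNReal.ofReal t).toReal = t := ENNReal.toReal_ofReal (by linarith)
  refine ⟨ENNReal.ofReal t, by simpa using ht1, ENNReal.ofReal_ne_top, p, 1 - p, hp0,
    by linarith, fun {Ω Z} _ _ μ g hg => ?_⟩
  have h2 := lintegral_enorm_rpow_toReal (P := μ) g two_ne_zero ENNReal.ofNat_ne_top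
  rw [ENNReal.toReal_ofNat] at h2
  rw [← lintegral_enorm_rpow_toReal g (zero_lt_one.trans hs1).ne' hs, ← h2,
    ← lintegral_enorm_rpow_toReal g (by simpa using by linarith) ENNReal.ofReal_ne_top, htt]
  refine le_trans (le_of_eq (lintegral_congr fun x => ?_)) (ENNReal.lintegral_mul_norm_pow_le
    (hg.enorm.pow_const 2) (hg.enorm.pow_const t) hp0.le (by linarith) (by ring))
  rw [← ENNReal.rpow_mul, ← ENNReal.rpow_mul, ← ENNReal.rpow_add_of_nonneg _ _ (by positivity)
    (mul_nonneg (by linarith) (by linarith)), htσ]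

namespace DyadicSystem

variable {E : Type u} [MetricSpace E] [MeasurableSpace E] {μ : Measure E} {δ r₀ r₁ : ℝ}
  {D : DyadicSystem μ δ r₀ r₁} {𝕜 : Type w} [RCLike 𝕜] {L : ℝ≥0}

theorem norm_cubeAvg_le {Y : Type*} [NormedAddCommGroup Y] [NormedSpace ℝ Y] {f : E → Y} {R : ℝ}
    (hR : 0 ≤ R) (hf : ∀ x, ‖f x‖ ≤ R) (k : ℤ) (x : E) : ‖D.cubeAvg k f x‖ ≤ R := by
  refine (norm_integral_le_of_norm_le_const (C := R) (ae_of_all _ hf)).trans ?_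
  refine mul_le_of_le_one_right hR ?_
  rw [measureReal_def, Measure.smul_apply, smul_eq_mul]
  refine ENNReal.toReal_le_of_le_ofReal zero_le_one ?_
  rw [ENNReal.ofReal_one]
  exact ENNReal.inv_mul_le_one _

/-- On each cube of generation `σ` the partial sums form a martingale with these summands as
differences; boundedness of `f` makes the transform square integrable. -/
theorem IsRegular.lintegral_norm_sq_cubeParaproduct (hD : D.IsRegular L) {b : E → 𝕜}
    (hb : D.MemBMO b) (σ : ℤ) (n : ℕ) {f : E → 𝕜} {R : ℝ} (hR : 0 ≤ R) (hf : ∀ x, ‖f x‖ ≤ R) :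
    ∫⁻ x, ENNReal.ofReal (‖D.cubeParaproduct b σ n f x‖ ^ 2) ∂μ =
      ∑ j ∈ Finset.range n, ∫⁻ x, ENNReal.ofReal
        (‖D.cubeDiff (σ + j) b x • D.cubeAvg (σ + j) f x‖ ^ 2) ∂μ := by
  have hm : ∀ j : ℕ, Measurable fun x =>
      ENNReal.ofReal (‖D.cubeDiff (σ + j) b x • D.cubeAvg (σ + j) f x‖ ^ 2) := fun j =>
    ENNReal.measurable_ofReal.comp (((D.stronglyMeasurable_cubeDiff _ b).smul
      (D.stronglyMeasurable_cubeAvg _ f)).norm.measurable.pow_const 2)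
  rw [← lintegral_finsetSum _ fun j _ => hm j]
  have key : ∀ Q ∈ D.cubes σ, ∫⁻ x in Q, ENNReal.ofReal (‖D.cubeParaproduct b σ n f x‖ ^ 2) ∂μ =
      ∫⁻ x in Q, ∑ j ∈ Finset.range n, ENNReal.ofReal
        (‖D.cubeDiff (σ + j) b x • D.cubeAvg (σ + j) f x‖ ^ 2) ∂μ := by
    intro Q hQ
    have := cond_isProbabilityMeasure_of_finite (hD.ne_zero σ Q hQ) (hD.ne_top σ Q hQ)
    have hM := martingale_sum_smul (P := μ[|Q]) (ℱ := D.filtration σ)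
      (d := fun j => D.cubeDiff (σ + j) b) (ψ := fun j => D.cubeAvg (σ + j) f)
      (fun i => D.stronglyMeasurable_filtration_cubeDiff σ b i)
      (fun i => D.stronglyMeasurable_cubeAvg_comap (σ + i) f)
      (fun i x => hD.norm_cubeDiff_le hb (σ + i) x) (fun i x => norm_cubeAvg_le hR hf (σ + i) x)
      (fun i => hD.condExp_cubeDiff hQ (hb.integrableOn σ Q hQ) i)
    have hM2 : ∀ m ≤ n, MemLp (D.cubeParaproduct b σ m f) 2 (μ[|Q]) := fun m _ =>
      memLp_finsetSum _ fun j _ => MemLp.of_bound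
        ((D.stronglyMeasurable_cubeDiff _ b).smul
          (D.stronglyMeasurable_cubeAvg _ f)).aestronglyMeasurable
        (L * (D.bmoNorm b).toReal * R) (ae_of_all _ fun x => by
          rw [norm_smul]
          exact mul_le_mul (hD.norm_cubeDiff_le hb _ x) (norm_cubeAvg_le hR hf _ x)
            (norm_nonneg _) (by positivity))
    have h := lintegral_norm_sq_martingale hM (N := n) hM2
    simp only [Finset.range_zero, Finset.sum_empty, norm_zero, Finset.sum_range_succ,
      add_sub_cancel_left, ne_eq, OfNat.ofNat_ne_zero, not_false_eq_true, zero_pow, zero_add] at h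
    rw [ProbabilityTheory.cond, lintegral_smul_measure, lintegral_smul_measure, smul_eq_mul,
      smul_eq_mul, ENNReal.mul_right_inj (ENNReal.inv_ne_zero.2 (hD.ne_top σ Q hQ))
      (ENNReal.inv_ne_top.2 (hD.ne_zero σ Q hQ))] at h
    refine h.trans (lintegral_congr fun x => ?_)
    exact ENNReal.ofReal_sum_of_nonneg fun j _ => by positivity
  rw [← setLIntegral_univ, ← setLIntegral_univ (μ := μ)]
  exact le_antisymm ((D.isSaturated_univ σ).setLIntegral_le fun Q hQ => (key Q hQ).le)
    ((D.isSaturated_univ σ).setLIntegral_le fun Q hQ => (key Q hQ).ge)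

/-- Scalars have martingale type `2`, for which the factor in `n` is `1`. -/
theorem IsRegular.exists_eLpNorm_cubeParaproduct_scalar_le (hD : D.IsRegular L) {b : E → 𝕜}
    (hb : D.MemBMO b) {t : ℝ≥0∞} (ht1 : 1 < t) (ht : t ≠ ∞) {f : E → 𝕜} (hf : MemLp f t μ) :
    ∃ K : ℝ≥0∞, K ≠ ∞ ∧ ∀ (σ : ℤ) (n : ℕ), eLpNorm (D.cubeParaproduct b σ n f) t μ ≤ K := by
  obtain ⟨C, hC⟩ := exists_eLpNorm_cubeParaproduct_le (𝕜 := 𝕜) one_le_two le_rfl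
    (hasMartingaleType_two_scalar.{u} (𝕜 := 𝕜)) ht1 ht L
  refine ⟨C * D.bmoNorm b * eLpNorm f t μ, ENNReal.mul_ne_top (ENNReal.mul_ne_top
    ENNReal.coe_ne_top hb.bmoNorm_lt_top.ne) hf.2.ne, fun σ n => ?_⟩
  rcases n.eq_zero_or_pos with rfl | hn
  · have : D.cubeParaproduct b σ 0 f = fun _ => 0 := by
      funext x
      simp [cubeParaproduct]
    rw [this]
    simp
  · simpa using hC E μ δ r₀ r₁ D hD b hb σ n hn f hf

/-- Blocks of the paraproduct series of a bounded scalar function with support of finite measure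
are small if the generations involved are far from zero. -/
theorem IsRegular.exists_forall_eLpNorm_cubeParaproduct_le (hD : D.IsRegular L) {b : E → 𝕜}
    (hb : D.MemBMO b) {s : ℝ≥0∞} (hs1 : 1 < s) (hs : s ≠ ∞) {f : E → 𝕜} {R : ℝ} (hR : 0 ≤ R)
    (hf : ∀ x, ‖f x‖ ≤ R) (hfLp : ∀ t, MemLp f t μ) {ε : ℝ≥0∞} (hε : 0 < ε) :
    ∃ M : ℕ, ∀ (σ : ℤ) (n : ℕ), σ + n ≤ -M ∨ M < σ →
      eLpNorm (D.cubeParaproduct b σ n f) s μ ≤ ε := by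
  obtain ⟨t, ht1, ht, p, q, hp, hq, hint⟩ := exists_eLpNorm_rpow_le_interpolation hs1 hs
  obtain ⟨K, hK, hKt⟩ := hD.exists_eLpNorm_cubeParaproduct_scalar_le hb ht1 ht (hfLp t)
  obtain ⟨K₂, hK₂, hK₂t⟩ := hD.exists_eLpNorm_cubeParaproduct_scalar_le hb ENNReal.one_lt_two
    ENNReal.ofNat_ne_top (hfLp 2)
  have hσ : 0 < s.toReal := ENNReal.toReal_pos (zero_lt_one.trans hs1).ne' hs
  set a : ℤ → ℝ≥0∞ := fun i =>
    ∫⁻ x, ENNReal.ofReal (‖D.cubeDiff i b x • D.cubeAvg i f x‖ ^ 2) ∂μ with ha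
  have hsum : ∀ (σ : ℤ) (n : ℕ), ∑ j ∈ Finset.range n, a (σ + j) =
      eLpNorm (D.cubeParaproduct b σ n f) 2 μ ^ (2 : ℝ) := fun σ n => by
    rw [← lintegral_ofReal_norm_sq, hD.lintegral_norm_sq_cubeParaproduct hb σ n hR hf]
  -- Any finite set of generations lies in a symmetric block, whose sum of squares is a squared
  -- `L_2` norm bounded uniformly by `K₂²`.
  have htsum : ∑' i, a i ≠ ∞ := by
    refine ne_top_of_le_ne_top (ENNReal.rpow_ne_top_of_nonneg zero_le_two hK₂)
      (b := K₂ ^ (2 : ℝ)) ?_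
    rw [ENNReal.tsum_eq_iSup_sum]
    refine iSup_le fun F => ?_
    obtain ⟨N, hN⟩ : ∃ N : ℕ, ∀ i ∈ F, -(N : ℤ) ≤ i ∧ i ≤ N := by
      refine ⟨F.sup Int.natAbs, fun i hi => ?_⟩
      have := Finset.le_sup (f := Int.natAbs) hi
      omega
    calc ∑ i ∈ F, a i ≤ ∑ i ∈ Finset.Icc (-(N : ℤ)) N, a i :=
          Finset.sum_le_sum_of_subset fun i hi => Finset.mem_Icc.2 (hN i hi)
      _ ≤ K₂ ^ (2 : ℝ) := by
          rw [sum_Icc_int_eq_sum_range, hsum]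
          exact ENNReal.rpow_le_rpow (hK₂t _ _) zero_le_two
  have hlim : Tendsto (fun F : Finset ℤ => (∑' i : {x // x ∉ F}, a i) ^ p * (K ^ t.toReal) ^ q)
      atTop (𝓝 0) := by
    have h1 := (ENNReal.tendsto_tsum_compl_atTop_zero htsum).ennrpow_const p
    rw [ENNReal.zero_rpow_of_pos hp] at h1
    have h2 := ENNReal.Tendsto.mul_const (b := (K ^ t.toReal) ^ q) h1
      (Or.inr (ENNReal.rpow_ne_top_of_nonneg hq
        (ENNReal.rpow_ne_top_of_nonneg ENNReal.toReal_nonneg hK)))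
    rwa [zero_mul] at h2
  -- `F` is a finite set of generations outside which the squares have a small sum; a block beyond
  -- the largest absolute value in `F` avoids it.
  obtain ⟨F, hF⟩ := (hlim.eventually_le_const (ENNReal.rpow_pos_of_nonneg hε hσ.le)).exists
  refine ⟨F.sup Int.natAbs, fun σ n hσn => ?_⟩
  have hdisj : ∀ j ∈ Finset.range n, σ + (j : ℤ) ∉ F := fun j hj hj' => by
    have h1 := Finset.le_sup (f := Int.natAbs) hj'
    have h2 := Finset.mem_range.1 hj
    omega
  have htail : ∑ j ∈ Finset.range n, a (σ + j) ≤ ∑' i : {x // x ∉ F}, a i := by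
    have hinj : Set.InjOn (fun j : ℕ => σ + (j : ℤ)) (Finset.range n) := fun i _ j _ h => by
      simpa using h
    rw [← Finset.sum_image (f := a) hinj, ← Finset.sum_subtype_of_mem a (p := fun x => x ∉ F)]
    · exact ENNReal.sum_le_tsum _
    · intro i hi
      obtain ⟨j, hj, rfl⟩ := Finset.mem_image.1 hi
      exact hdisj j hj
  rw [← ENNReal.rpow_le_rpow_iff hσ]
  refine (hint (D.stronglyMeasurable_cubeParaproduct b σ n f).aestronglyMeasurable).trans
    (le_trans ?_ hF)
  rw [← hsum]
  gcongr
  exact hKt σ n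

end DyadicSystem

theorem sum_Icc_int_add_add {G : Type*} [AddCommMonoid G] (u : ℤ → G) {σ τ a c : ℤ} (h1 : σ ≤ a)
    (h2 : a ≤ c + 1) (h3 : c ≤ τ) :
    ∑ i ∈ Finset.Icc σ τ, u i = ∑ i ∈ Finset.Icc σ (a - 1), u i + ∑ i ∈ Finset.Icc a c, u i +
      ∑ i ∈ Finset.Icc (c + 1) τ, u i := by
  rw [← Finset.sum_union, ← Finset.sum_union]
  · congr 1
    ext i
    simp only [Finset.mem_union, Finset.mem_Icc]
    omega
  · rw [Finset.disjoint_left]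
    intro i
    simp only [Finset.mem_union, Finset.mem_Icc]
    omega
  · rw [Finset.disjoint_left]
    intro i
    simp only [Finset.mem_Icc]
    omega

/-- Two large truncations share the block from `-M` to `M`, so they differ only by four outer
blocks, each of norm at most `ε / 5`. -/
theorem cauchy_map_sum_Icc {G : Type*} [SeminormedAddCommGroup G] {u : ℤ → G}
    (h : ∀ ε > 0, ∃ M : ℕ, ∀ σ τ : ℤ, σ ≤ τ → τ < -M ∨ M < σ →
      ‖∑ i ∈ Finset.Icc σ τ, u i‖ ≤ ε) :
    Cauchy (map (fun a : ℤ × ℤ => ∑ i ∈ Finset.Icc a.1 a.2, u i) (atBot ×ˢ atTop)) := by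
  rw [Metric.cauchy_iff]
  refine ⟨inferInstance, fun ε hε => ?_⟩
  obtain ⟨M, hM⟩ := h (ε / 5) (by positivity)
  have hM' : ∀ σ τ : ℤ, τ < -M ∨ M < σ → ‖∑ i ∈ Finset.Icc σ τ, u i‖ ≤ ε / 5 := by
    intro σ τ hστ
    rcases le_or_gt σ τ with h' | h'
    · exact hM σ τ h' hστ
    · rw [Finset.Icc_eq_empty h'.not_ge, Finset.sum_empty, norm_zero]
      positivity
  refine ⟨_, image_mem_map (prod_mem_prod (Iic_mem_atBot (-(M : ℤ))) (Ici_mem_atTop (M : ℤ))), ?_⟩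
  rintro _ ⟨⟨σ, τ⟩, ⟨h1, h2⟩, rfl⟩ _ ⟨⟨σ', τ'⟩, ⟨h1', h2'⟩, rfl⟩
  simp only [Set.mem_Iic, Set.mem_Ici] at h1 h2 h1' h2'
  simp only
  rw [sum_Icc_int_add_add u h1 (by omega : -(M : ℤ) ≤ M + 1) h2,
    sum_Icc_int_add_add u h1' (by omega : -(M : ℤ) ≤ M + 1) h2']
  have e1 := hM' σ (-M - 1) (Or.inl (by omega))
  have e2 := hM' σ' (-M - 1) (Or.inl (by omega))
  have e3 := hM' (M + 1) τ (Or.inr (by omega))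
  have e4 := hM' (M + 1) τ' (Or.inr (by omega))
  calc _ ≤ ‖∑ i ∈ Finset.Icc σ (-M - 1), u i‖ + ‖∑ i ∈ Finset.Icc σ' (-M - 1), u i‖ +
        (‖∑ i ∈ Finset.Icc ((M : ℤ) + 1) τ, u i‖ + ‖∑ i ∈ Finset.Icc ((M : ℤ) + 1) τ', u i‖) := by
        refine (dist_add_add_le _ _ _ _).trans (add_le_add ?_ (dist_le_norm_add_norm _ _))
        rw [dist_add_right]
        exact dist_le_norm_add_norm _ _
    _ < ε := by linarith

/-- By the uniform operator bound, the values at a nearby vector approximate all `T i f`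
simultaneously, so the Cauchy property passes to the closure. -/
theorem isClosed_setOf_cauchy_map_apply {𝕜 F G ι : Type*} [NontriviallyNormedField 𝕜]
    [SeminormedAddCommGroup F] [NormedSpace 𝕜 F] [SeminormedAddCommGroup G] [NormedSpace 𝕜 G]
    {l : Filter ι} [l.NeBot] {T : ι → F →L[𝕜] G} {C : ℝ} (hT : ∀ i, ‖T i‖ ≤ C) :
    IsClosed {f | Cauchy (map (fun i => T i f) l)} := by
  have hC : 0 ≤ C := (norm_nonneg _).trans (hT (nonempty_of_neBot l).some)
  refine isClosed_of_closure_subset fun f hf => ?_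
  rw [Set.mem_ofPred_eq, Metric.cauchy_iff]
  refine ⟨inferInstance, fun ε hε => ?_⟩
  obtain ⟨g, hg, hfg⟩ := Metric.mem_closure_iff.1 hf (ε / (3 * (C + 1))) (by positivity)
  obtain ⟨t, ht, h⟩ := (Metric.cauchy_iff.1 hg).2 (ε / 3) (by positivity)
  have hclose : ∀ i, dist (T i f) (T i g) ≤ ε / 3 := fun i => by
    rw [dist_eq_norm, ← map_sub]
    calc ‖T i (f - g)‖ ≤ C * ‖f - g‖ := (T i).le_of_opNorm_le (hT i) _
      _ ≤ (C + 1) * (ε / (3 * (C + 1))) := by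
          rw [← dist_eq_norm]
          gcongr
          linarith
      _ = ε / 3 := by field_simp
  refine ⟨_, image_mem_map (mem_map.1 ht), ?_⟩
  rintro _ ⟨i, hi, rfl⟩ _ ⟨j, hj, rfl⟩
  calc dist (T i f) (T j f) ≤ dist (T i f) (T i g) + dist (T i g) (T j g) + dist (T j g) (T j f) :=
        dist_triangle4 _ _ _ _
    _ < ε / 3 + ε / 3 + ε / 3 := by
        have h1 := hclose i
        have h2 := hclose j
        rw [dist_comm] at h2
        have h3 := h _ hi _ hj
        linarith
    _ = ε := by ring

/-! ### Paraproducts as operators on `L_s`, and the limit. -/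

namespace DyadicSystem

variable {E : Type u} [MetricSpace E] [MeasurableSpace E] {μ : Measure E} {δ r₀ r₁ : ℝ}
  {D : DyadicSystem μ δ r₀ r₁} {𝕜 : Type w} [RCLike 𝕜] {L : ℝ≥0}
  {X : Type v} [NormedAddCommGroup X] [NormedSpace ℝ X] [NormedSpace 𝕜 X] [IsScalarTower ℝ 𝕜 X]
  [CompleteSpace X]

omit [NormedSpace 𝕜 X] [IsScalarTower ℝ 𝕜 X] [CompleteSpace X] in
theorem cubeAvg_add {k : ℤ} {f g : E → X} (hf : ∀ Q ∈ D.cubes k, IntegrableOn f Q μ)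
    (hg : ∀ Q ∈ D.cubes k, IntegrableOn g Q μ) (x : E) :
    D.cubeAvg k (fun y => f y + g y) x = D.cubeAvg k f x + D.cubeAvg k g x := by
  by_cases hx : x ∈ D.goodSet
  · have hQ := (D.cube_mem_cubes (k := k) hx).1
    rw [cubeAvg, cubeAvg, cubeAvg, setAverage_eq, setAverage_eq, setAverage_eq,
      integral_add (hf _ hQ) (hg _ hQ), smul_add]
  · simp only [cubeAvg, D.cube_eq_empty hx, Measure.restrict_empty, average_zero_measure, add_zero]

omit [CompleteSpace X] in
theorem cubeAvg_const_smul (k : ℤ) (c : 𝕜) (f : E → X) (x : E) :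
    D.cubeAvg k (fun y => c • f y) x = c • D.cubeAvg k f x := by
  rw [cubeAvg, cubeAvg, setAverage_eq, setAverage_eq, integral_smul, smul_comm]

theorem cubeAvg_smul_const (k : ℤ) (f : E → 𝕜) (c : X) (x : E) :
    D.cubeAvg k (fun y => f y • c) x = D.cubeAvg k f x • c := by
  rw [cubeAvg, cubeAvg, setAverage_eq, setAverage_eq, integral_smul_const, smul_assoc]

theorem cubeParaproduct_smul_const (b : E → 𝕜) (σ : ℤ) (n : ℕ) (f : E → 𝕜) (c : X) (x : E) :
    D.cubeParaproduct b σ n (fun y => f y • c) x = D.cubeParaproduct b σ n f x • c := by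
  rw [cubeParaproduct, cubeParaproduct, Finset.sum_smul]
  refine Finset.sum_congr rfl fun j _ => ?_
  rw [cubeAvg_smul_const, smul_assoc]

omit [IsScalarTower ℝ 𝕜 X] [CompleteSpace X] in
theorem cubeParaproduct_congr_ae {b : E → 𝕜} {σ : ℤ} {n : ℕ} {f g : E → X} (h : f =ᵐ[μ] g) :
    D.cubeParaproduct b σ n f = D.cubeParaproduct b σ n g := by
  funext x
  simp only [cubeParaproduct, D.cubeAvg_congr_ae _ h]

/-- The summands of the paraproduct as operators. -/
theorem IsRegular.exists_continuousLinearMap_cubeDiff_smul_cubeAvg (hD : D.IsRegular L)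
    {b : E → 𝕜} (hb : D.MemBMO b) {s : ℝ≥0∞} [Fact (1 ≤ s)] (hs : s ≠ ∞) (k : ℤ) :
    ∃ A : Lp X s μ →L[𝕜] Lp X s μ, ∀ f : Lp X s μ,
      A f =ᵐ[μ] fun x => D.cubeDiff k b x • D.cubeAvg k f x := by
  have hs1 : 1 ≤ s := Fact.out
  have hm : ∀ f : Lp X s μ, MemLp (fun x => D.cubeDiff k b x • D.cubeAvg k f x) s μ := fun f =>
    hD.memLp_cubeDiff_smul hb k (hD.memLp_cubeAvg hs1 hs k (Lp.memLp f))
  have hint : ∀ f : Lp X s μ, ∀ Q ∈ D.cubes k, IntegrableOn f Q μ := fun f Q hQ =>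
    hD.integrableOn_of_memLp hQ hs1 (Lp.memLp f)
  set A₀ : Lp X s μ →ₗ[𝕜] Lp X s μ :=
    { toFun := fun f => (hm f).toLp _
      map_add' := fun f g => by
        rw [← MemLp.toLp_add]
        refine MemLp.toLp_congr _ _ (ae_of_all _ fun x => ?_)
        rw [Pi.add_apply, D.cubeAvg_congr_ae k (Lp.coeFn_add f g), ← smul_add,
          ← cubeAvg_add (hint f) (hint g)]
        rfl
      map_smul' := fun c f => by
        rw [RingHom.id_apply, ← MemLp.toLp_const_smul]
        refine MemLp.toLp_congr _ _ (ae_of_all _ fun x => ?_)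
        rw [Pi.smul_apply, D.cubeAvg_congr_ae k (Lp.coeFn_smul c f), smul_comm c,
          ← cubeAvg_const_smul]
        rfl }
  refine ⟨A₀.mkContinuous (L * (D.bmoNorm b).toReal) fun f => ?_, fun f => (hm f).coeFn_toLp⟩
  change ‖(hm f).toLp _‖ ≤ _
  rw [Lp.norm_toLp, Lp.norm_def, ← ENNReal.toReal_ofReal (by positivity :
    (0 : ℝ) ≤ L * (D.bmoNorm b).toReal), ← ENNReal.toReal_mul]
  refine ENNReal.toReal_mono (ENNReal.mul_ne_top ENNReal.ofReal_ne_top (Lp.memLp f).2.ne) ?_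
  calc _ ≤ ENNReal.ofReal (L * (D.bmoNorm b).toReal) * eLpNorm (D.cubeAvg k f) s μ :=
        eLpNorm_le_mul_eLpNorm_of_ae_le_mul (ae_of_all _ fun x => by
          rw [norm_smul]
          exact mul_le_mul_of_nonneg_right (hD.norm_cubeDiff_le hb k x) (norm_nonneg _)) s
    _ ≤ _ := by
        gcongr
        exact hD.eLpNorm_cubeAvg_le hs1 hs k (Lp.memLp f)

/-- The truncated paraproducts as operators. -/
theorem IsRegular.exists_continuousLinearMap_paraproduct (hD : D.IsRegular L)
    {b : E → 𝕜} (hb : D.MemBMO b) {s : ℝ≥0∞} [Fact (1 ≤ s)] (hs : s ≠ ∞) :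
    ∃ A : ℤ → Lp X s μ →L[𝕜] Lp X s μ, ∀ (σ τ : ℤ) (f : Lp X s μ),
      (∑ i ∈ Finset.Icc σ τ, A i) f =ᵐ[μ] D.paraproduct b σ τ f := by
  choose A hA using fun k => hD.exists_continuousLinearMap_cubeDiff_smul_cubeAvg (X := X) hb hs k
  refine ⟨A, fun σ τ f => ?_⟩
  rw [sum_apply]
  have h1 : ∀ᵐ x ∂μ, ∀ i : ℤ, A i f x = D.cubeDiff i b x • D.cubeAvg i f x :=
    ae_all_iff.2 fun i => hA i f
  filter_upwards [Lp.coeFn_fun_finsetSum (Finset.Icc σ τ) fun i => A i f, h1,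
    D.ae_mem_goodSet] with x h2 h3 hx
  rw [h2, paraproduct]
  refine Finset.sum_congr rfl fun i _ => ?_
  rw [h3, cubeDiff, diff, D.avg_eq_cubeAvg _ _ hx, D.avg_eq_cubeAvg _ _ hx,
    D.avg_eq_cubeAvg _ _ hx]

/-- Convergence of the paraproduct series for indicator functions. -/
theorem IsRegular.cauchy_map_paraproduct_indicator (hD : D.IsRegular L) {b : E → 𝕜}
    (hb : D.MemBMO b) {s : ℝ≥0∞} [Fact (1 ≤ s)] (hs1 : 1 < s) (hs : s ≠ ∞)
    {A : ℤ → Lp X s μ →L[𝕜] Lp X s μ} (hA : ∀ (σ τ : ℤ) (f : Lp X s μ),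
      (∑ i ∈ Finset.Icc σ τ, A i) f =ᵐ[μ] D.paraproduct b σ τ f)
    {S : Set E} (hS : MeasurableSet S) (hμS : μ S ≠ ∞) (c : X) :
    Cauchy (map (fun a : ℤ × ℤ => (∑ i ∈ Finset.Icc a.1 a.2, A i) (indicatorConstLp s hS hμS c))
      (atBot ×ˢ atTop)) := by
  set F := indicatorConstLp s hS hμS c
  -- The function is `g` times the fixed vector `c`, and the paraproduct acts on `g` alone, so the
  -- scalar smallness of blocks suffices.
  set g : E → 𝕜 := S.indicator fun _ => 1 with hg
  have hFg : F =ᵐ[μ] fun y => g y • c := by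
    filter_upwards [indicatorConstLp_coeFn (p := s) (hs := hS) (hμs := hμS) (c := c)] with x hx
    rw [hx, hg]
    by_cases h : x ∈ S <;> simp [h]
  simp only [sum_apply]
  refine cauchy_map_sum_Icc fun ε hε => ?_
  obtain ⟨M, hM⟩ := hD.exists_forall_eLpNorm_cubeParaproduct_le hb hs1 hs (f := g) zero_le_one
    (fun x => by by_cases h : x ∈ S <;> simp [hg, h])
    (fun t => memLp_indicator_const t hS 1 (Or.inr hμS))
    (ENNReal.ofReal_pos.2 (by positivity : 0 < ε / (‖c‖ + 1)))
  refine ⟨M, fun σ τ hστ hM' => ?_⟩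
  have h1 := hM σ (τ - σ + 1).toNat (by omega)
  have h2 : (∑ i ∈ Finset.Icc σ τ, A i F : Lp X s μ) =ᵐ[μ]
      fun x => D.cubeParaproduct b σ (τ - σ + 1).toNat g x • c := by
    have h3 := (hA σ τ F).trans (D.paraproduct_ae_eq b σ τ F)
    rw [sum_apply, cubeParaproduct_congr_ae hFg] at h3
    filter_upwards [h3] with x hx
    rw [hx, cubeParaproduct_smul_const]
  rw [Lp.norm_def, eLpNorm_congr_ae h2]
  refine ENNReal.toReal_le_of_le_ofReal hε.le ?_
  calc _ ≤ ENNReal.ofReal ‖c‖ * eLpNorm (D.cubeParaproduct b σ (τ - σ + 1).toNat g) s μ :=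
        eLpNorm_le_mul_eLpNorm_of_ae_le_mul (ae_of_all _ fun x => by
          rw [norm_smul, mul_comm]) s
    _ ≤ ENNReal.ofReal ‖c‖ * ENNReal.ofReal (ε / (‖c‖ + 1)) := by gcongr
    _ ≤ ENNReal.ofReal ε := by
        rw [← ENNReal.ofReal_mul (norm_nonneg _)]
        refine ENNReal.ofReal_le_ofReal ?_
        rw [mul_div_assoc', div_le_iff₀ (by positivity)]
        nlinarith [norm_nonneg c]

/-- The paraproduct as a limit of truncated paraproducts under martingale type `2`. -/
theorem exists_paraproduct_limit (hT : HasMartingaleType.{u} X 2) {s : ℝ≥0∞} [Fact (1 ≤ s)]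
    (hs1 : 1 < s) (hs : s ≠ ∞) (L : ℝ≥0) :
    ∃ C : ℝ≥0, ∀ (E : Type u) [MetricSpace E] [MeasurableSpace E] (μ : Measure E) (δ r₀ r₁ : ℝ)
      (D : DyadicSystem μ δ r₀ r₁), D.IsRegular L → ∀ b : E → 𝕜, D.MemBMO b →
      ∃ T : Lp X s μ →L[𝕜] Lp X s μ, ‖T‖ ≤ C * (D.bmoNorm b).toReal ∧ ∀ f : Lp X s μ,
        Tendsto (fun a : ℤ × ℤ => eLpNorm (fun x => D.paraproduct b a.1 a.2 f x - T f x) s μ)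
          (atBot ×ˢ atTop) (𝓝 0) := by
  obtain ⟨C, hC⟩ := exists_eLpNorm_paraproduct_le (𝕜 := 𝕜) one_le_two le_rfl hT hs1 hs L
  refine ⟨C, fun E _ _ μ δ r₀ r₁ D hD b hb => ?_⟩
  obtain ⟨A, hA⟩ := hD.exists_continuousLinearMap_paraproduct (X := X) hb hs
  set T : ℤ × ℤ → Lp X s μ →L[𝕜] Lp X s μ := fun a => ∑ i ∈ Finset.Icc a.1 a.2, A i with hTdef
  have hK : 0 ≤ C * (D.bmoNorm b).toReal := by positivity
  have hTn : ∀ a, ‖T a‖ ≤ C * (D.bmoNorm b).toReal := by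
    intro a
    refine ContinuousLinearMap.opNorm_le_bound _ hK fun f => ?_
    rcases le_or_gt a.1 a.2 with h | h
    · have h1 := (hC E μ δ r₀ r₁ D hD b hb a.1 a.2 h f (Lp.memLp f)).2
      -- At `p = 2` the exponent `1/p - 1/2` is zero, which makes the bound uniform over all
      -- truncations.
      rw [← eLpNorm_congr_ae (hA a.1 a.2 f), sub_self, Real.rpow_zero, ENNReal.ofReal_one,
        mul_one] at h1
      have h2 := ENNReal.toReal_mono (ENNReal.mul_ne_top (ENNReal.mul_ne_top ENNReal.coe_ne_top
        hb.bmoNorm_lt_top.ne) (Lp.memLp f).2.ne) h1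
      rwa [ENNReal.toReal_mul, ENNReal.toReal_mul, ENNReal.coe_toReal] at h2
    · simp only [hTdef, Finset.Icc_eq_empty h.not_ge, Finset.sum_empty, zero_apply, norm_zero]
      positivity
  have hlim : ∀ f : Lp X s μ, Cauchy (map (fun a => T a f) (atBot ×ˢ atTop)) := by
    -- Convergence holds for indicators times vectors and for sums, and passes to limits by the
    -- uniform bound; these exhaust `L_s` for finite `s`.
    refine Lp.induction hs _ (fun c S hS hμS => ?_) (fun f g hf hg _ h1 h2 => ?_)
      (isClosed_setOf_cauchy_map_apply hTn)
    · exact hD.cauchy_map_paraproduct_indicator hb hs1 hs hA hS hμS.ne c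
    · rw [cauchy_map_iff_exists_tendsto] at h1 h2 ⊢
      obtain ⟨y, hy⟩ := h1
      obtain ⟨z, hz⟩ := h2
      refine ⟨y + z, ?_⟩
      simp only [map_add]
      exact hy.add hz
  choose T₀ hT₀ using fun f => cauchy_map_iff_exists_tendsto.1 (hlim f)
  set T₁ : Lp X s μ →ₗ[𝕜] Lp X s μ := linearMapOfTendsto T₀
    (fun a => (T a : Lp X s μ →ₗ[𝕜] Lp X s μ))
    (tendsto_pi_nhds.2 hT₀)
  have hb1 : ∀ f, ‖T₁ f‖ ≤ C * (D.bmoNorm b).toReal * ‖f‖ := fun f =>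
    le_of_tendsto (hT₀ f).norm (Eventually.of_forall fun a => (T a).le_of_opNorm_le (hTn a) f)
  refine ⟨T₁.mkContinuous _ hb1, T₁.mkContinuous_norm_le hK hb1, fun f => ?_⟩
  have h1 := tendsto_iff_edist_tendsto_0.1 (hT₀ f)
  refine h1.congr fun a => ?_
  rw [Lp.edist_def]
  refine eLpNorm_congr_ae ?_
  filter_upwards [hA a.1 a.2 f] with x hx
  rw [Pi.sub_apply, hx]
  rfl

end DyadicSystem

end

/-! ### The main theorem. -/

theorem mainTheorem2 {𝕜 : Type w} [RCLike 𝕜] {X : Type v} [NormedAddCommGroup X]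
    [NormedSpace ℝ X] [NormedSpace 𝕜 X] [IsScalarTower ℝ 𝕜 X] [CompleteSpace X]
    (s : ℝ≥0∞) [Fact (1 ≤ s)] (hs : 1 < s) (hs_top : s ≠ ∞)
    (c : ℝ≥0) (δ r₀ r₁ : ℝ) (hδ₀ : 0 < δ) (hδ₁ : δ < 1) (hr₀ : 0 < r₀) (hr₁ : 0 < r₁) :
    -- the truncated paraproduct under martingale type `p`
    (∀ p : ℝ, 1 ≤ p → p ≤ 2 → HasMartingaleType.{u} X p →
      ∃ C : ℝ≥0, ∀ (E : Type u) [MetricSpace E] [MeasurableSpace E] [BorelSpace E]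
        (μ : Measure E), IsDoublingMeasure μ c →
        ∀ (D : DyadicSystem μ δ r₀ r₁) (b : E → 𝕜), D.MemBMO b →
        ∀ (σ τ : ℤ), σ ≤ τ → ∀ f : E → X, MemLp f s μ →
          MemLp (D.paraproduct b σ τ f) s μ ∧
          eLpNorm (D.paraproduct b σ τ f) s μ ≤
            C * ENNReal.ofReal (((τ - σ + 1 : ℤ) : ℝ) ^ (1 / p - 1 / 2))
              * D.bmoNorm b * eLpNorm f s μ) ∧
    -- the paraproduct without truncation under martingale type `2`
    (HasMartingaleType.{u} X 2 →
      ∃ C : ℝ≥0, ∀ (E : Type u) [MetricSpace E] [MeasurableSpace E] [BorelSpace E]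
        (μ : Measure E), IsDoublingMeasure μ c →
        ∀ (D : DyadicSystem μ δ r₀ r₁) (b : E → 𝕜), D.MemBMO b →
        ∃ T : Lp X s μ →L[𝕜] Lp X s μ,
          ‖T‖ ≤ C * (D.bmoNorm b).toReal ∧
          ∀ f : Lp X s μ,
            Tendsto (fun στ : ℤ × ℤ =>
                eLpNorm (fun x => D.paraproduct b στ.1 στ.2 f x - T f x) s μ)
              (atBot ×ˢ atTop) (𝓝 0)) ∧
    -- the truncated dual paraproduct under martingale cotype `q`, and its duality relation
    (∀ q : ℝ, 2 ≤ q → HasMartingaleCotype.{u} X q →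
      ∃ C : ℝ≥0, ∀ (E : Type u) [MetricSpace E] [MeasurableSpace E] [BorelSpace E]
        (μ : Measure E), IsDoublingMeasure μ c →
        ∀ (D : DyadicSystem μ δ r₀ r₁) (b : E → 𝕜), D.MemBMO b →
        ∀ (σ τ : ℤ), σ ≤ τ → ∀ f : E → X, MemLp f s μ →
          MemLp (D.dualParaproduct b σ τ f) s μ ∧
          eLpNorm (D.dualParaproduct b σ τ f) s μ ≤
            C * ENNReal.ofReal (((τ - σ + 1 : ℤ) : ℝ) ^ (1 / 2 - 1 / q))
              * D.bmoNorm b * eLpNorm f s μ ∧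
          ∀ s' : ℝ≥0∞, ENNReal.HolderConjugate s s' →
            ∀ g : E → StrongDual 𝕜 X, MemLp g s' μ →
              ∫ x, g x (D.dualParaproduct b σ τ f x) ∂μ =
                ∫ x, (D.paraproduct b σ τ g x) (f x) ∂μ) := by
  -- The geometry enters all constants only through `L`, which is fixed by `c`, `δ`, `r₀` and `r₁`
  -- before the space and the cubes are given.
  obtain ⟨L, hL⟩ := DyadicSystem.exists_isRegular.{u} c (r₁ := r₁) hδ₀ hr₀
  refine ⟨fun p hp1 hp2 hT => ?_, fun hT => ?_, fun q hq hX => ?_⟩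
  · obtain ⟨C, hC⟩ :=
      DyadicSystem.exists_eLpNorm_paraproduct_le (𝕜 := 𝕜) hp1 hp2 hT hs hs_top L
    exact ⟨C, fun E _ _ _ μ hμ D b hb => hC E μ δ r₀ r₁ D (hL E μ hμ D) b hb⟩
  · obtain ⟨C, hC⟩ := DyadicSystem.exists_paraproduct_limit (𝕜 := 𝕜) hT hs hs_top L
    exact ⟨C, fun E _ _ _ μ hμ D b hb => hC E μ δ r₀ r₁ D (hL E μ hμ D) b hb⟩
  · obtain ⟨C, hC⟩ := DyadicSystem.exists_eLpNorm_dualParaproduct_le (𝕜 := 𝕜) hq hX hs hs_top L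
    exact ⟨C, fun E _ _ _ μ hμ D b hb => hC E μ δ r₀ r₁ D (hL E μ hμ D) b hb⟩
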